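/- Let $M$ be a smooth manifold with a pseudo-Riemannian metric $\tilde g$ with cometric $g(\alpha,\beta)=\tilde g(\sharp_{\tilde g}\alpha,\sharp_{\tilde g}\beta)$, and a bivector field $\Pi$ (not assumed Poisson), with anchor $\sharp_\Pi$, $\beta(\sharp_\Pi\alpha)=\Pi(\alpha,\beta)$, and Koszul bracket $[\alpha,\beta]_\Pi=\mathcal L_{\sharp_\Pi\alpha}\beta-\mathcal L_{\sharp_\Pi\beta}\alpha-d(\Pi(\alpha,\beta))$. The Levi-Civita contravariant connection $\mathcal D$ of $(g,\Pi)$ is the unique $\mathbb R$-bilinear map $\Gamma(T^*M)\times\Gamma(T^*M)\to\Gamma(T^*M)$ with $$\mathcal D_{\varphi\alpha}\beta=\varphi\,\mathcal D_\alpha\beta,\quad \mathcal D_\alpha(\varphi\beta)=\varphi\,\mathcal D_\alpha\beta+\sharp_\Pi(\alpha)(\varphi)\,\beta,\quad \sharp_\Pi(\alpha)\cdot g(\beta,\gamma)=g(\mathcal D_\alpha\beta,\gamma)+g(\beta,\mathcal D_\alpha\gamma),\quad \mathcal D_\alpha\beta-\mathcal D_\beta\alpha=[\alpha,\beta]_\Pi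 ;$$ it acts on functions by $\mathcal D_\alpha\varphi=\sharp_\Pi(\alpha)(\varphi)$ and on vector fields and $2$-forms by the usual Leibniz rules. Its curvature is $\mathcal R(\alpha,\beta)=\mathcal D_\alpha\mathcal D_\beta-\mathcal D_\beta\mathcal D_\alpha-\mathcal D_{[\alpha,\beta]_\Pi}$. Its generalized pre-Poisson bracket is the $\mathbb R$-bilinear bracket on differential forms with $\{\varphi,\eta\}=\mathcal D_{d\varphi}\eta$ for functions $\varphi$ that satisfies $$\{\omega,\eta\}=-(-1)^{\deg\omega\deg\eta}\{\eta,\omega\},\quad d\{\omega,\eta\}=\{d\omega,\eta\}+(-1)^{\deg\omega}\{\omega,d\eta\},\quad \{\omega,\eta\wedge\lambda\}=\{\omega,\eta\}\wedge\lambda+(-1)^{\deg\omega\deg\eta}\eta\wedge\{\omega,\lambda\}.$$ The triple $(M,g,\Pi)$ is called metaflat if $\mathcal R=0$ and the metacurvature $$\mathcal M(d\varphi,\alpha,\beta)=\{\varphi,\{\alpha,\beta\}\}-\{\{\varphi,\alpha\},\beta\}-\{\{\varphi,\beta\},\alpha\}$$ vanishes for all smooth functions $\varphi$ and all $1$-forms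 $\alpha,\beta$. **Theorem.** Let $(M_1,\tilde g_1)$ and $(M_2,\tilde g_2)$ be nonempty pseudo-Riemannian manifolds with cometrics $g_1,g_2$, let $\Pi_1,\Pi_2$ be bivector fields on $M_1,M_2$, let $f$ be a positive smooth function on $M_1$ that is Casimir, i.e. $\sharp_{\Pi_1}(df)=0$, and let $\mu$ be a smooth function on $M_1$ that is not identically zero and is essentially constant, i.e. constant on each connected component of $M_1$. On $M_1\times M_2$ consider the contravariant metric $g^f=g_1^h+f^hg_2^v$ and the bivector field $\Pi^\mu=\Pi_1^h+\mu^h\Pi_2^v$, where $h$ and $v$ denote the horizontal and vertical lifts to $M_1\times M_2$ from $M_1$ and $M_2$. Then $(M_1\times M_2,g^f,\Pi^\mu)$ is metaflat if and only if $(M_1,g_1,\Pi_1)$ and $(M_2,g_2,\Pi_2)$ are both metaflat. -/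

import Mathlib

open Set Bundle
open scoped Manifold ContDiff Topology

set_option maxSynthPendingDepth 3

noncomputable section

namespace PoissonGeometry

section SingleManifold

variable {E : Type*} [NormedAddCommGroup E] [NormedSpace ℝ E]
  {H : Type*} [TopologicalSpace H] (I : ModelWithCorners ℝ E H)
  (M : Type*) [TopologicalSpace M] [ChartedSpace H M]

/-! ### Tensor fields -/

/-- Vector fields on `M` (not necessarily smooth). -/
abbrev VField := Π x : M, TangentSpace I x

/-- Fields of covectors on `M` (not necessarily smooth). -/
abbrev OneForm := Π x : M, TangentSpace I x →L[ℝ] ℝ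

/-- Fields of bilinear forms on the tangent spaces of `M` (not necessarily smooth). -/
abbrev CovTwoTensor := Π x : M, TangentSpace I x →L[ℝ] TangentSpace I x →L[ℝ] ℝ

/-- Fields of bilinear forms on the cotangent spaces of `M` (not necessarily smooth). -/
abbrev ContraTwoTensor :=
  Π x : M, (TangentSpace I x →L[ℝ] ℝ) →L[ℝ] (TangentSpace I x →L[ℝ] ℝ) →L[ℝ] ℝ

variable {M}

/-- Smooth functions, `C^∞(M)`. -/
def SmoothFun (φ : M → ℝ) : Prop := ContMDiff I 𝓘(ℝ, ℝ) ∞ φ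

variable {I}

section Smooth

variable [IsManifold I ∞ M]

/-- Smooth vector fields: smooth sections of the tangent bundle. -/
def SmoothVField (X : VField I M) : Prop :=
  ContMDiff I (I.prod 𝓘(ℝ, E)) ∞ (fun x => TotalSpace.mk' E x (X x))

/-- Smooth `1`-forms: smooth sections of the cotangent bundle. -/
def SmoothOneForm (α : OneForm I M) : Prop :=
  ContMDiff I (I.prod 𝓘(ℝ, E →L[ℝ] ℝ)) ∞ (fun x => TotalSpace.mk' (E →L[ℝ] ℝ) x (α x))

/-- Smooth covariant `2`-tensor fields: smooth sections of `T*M ⊗ T*M`. -/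
def SmoothCovTwoTensor (η : CovTwoTensor I M) : Prop :=
  ContMDiff I (I.prod 𝓘(ℝ, E →L[ℝ] E →L[ℝ] ℝ)) ∞
    (fun x => TotalSpace.mk' (E →L[ℝ] E →L[ℝ] ℝ) x (η x))

/-- Smooth contravariant `2`-tensor fields: smooth sections of `TM ⊗ TM`. -/
def SmoothContraTwoTensor (Q : ContraTwoTensor I M) : Prop :=
  ContMDiff I (I.prod 𝓘(ℝ, (E →L[ℝ] ℝ) →L[ℝ] (E →L[ℝ] ℝ) →L[ℝ] ℝ)) ∞
    (fun x => TotalSpace.mk' ((E →L[ℝ] ℝ) →L[ℝ] (E →L[ℝ] ℝ) →L[ℝ] ℝ) x (Q x))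

/-- Smooth differential `2`-forms: smooth alternating covariant `2`-tensor fields. -/
def SmoothTwoForm (η : CovTwoTensor I M) : Prop :=
  SmoothCovTwoTensor η ∧ ∀ (x : M) (u : TangentSpace I x), η x u u = 0

end Smooth

/-! ### Exterior calculus in degrees at most two -/

/-- The differential `dφ` of a function. -/
def dFun (φ : M → ℝ) : OneForm I M := fun x => mfderiv I 𝓘(ℝ, ℝ) φ x

/-- The wedge product of two `1`-forms,
`(α ∧ β)(u, v) = α(u) β(v) - α(v) β(u)`. -/
def wedge (α β : OneForm I M) : CovTwoTensor I M := fun x =>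
  (α x).smulRight (β x) - (β x).smulRight (α x)

/-- The expression of a `1`-form in the chart at `x₀`: its pullback under the inverse chart. -/
def chartRep (x₀ : M) (α : OneForm I M) (y : E) : E →L[ℝ] ℝ :=
  (α ((extChartAt I x₀).symm y)).comp
    (mfderivWithin 𝓘(ℝ, E) I (extChartAt I x₀).symm (range I) y)

/-- The exterior derivative `dα` of a `1`-form: at `x`, read `α` in the chart at `x`, form
`(u, v) ↦ ∂ᵤ α(v) - ∂ᵥ α(u)`, and pull the result back to `M`. -/
def dOne (α : OneForm I M) : CovTwoTensor I M := fun x =>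
  let A : E →L[ℝ] E →L[ℝ] ℝ := fderivWithin ℝ (chartRep x α) (range I) (extChartAt I x x)
  let T : TangentSpace I x →L[ℝ] E := mfderiv I 𝓘(ℝ, E) (extChartAt I x) x
  ((ContinuousLinearMap.precomp ℝ T).comp (A - A.flip)).comp T

/-- The Lie derivative of a `1`-form, by Cartan's formula `L_X β = i_X dβ + d (β(X))`. -/
def lieDerivOne (X : VField I M) (β : OneForm I M) : OneForm I M := fun x =>
  dOne β x (X x) + dFun (fun y => β y (X y)) x

/-! ### Bivector fields, the anchor map and the Koszul bracket -/

section Anchor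

variable [FiniteDimensional ℝ E]

instance (x : M) : FiniteDimensional ℝ (TangentSpace I x) :=
  inferInstanceAs (FiniteDimensional ℝ E)

instance (x : M) : T2Space (TangentSpace I x) :=
  inferInstanceAs (T2Space E)

/-- For a contravariant tensor `Q` and a covector `a` at `x`, the tangent vector `♯_Q(a)` at `x`
determined by `b(♯_Q(a)) = Q(a, b)` for all covectors `b` at `x`. -/
def sharpAt (Q : ContraTwoTensor I M) (x : M) (a : TangentSpace I x →L[ℝ] ℝ) :
    TangentSpace I x :=
  (Module.evalEquiv ℝ (TangentSpace I x)).symm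
    ((Q x a).toLinearMap ∘ₗ
      (LinearMap.toContinuousLinearMap :
        (TangentSpace I x →ₗ[ℝ] ℝ) ≃ₗ[ℝ] (TangentSpace I x →L[ℝ] ℝ)).toLinearMap)

theorem apply_sharpAt (Q : ContraTwoTensor I M) (x : M) (a b : TangentSpace I x →L[ℝ] ℝ) :
    b (sharpAt Q x a) = Q x a b := by
  have h := Module.apply_evalEquiv_symm_apply (R := ℝ) (M := TangentSpace I x)
    (b : TangentSpace I x →ₗ[ℝ] ℝ)
    ((Q x a).toLinearMap ∘ₗ
      (LinearMap.toContinuousLinearMap :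
        (TangentSpace I x →ₗ[ℝ] ℝ) ≃ₗ[ℝ] (TangentSpace I x →L[ℝ] ℝ)).toLinearMap)
  exact h

/-- The anchor map on `1`-forms. -/
def sharp (P : ContraTwoTensor I M) (α : OneForm I M) : VField I M := fun x => sharpAt P x (α x)

/-- The derivative `♯_P(α)(φ)` of a function `φ` along the vector field `♯_P(α)`. -/
def anchorDeriv (P : ContraTwoTensor I M) (α : OneForm I M) (φ : M → ℝ) : M → ℝ := fun x =>
  dFun φ x (sharp P α x)

/-- The function `Q(α, β)`. -/
def pairing (Q : ContraTwoTensor I M) (α β : OneForm I M) : M → ℝ := fun x => Q x (α x) (β x)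

/-- The Koszul bracket
`[α, β]_P = L_{♯α} β - L_{♯β} α - d (P(α, β))`. -/
def koszulBracket (P : ContraTwoTensor I M) (α β : OneForm I M) : OneForm I M := fun x =>
  lieDerivOne (sharp P α) β x - lieDerivOne (sharp P β) α x - dFun (pairing P α β) x

/-- A function is Casimir if its Hamiltonian vector field `♯_P(dφ)` vanishes. -/
def IsCasimir (P : ContraTwoTensor I M) (φ : M → ℝ) : Prop := ∀ x, sharp P (dFun φ) x = 0

variable [IsManifold I ∞ M]

/-! ### Contravariant connections -/

/-- `D` restricts to a contravariant connection on smooth `1`-forms with respect to `P`.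
(Homogeneity over `ℝ` in each variable is the case of a constant function `φ`.) -/
structure IsContravariantConnection (P : ContraTwoTensor I M)
    (D : OneForm I M → OneForm I M → OneForm I M) : Prop where
  smooth : ∀ α β, SmoothOneForm α → SmoothOneForm β → SmoothOneForm (D α β)
  add_left : ∀ α α' β, SmoothOneForm α → SmoothOneForm α' → SmoothOneForm β →
    D (α + α') β = D α β + D α' β
  add_right : ∀ α β β', SmoothOneForm α → SmoothOneForm β → SmoothOneForm β' →
    D α (β + β') = D α β + D α β'
  smul_left : ∀ (φ : M → ℝ) (α β), SmoothFun I φ → SmoothOneForm α → SmoothOneForm β →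
    D (fun x => φ x • α x) β = fun x => φ x • D α β x
  leibniz : ∀ (φ : M → ℝ) (α β), SmoothFun I φ → SmoothOneForm α → SmoothOneForm β →
    D α (fun x => φ x • β x) = fun x => φ x • D α β x + anchorDeriv P α φ x • β x

/-- `D` is the Levi-Civita contravariant connection of the pair `(g, P)`, where `g` is a
contravariant metric: a contravariant connection that is torsion-free and for which `g` is
parallel. -/
structure IsLeviCivita (g P : ContraTwoTensor I M)
    (D : OneForm I M → OneForm I M → OneForm I M) : Prop
    extends IsContravariantConnection P D where
  parallel : ∀ α β γ, SmoothOneForm α → SmoothOneForm β → SmoothOneForm γ → ∀ x,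
    anchorDeriv P α (pairing g β γ) x = pairing g (D α β) γ x + pairing g β (D α γ) x
  torsionFree : ∀ α β, SmoothOneForm α → SmoothOneForm β →
    D α β - D β α = koszulBracket P α β

/-- The curvature `R(α, β)γ = D_α D_β γ - D_β D_α γ - D_{[α, β]} γ`. -/
def curvature (P : ContraTwoTensor I M) (D : OneForm I M → OneForm I M → OneForm I M)
    (α β γ : OneForm I M) : OneForm I M :=
  D α (D β γ) - D β (D α γ) - D (koszulBracket P α β) γ

/-- Flatness of a contravariant connection. -/
def IsFlat (P : ContraTwoTensor I M) (D : OneForm I M → OneForm I M → OneForm I M) : Prop :=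
  ∀ α β γ, SmoothOneForm α → SmoothOneForm β → SmoothOneForm γ → curvature P D α β γ = 0

/-- The contravariant derivative `D_α X` of a vector field: the vector field with
`β(D_α X) = ♯α(β(X)) - (D_α β)(X)` for all smooth `1`-forms `β`. -/
def derivVField (P : ContraTwoTensor I M) (D : OneForm I M → OneForm I M → OneForm I M)
    (α : OneForm I M) (X : VField I M) : VField I M := fun x =>
  Classical.epsilon fun v : TangentSpace I x =>
    ∀ β : OneForm I M, SmoothOneForm β →
      β x v = anchorDeriv P α (fun y => β y (X y)) x - D α β x (X x)

/-- The contravariant derivative `D_α η` of a `2`-form: the covariant tensor field with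
`(D_α η)(X, Y) = ♯α(η(X, Y)) - η(D_α X, Y) - η(X, D_α Y)` for all smooth vector fields
`X` and `Y`. -/
def derivTwoForm (P : ContraTwoTensor I M) (D : OneForm I M → OneForm I M → OneForm I M)
    (α : OneForm I M) (η : CovTwoTensor I M) : CovTwoTensor I M := fun x =>
  Classical.epsilon fun θ : TangentSpace I x →L[ℝ] TangentSpace I x →L[ℝ] ℝ =>
    ∀ X Y : VField I M, SmoothVField X → SmoothVField Y →
      θ (X x) (Y x) = anchorDeriv P α (fun y => η y (X y) (Y y)) x
        - η x (derivVField P D α X x) (Y x) - η x (X x) (derivVField P D α Y x)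

/-! ### The generalized pre-Poisson bracket and the metacurvature -/

/-- `B` is the bracket `{α, β}` of two smooth `1`-forms in the generalized pre-Poisson bracket
associated with `D`. The generalized pre-Poisson bracket is the `ℝ`-bilinear bracket on
differential forms with `{φ, η} = D_{dφ} η` for a function `φ` and a form `η` that is graded
antisymmetric, has `d` as a derivation, and obeys the graded product rule. For `1`-forms these say:
`{α, β} = {β, α}` (antisymmetry, both degrees being odd);
`{dφ, β} = d {φ, β} - {φ, dβ}`, that is, `d (D_{dφ} β) - D_{dφ} (dβ)`;
and `{α, φ β} = {α, φ} ∧ β + φ {α, β}` with `{α, φ} = - {φ, α} = - D_{dφ} α`.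
They determine `{α, β}`, as every `1`-form is locally a sum of terms `φ dψ`. -/
structure IsOneFormBracket (P : ContraTwoTensor I M)
    (D : OneForm I M → OneForm I M → OneForm I M)
    (B : OneForm I M → OneForm I M → CovTwoTensor I M) : Prop where
  smooth : ∀ α β, SmoothOneForm α → SmoothOneForm β → SmoothTwoForm (B α β)
  add_right : ∀ α β β', SmoothOneForm α → SmoothOneForm β → SmoothOneForm β' →
    B α (β + β') = B α β + B α β'
  symm : ∀ α β, SmoothOneForm α → SmoothOneForm β → B α β = B β α
  differential : ∀ (φ : M → ℝ) (β), SmoothFun I φ → SmoothOneForm β →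
    dOne (D (dFun φ) β) = B (dFun φ) β + derivTwoForm P D (dFun φ) (dOne β)
  product : ∀ (φ : M → ℝ) (α β), SmoothFun I φ → SmoothOneForm α → SmoothOneForm β →
    B α (fun x => φ x • β x) =
      fun x => wedge (-(D (dFun φ) α)) β x + φ x • B α β x

/-- The metacurvature
`M(dφ, α, β) = {φ, {α, β}} - {{φ, α}, β} - {{φ, β}, α}`, with `{φ, η} = D_{dφ} η`. -/
def metacurvature (P : ContraTwoTensor I M) (D : OneForm I M → OneForm I M → OneForm I M)
    (B : OneForm I M → OneForm I M → CovTwoTensor I M) (φ : M → ℝ) (α β : OneForm I M) :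
    CovTwoTensor I M :=
  derivTwoForm P D (dFun φ) (B α β) - B (D (dFun φ) α) β - B (D (dFun φ) β) α

/-- The triple `(M, g, P)` is metaflat: the Levi-Civita contravariant connection `D` of `(g, P)`
is flat, and its metacurvature, formed with the generalized pre-Poisson bracket associated
with `D`, vanishes. -/
def IsMetaflat (g P : ContraTwoTensor I M) : Prop :=
  ∃ D : OneForm I M → OneForm I M → OneForm I M, IsLeviCivita g P D ∧ IsFlat P D ∧
    ∃ B : OneForm I M → OneForm I M → CovTwoTensor I M, IsOneFormBracket P D B ∧
      ∀ (φ : M → ℝ) (α β : OneForm I M), SmoothFun I φ → SmoothOneForm α → SmoothOneForm β →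
        metacurvature P D B φ α β = 0

end Anchor

/-! ### Pseudo-Riemannian metrics and bivector fields -/

variable (I M) [IsManifold I ∞ M]

/-- A pseudo-Riemannian metric: a smooth field of symmetric nondegenerate bilinear forms. -/
structure PseudoRiemannianMetric where
  form : CovTwoTensor I M
  smooth : SmoothCovTwoTensor form
  symm : ∀ (x : M) (u v : TangentSpace I x), form x u v = form x v u
  nondegenerate : ∀ (x : M) (u : TangentSpace I x), (∀ v, form x u v = 0) → u = 0

/-- A bivector field: a smooth field of alternating bilinear forms on the cotangent spaces. -/
structure BivectorField where
  form : ContraTwoTensor I M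
  smooth : SmoothContraTwoTensor form
  alternating : ∀ (x : M) (a : TangentSpace I x →L[ℝ] ℝ), form x a a = 0

variable {I M}

/-- The cometric `g(a, b) = g̃(♯a, ♯b)`, where `♯` is the inverse of the musical isomorphism
`u ↦ g̃(u, ·)`. -/
def PseudoRiemannianMetric.cometric (g : PseudoRiemannianMetric I M) : ContraTwoTensor I M :=
  fun x =>
    let s : (TangentSpace I x →L[ℝ] ℝ) →L[ℝ] TangentSpace I x := (g.form x).inverse
    ((ContinuousLinearMap.precomp ℝ s).comp (g.form x)).comp s

end SingleManifold

section Product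

variable {E₁ : Type*} [NormedAddCommGroup E₁] [NormedSpace ℝ E₁]
  {H₁ : Type*} [TopologicalSpace H₁] {I₁ : ModelWithCorners ℝ E₁ H₁}
  {M₁ : Type*} [TopologicalSpace M₁] [ChartedSpace H₁ M₁]
  {E₂ : Type*} [NormedAddCommGroup E₂] [NormedSpace ℝ E₂]
  {H₂ : Type*} [TopologicalSpace H₂] {I₂ : ModelWithCorners ℝ E₂ H₂}
  {M₂ : Type*} [TopologicalSpace M₂] [ChartedSpace H₂ M₂]

/-- The horizontal lift of tangent vectors of `M₁` to the point `z` of `M₁ × M₂`. -/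
def hLiftVec (z : M₁ × M₂) : TangentSpace I₁ z.1 →L[ℝ] TangentSpace (I₁.prod I₂) z :=
  mfderiv I₁ (I₁.prod I₂) (fun p : M₁ => (p, z.2)) z.1

/-- The vertical lift of tangent vectors of `M₂` to the point `z` of `M₁ × M₂`. -/
def vLiftVec (z : M₁ × M₂) : TangentSpace I₂ z.2 →L[ℝ] TangentSpace (I₁.prod I₂) z :=
  mfderiv I₂ (I₁.prod I₂) (fun q : M₂ => (z.1, q)) z.2

/-- The horizontal lift `Q^h` of a contravariant tensor on `M₁`: covectors of `M₁ × M₂` are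
restricted to horizontal vectors and inserted into `Q`, so that
`Q^h(α^h, β^h) = Q(α, β)^h` and `Q^h` vanishes when an argument is vertical. -/
def hLiftContra (Q : ContraTwoTensor I₁ M₁) : ContraTwoTensor (I₁.prod I₂) (M₁ × M₂) := fun z =>
  let r : (TangentSpace (I₁.prod I₂) z →L[ℝ] ℝ) →L[ℝ] (TangentSpace I₁ z.1 →L[ℝ] ℝ) :=
    ContinuousLinearMap.precomp ℝ (hLiftVec z)
  ((ContinuousLinearMap.precomp ℝ r).comp (Q z.1)).comp r

/-- The vertical lift `Q^v` of a contravariant tensor on `M₂`. -/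
def vLiftContra (Q : ContraTwoTensor I₂ M₂) : ContraTwoTensor (I₁.prod I₂) (M₁ × M₂) := fun z =>
  let r : (TangentSpace (I₁.prod I₂) z →L[ℝ] ℝ) →L[ℝ] (TangentSpace I₂ z.2 →L[ℝ] ℝ) :=
    ContinuousLinearMap.precomp ℝ (vLiftVec z)
  ((ContinuousLinearMap.precomp ℝ r).comp (Q z.2)).comp r

/-- The warped tensor `Q₁^h + φ^h Q₂^v` on `M₁ × M₂`. For cometrics and a positive `φ` it is the
contravariant warped product metric, for bivector fields the warped bivector field. -/
def warped (φ : M₁ → ℝ) (Q₁ : ContraTwoTensor I₁ M₁) (Q₂ : ContraTwoTensor I₂ M₂) :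
    ContraTwoTensor (I₁.prod I₂) (M₁ × M₂) := fun z =>
  hLiftContra Q₁ z + φ z.1 • vLiftContra Q₂ z

end Product

/-- A function is essentially constant if it is constant on each connected component. -/
def IsEssentiallyConstant {X : Type*} [TopologicalSpace X] (μ : X → ℝ) : Prop :=
  ∀ x, ∀ y ∈ connectedComponent x, μ y = μ x

end PoissonGeometry

end

open PoissonGeometry

set_option linter.unusedSectionVars false

noncomputable section

namespace PoissonGeometry

/-! ### Smooth tensor fields -/

section SmoothTensors

variable {E : Type*} [NormedAddCommGroup E] [NormedSpace ℝ E]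
  {H : Type*} [TopologicalSpace H] {I : ModelWithCorners ℝ E H}
  {M : Type*} [TopologicalSpace M] [ChartedSpace H M]

theorem SmoothFun.mdifferentiableAt {φ : M → ℝ} (hφ : SmoothFun I φ) (x : M) :
    MDifferentiableAt I 𝓘(ℝ, ℝ) φ x :=
  (hφ x).mdifferentiableAt (by simp)

theorem dFun_add {φ ψ : M → ℝ} (hφ : SmoothFun I φ) (hψ : SmoothFun I ψ) :
    (dFun (φ + ψ) : OneForm I M) = dFun φ + dFun ψ :=
  funext fun x => mfderiv_add (hφ.mdifferentiableAt x) (hψ.mdifferentiableAt x)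

theorem dFun_mul {φ ψ : M → ℝ} (hφ : SmoothFun I φ) (hψ : SmoothFun I ψ) :
    (dFun (φ * ψ) : OneForm I M) = fun x => φ x • dFun ψ x + ψ x • dFun φ x := by
  funext x
  exact (((hφ.mdifferentiableAt x).hasMFDerivAt).mul ((hψ.mdifferentiableAt x).hasMFDerivAt)).mfderiv

theorem dFun_const (c : ℝ) : (dFun (fun _ : M => c) : OneForm I M) = 0 :=
  funext fun _ => mfderiv_const

theorem dFun_congr {φ ψ : M → ℝ} {x : M} (h : φ =ᶠ[𝓝 x] ψ) :
    (dFun φ : OneForm I M) x = dFun ψ x := by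
  exact h.mfderiv_eq (I := I) (I' := 𝓘(ℝ, ℝ))

variable [IsManifold I ∞ M]

theorem SmoothOneForm.apply {α : OneForm I M} {X : VField I M} (hα : SmoothOneForm α)
    (hX : SmoothVField X) : SmoothFun I (fun x => α x (X x)) := by
  have h := ContMDiff.clm_bundle_apply (E₁ := fun x : M => TangentSpace I x)
    (E₂ := fun _ : M => ℝ) hα hX
  exact fun x => (contMDiffAt_totalSpace.1 (h x)).2

theorem SmoothCovTwoTensor.apply {η : CovTwoTensor I M} {X Y : VField I M}
    (hη : SmoothCovTwoTensor η) (hX : SmoothVField X) (hY : SmoothVField Y) :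
    SmoothFun I (fun x => η x (X x) (Y x)) := by
  have h := ContMDiff.clm_bundle_apply₂ (E₁ := fun x : M => TangentSpace I x)
    (E₂ := fun x : M => TangentSpace I x) (E₃ := fun _ : M => ℝ) hη hX hY
  exact fun x => (contMDiffAt_totalSpace.1 (h x)).2

theorem SmoothContraTwoTensor.apply {Q : ContraTwoTensor I M} {α β : OneForm I M}
    (hQ : SmoothContraTwoTensor Q) (hα : SmoothOneForm α) (hβ : SmoothOneForm β) :
    SmoothFun I (pairing Q α β) := by
  have h := ContMDiff.clm_bundle_apply₂ (E₁ := fun x : M => TangentSpace I x →L[ℝ] ℝ)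
    (E₂ := fun x : M => TangentSpace I x →L[ℝ] ℝ) (E₃ := fun _ : M => ℝ) hQ hα hβ
  exact fun x => (contMDiffAt_totalSpace.1 (h x)).2

theorem SmoothFun.dFun {φ : M → ℝ} (hφ : SmoothFun I φ) :
    SmoothOneForm (dFun φ : OneForm I M) := by
  intro x
  have h := ContMDiffAt.mfderiv_const (m := ∞) (hφ x) (by simp)
  refine (contMDiffAt_hom_bundle (E₁ := fun x : M => TangentSpace I x)
    (E₂ := fun _ : M => ℝ) _).2 ⟨contMDiffAt_id, ?_⟩
  refine h.congr_of_eventuallyEq (Filter.Eventually.of_forall fun y => ?_)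
  ext v
  simp [inTangentCoordinates, ContinuousLinearMap.inCoordinates, PoissonGeometry.dFun]
  rfl

theorem SmoothVField.smul {φ : M → ℝ} {X : VField I M} (hφ : SmoothFun I φ)
    (hX : SmoothVField X) : SmoothVField (fun x => φ x • X x) :=
  hφ.smul_section hX

theorem SmoothVField.sum {ι : Type*} (s : Finset ι) {X : ι → VField I M}
    (hX : ∀ i, SmoothVField (X i)) : SmoothVField (fun x => ∑ i ∈ s, X i x) :=
  ContMDiff.sum_section fun i _ => hX i

theorem SmoothOneForm.smul {φ : M → ℝ} {α : OneForm I M} (hφ : SmoothFun I φ)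
    (hα : SmoothOneForm α) : SmoothOneForm (fun x => φ x • α x) :=
  hφ.smul_section hα

theorem SmoothOneForm.add {α β : OneForm I M} (hα : SmoothOneForm α) (hβ : SmoothOneForm β) :
    SmoothOneForm (α + β) :=
  hα.add_section hβ

theorem SmoothOneForm.zero : SmoothOneForm (0 : OneForm I M) :=
  contMDiff_zeroSection (IB := I) (n := ∞) ℝ (fun x : M => TangentSpace I x →L[ℝ] ℝ)

theorem SmoothCovTwoTensor.smul {φ : M → ℝ} {η : CovTwoTensor I M} (hφ : SmoothFun I φ)
    (hη : SmoothCovTwoTensor η) : SmoothCovTwoTensor (fun x => φ x • η x) :=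
  hφ.smul_section hη

theorem SmoothCovTwoTensor.add {η θ : CovTwoTensor I M} (hη : SmoothCovTwoTensor η)
    (hθ : SmoothCovTwoTensor θ) : SmoothCovTwoTensor (η + θ) :=
  hη.add_section hθ

theorem SmoothCovTwoTensor.zero : SmoothCovTwoTensor (0 : CovTwoTensor I M) :=
  contMDiff_zeroSection (IB := I) (n := ∞) ℝ
    (fun x : M => TangentSpace I x →L[ℝ] TangentSpace I x →L[ℝ] ℝ)

theorem SmoothOneForm.tensor {α β : OneForm I M} (hα : SmoothOneForm α)
    (hβ : SmoothOneForm β) : SmoothCovTwoTensor (fun x => (α x).smulRight (β x)) := by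
  intro x
  have h1 := ((contMDiffAt_hom_bundle (E₁ := fun x : M => TangentSpace I x)
    (E₂ := fun _ : M => ℝ) _).1 (hα x)).2
  have h2 := (contMDiffAt_totalSpace.1 (hβ x)).2
  refine (contMDiffAt_hom_bundle (E₁ := fun x : M => TangentSpace I x)
    (E₂ := fun x : M => TangentSpace I x →L[ℝ] ℝ) _).2 ⟨contMDiffAt_id, ?_⟩
  have h3 := ((ContinuousLinearMap.smulRightL ℝ E (E →L[ℝ] ℝ)).contMDiff (n := ∞) _).comp x h1
    |>.clm_apply h2
  refine h3.congr_of_eventuallyEq ?_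
  filter_upwards [(trivializationAt (E →L[ℝ] ℝ) (fun x : M => TangentSpace I x →L[ℝ] ℝ)
    x).open_baseSet.mem_nhds (FiberBundle.mem_baseSet_trivializationAt' x)] with y hy
  ext u v
  simp only [ContinuousLinearMap.inCoordinates]
  simp [(trivializationAt (E →L[ℝ] ℝ) (fun x : M => TangentSpace I x →L[ℝ] ℝ)
    x).coe_linearMapAt_of_mem hy]

theorem smoothOneForm_of_eventuallyEq {α : OneForm I M}
    (h : ∀ x, ∃ β : OneForm I M, SmoothOneForm β ∧ ∀ᶠ y in 𝓝 x, α y = β y) :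
    SmoothOneForm α := by
  intro x
  obtain ⟨β, hβ, he⟩ := h x
  refine (hβ x).congr_of_eventuallyEq ?_
  filter_upwards [he] with y hy
  rw [hy]

theorem smoothCovTwoTensor_of_eventuallyEq {η : CovTwoTensor I M}
    (h : ∀ x, ∃ θ : CovTwoTensor I M, SmoothCovTwoTensor θ ∧ ∀ᶠ y in 𝓝 x, η y = θ y) :
    SmoothCovTwoTensor η := by
  intro x
  obtain ⟨β, hβ, he⟩ := h x
  refine (hβ x).congr_of_eventuallyEq ?_
  filter_upwards [he] with y hy
  rw [hy]

end SmoothTensors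

/-! ### The exterior derivative of a `1`-form -/

section ExteriorDerivative

variable {E : Type*} [NormedAddCommGroup E] [NormedSpace ℝ E]
  {H : Type*} [TopologicalSpace H] {I : ModelWithCorners ℝ E H} [I.Boundaryless]
  {M : Type*} [TopologicalSpace M] [ChartedSpace H M] [IsManifold I ∞ M]

theorem dOne_apply (α : OneForm I M) (x : M) (u v : E) :
    dOne α x u v =
      fderiv ℝ (chartRep x α) (extChartAt I x x) u v -
      fderiv ℝ (chartRep x α) (extChartAt I x x) v u := by
  have h := mfderiv_extChartAt_self (I := I) (x := x)
  simp only [dOne, I.range_eq_univ, fderivWithin_univ, h]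
  rfl

theorem dOne_self (α : OneForm I M) (x : M) (u : TangentSpace I x) : dOne α x u u = 0 := by
  exact (dOne_apply (E := E) α x u u).trans (sub_self _)

theorem dOne_congr {α β : OneForm I M} {x : M} (h : ∀ᶠ y in 𝓝 x, α y = β y) :
    dOne α x = dOne β x := by
  have h' : ∀ᶠ y in 𝓝 (extChartAt I x x), chartRep x α y = chartRep x β y := by
    have hc : ContinuousAt (extChartAt I x).symm (extChartAt I x x) :=
      continuousAt_extChartAt_symm x
    have := hc.tendsto
    rw [extChartAt_to_inv] at this
    filter_upwards [this.eventually h] with y hy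
    simp only [chartRep, hy]
  ext u v
  refine (dOne_apply (E := E) α x u v).trans (.trans ?_ (dOne_apply (E := E) β x u v).symm)
  rw [Filter.EventuallyEq.fderiv_eq h']

theorem SmoothOneForm.differentiableAt_chartRep {α : OneForm I M} (hα : SmoothOneForm α) (x : M) :
    DifferentiableAt ℝ (chartRep x α) (extChartAt I x x) := by
  have h1 := ((contMDiffAt_hom_bundle (E₁ := fun x : M => TangentSpace I x)
    (E₂ := fun _ : M => ℝ) _).1 (hα x)).2
  have h2 : ContMDiffAt 𝓘(ℝ, E) I ∞ (extChartAt I x).symm (extChartAt I x x) :=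
    (contMDiffOn_extChartAt_symm x).contMDiffAt (extChartAt_target_mem_nhds x)
  have h3 := (ContMDiffAt.comp_of_eq h1 h2 (extChartAt_to_inv x)).contDiffAt.differentiableAt
    (by simp)
  refine h3.congr_of_eventuallyEq ?_
  filter_upwards [extChartAt_target_mem_nhds (I := I) x] with y hy
  have hs : (extChartAt I x).symm y ∈ (chartAt H x).source := by
    rw [← extChartAt_source I]; exact (extChartAt I x).map_target hy
  ext v
  have h5 := TangentBundle.symmL_trivializationAt (I := I) hs
  rw [(extChartAt I x).right_inv hy] at h5
  refine Eq.trans ?_ (congrArg (α ((extChartAt I x).symm y))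
    (congrFun (congrArg DFunLike.coe h5) v)).symm |>.trans ?_
  · rfl
  · simp [ContinuousLinearMap.inCoordinates]
    rfl

theorem dOne_add {α β : OneForm I M} (hα : SmoothOneForm α) (hβ : SmoothOneForm β) :
    dOne (α + β) = dOne α + dOne β := by
  funext x
  ext u v
  have h : chartRep x (α + β) = chartRep x α + chartRep x β := by
    funext y; ext v; rfl
  refine (dOne_apply (E := E) _ x u v).trans ?_
  rw [h, fderiv_add (hα.differentiableAt_chartRep x) (hβ.differentiableAt_chartRep x)]
  exact (sub_add_sub_comm _ _ _ _).symm.trans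
    (congrArg₂ (· + ·) (dOne_apply (E := E) α x u v).symm (dOne_apply (E := E) β x u v).symm)

theorem fderiv_comp_extChartAt_symm {φ : M → ℝ} (hφ : SmoothFun I φ) (x : M) {y : E}
    (hy : y ∈ (extChartAt I x).target) :
    HasFDerivAt (φ ∘ (extChartAt I x).symm) (chartRep (I := I) x (dFun φ) y) y := by
  have hs : (extChartAt I x).symm y ∈ (extChartAt I x).source := (extChartAt I x).map_target hy
  have h1 : MDifferentiableAt 𝓘(ℝ, E) I (extChartAt I x).symm y :=
    ((contMDiffOn_extChartAt_symm (n := ∞) x).contMDiffAt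
      ((isOpen_extChartAt_target x).mem_nhds hy)).mdifferentiableAt (by simp)
  have h2 := (hφ.mdifferentiableAt ((extChartAt I x).symm y)).hasMFDerivAt.comp y h1.hasMFDerivAt
  simp only [chartRep, I.range_eq_univ, mfderivWithin_univ]
  exact h2.hasFDerivAt

omit [I.Boundaryless] in
theorem chartRep_self (α : OneForm I M) (x : M) : chartRep x α (extChartAt I x x) = α x := by
  have h1 : ∀ y, y = x → (show E →L[ℝ] ℝ from α y) = α x := by
    rintro _ rfl
    rfl
  have h2 := TangentBundle.symmL_trivializationAt (I := I) (mem_chart_source H x)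
  rw [TangentBundle.symmL_trivializationAt_eq_core (mem_chart_source H x)] at h2
  ext v
  have h3 : (mfderivWithin 𝓘(ℝ, E) I (extChartAt I x).symm (range I) (extChartAt I x x)) v = v := by
    rw [← h2]
    exact (tangentBundleCore I M).coordChange_self _ _ (mem_chart_source H x) v
  exact (congrArg _ h3).trans (congrFun (congrArg DFunLike.coe (h1 _ (extChartAt_to_inv x))) v)

theorem dOne_smul {φ : M → ℝ} {α : OneForm I M} (hφ : SmoothFun I φ) (hα : SmoothOneForm α) :
    dOne (fun x => φ x • α x) = fun x => wedge (dFun φ) α x + φ x • dOne α x := by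
  funext x
  ext u v
  have h : chartRep x (fun x => φ x • α x) = (φ ∘ (extChartAt I x).symm) • chartRep x α := by
    funext y; ext v; rfl
  have h1 := fderiv_comp_extChartAt_symm hφ x (mem_extChartAt_target x)
  have h2 := (h1.smul (hα.differentiableAt_chartRep x).hasFDerivAt).fderiv
  refine (dOne_apply (E := E) _ x u v).trans ?_
  have h3 := chartRep_self (I := I) (dFun φ) x
  have h4 := chartRep_self α x
  have h5 := dOne_apply (E := E) α x u v
  rw [h, h2, h3, h4]
  have h6 : (φ ∘ (extChartAt I x).symm) (extChartAt I x x) = φ x := by simp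
  rw [h6]
  set A : E →L[ℝ] E →L[ℝ] ℝ := fderiv ℝ (chartRep x α) (extChartAt I x x)
  change φ x * A u v + dFun φ x u * α x v - (φ x * A v u + dFun φ x v * α x u) =
    dFun φ x u * α x v - α x u * dFun φ x v + φ x * dOne α x u v
  refine Eq.trans ?_ (congrArg (fun t => dFun φ x u * α x v - α x u * dFun φ x v + φ x * t) h5.symm)
  ring

theorem dOne_dFun {φ : M → ℝ} (hφ : SmoothFun I φ) : dOne (dFun φ : OneForm I M) = 0 := by
  funext x
  ext u v
  have h : ∀ᶠ y in 𝓝 (extChartAt I x x), chartRep (I := I) x (dFun φ) y =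
      fderiv ℝ (φ ∘ (extChartAt I x).symm) y := by
    filter_upwards [extChartAt_target_mem_nhds (I := I) x] with y hy
    exact (fderiv_comp_extChartAt_symm hφ x hy).fderiv.symm
  have hs : ContDiffAt ℝ ∞ (φ ∘ (extChartAt I x).symm) (extChartAt I x x) :=
    (ContMDiffAt.comp (extChartAt I x x) (hφ _) ((contMDiffOn_extChartAt_symm x).contMDiffAt
      (extChartAt_target_mem_nhds (I := I) x))).contDiffAt
  refine (dOne_apply (E := E) _ x u v).trans ?_
  rw [Filter.EventuallyEq.fderiv_eq h]
  exact sub_eq_zero.2 (hs.isSymmSndFDerivAt (by simpa using (WithTop.coe_le_coe.2 le_top : ((2 : ℕ∞) : ℕ∞ω) ≤ ((⊤ : ℕ∞) : ℕ∞ω))) _ _)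

end ExteriorDerivative

section Frames

variable {E : Type*} [NormedAddCommGroup E] [NormedSpace ℝ E] [FiniteDimensional ℝ E]
  {H : Type*} [TopologicalSpace H] {I : ModelWithCorners ℝ E H}
  {M : Type*} [TopologicalSpace M] [ChartedSpace H M] [IsManifold I ∞ M]

variable (I) in
/-- Globally defined functions and vector fields which near `x₀` are coordinates and their
coordinate fields, cut off by `cutoff`. -/
structure CoordinateFrame (x₀ : M) where
  coord : Fin (Module.finrank ℝ E) → M → ℝ
  field : Fin (Module.finrank ℝ E) → VField I M
  cutoff : M → ℝ
  smooth_coord : ∀ a, SmoothFun I (coord a)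
  smooth_field : ∀ a, SmoothVField (field a)
  smooth_cutoff : SmoothFun I cutoff
  cutoff_eventuallyEq : ∀ᶠ x in 𝓝 x₀, cutoff x = 1
  decomp : ∀ (x : M) (v : TangentSpace I x),
    cutoff x • v = ∑ a, (dFun (coord a) x v : ℝ) • field a x
  dual : ∀ (x : M) (a b), dFun (coord a) x (field b x) = if a = b then cutoff x else 0

variable (I) in
theorem exists_coordinateFrame [T2Space M] (x₀ : M) : Nonempty (CoordinateFrame I x₀) := by
  let n := Module.finrank ℝ E
  let b : Module.Basis (Fin n) ℝ E := Module.finBasis ℝ E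
  let ρ : SmoothBumpFunction I x₀ := Classical.arbitrary _
  have hU : ∀ᶠ x in 𝓝 x₀, ∀ᶠ y in 𝓝 x, ρ y = 1 := by
    have := ρ.eventuallyEq_one
    exact eventually_eventually_nhds.2 this
  obtain ⟨χ, -, hχ⟩ := (SmoothBumpFunction.nhds_basis_tsupport (I := I) x₀).mem_iff.1 hU
  let c : Fin n → E →L[ℝ] ℝ := fun a => LinearMap.toContinuousLinearMap (b.coord a)
  let e := trivializationAt E (fun x : M => TangentSpace I x) x₀
  have he : e.baseSet = (chartAt H x₀).source := rfl
  let X : Fin n → M → ℝ := fun a x => ρ x • c a (extChartAt I x₀ x)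
  let F : Fin n → VField I M := fun a x => χ x • e.symmL ℝ x (b a)
  have hd : ∀ a x, x ∈ tsupport χ → ∀ v : TangentSpace I x,
      dFun (X a) x v = c a (e.continuousLinearMapAt ℝ x v) := by
    intro a x hx v
    have hxs : x ∈ (chartAt H x₀).source := χ.tsupport_subset_chartAt_source hx
    have h1 : X a =ᶠ[𝓝 x] (c a) ∘ (extChartAt I x₀) := by
      filter_upwards [hχ hx] with y hy
      simp [X, hy]
    have h2 := TangentBundle.continuousLinearMapAt_trivializationAt (I := I) hxs
    have h3 := ((c a).hasMFDerivAt (x := extChartAt I x₀ x)).comp x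
      (mdifferentiableAt_extChartAt (I := I) hxs).hasMFDerivAt
    rw [dFun_congr h1]
    have h4 := congrArg (fun L => c a (L v)) h2
    refine Eq.trans ?_ h4.symm
    exact congrFun (congrArg DFunLike.coe h3.mfderiv) v
  refine ⟨⟨X, F, χ, fun a => ?_, fun a => ?_, χ.contMDiff, ?_, ?_, ?_⟩⟩
  · exact ρ.contMDiff_smul (((c a).contMDiff (n := ∞)).comp_contMDiffOn
      (contMDiffOn_extChartAt (I := I) (n := ∞) (x := x₀)))
  · refine ContMDiffOn.smul_section_of_tsupport (u := e.baseSet) χ.contMDiff.contMDiffOn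
      e.open_baseSet χ.tsupport_subset_chartAt_source ?_
    rw [e.contMDiffOn_section_baseSet_iff]
    refine (contMDiffOn_const (c := b a)).congr fun y hy => ?_
    simp [e.symmL_apply hy, e.apply_mk_symm hy]
  · exact χ.eventuallyEq_one
  · intro x v
    by_cases hx : χ x = 0
    · simp [F, hx]
    have hx' : x ∈ tsupport χ := subset_tsupport _ hx
    have hxs : x ∈ e.baseSet := χ.tsupport_subset_chartAt_source hx'
    have h1 : e.symmL ℝ x (e.continuousLinearMapAt ℝ x v) = v :=
      e.symmL_continuousLinearMapAt hxs v
    have h2 := b.sum_repr (e.continuousLinearMapAt ℝ x v)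
    rw [← h2, map_sum] at h1
    conv_lhs => rw [← h1]
    rw [Finset.smul_sum]
    refine Finset.sum_congr rfl fun a _ => ?_
    rw [hd a x hx' v]
    simp only [F, map_smul]
    rw [smul_comm]
    simp [c]
  · intro x a a'
    by_cases hx : χ x = 0
    · simp [F, hx]
    have hx' : x ∈ tsupport χ := subset_tsupport _ hx
    have hxs : x ∈ e.baseSet := χ.tsupport_subset_chartAt_source hx'
    have h1 : e.continuousLinearMapAt ℝ x (e.symmL ℝ x (b a')) = b a' :=
      e.continuousLinearMapAt_symmL hxs _
    rw [hd a x hx']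
    simp only [F, map_smul]
    change χ x • c a (e.continuousLinearMapAt ℝ x (e.symmL ℝ x (b a'))) = _
    rw [h1]
    simp only [c, LinearMap.coe_toContinuousLinearMap', Module.Basis.coord_apply, b.repr_self]
    by_cases h : a = a'
    · simp [h]
    · simp [h]

omit [FiniteDimensional ℝ E] in
theorem CoordinateFrame.cutoff_self {x₀ : M} (F : CoordinateFrame I x₀) : F.cutoff x₀ = 1 :=
  F.cutoff_eventuallyEq.self_of_nhds

omit [FiniteDimensional ℝ E] in
theorem CoordinateFrame.covector_decomp {x₀ : M} (F : CoordinateFrame I x₀) (x : M)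
    (c : TangentSpace I x →L[ℝ] ℝ) :
    F.cutoff x • c = ∑ a, c (F.field a x) • dFun (F.coord a) x := by
  ext v
  have h := congrArg c (F.decomp x v)
  rw [map_smul, map_sum] at h
  simp only [map_smul] at h
  rw [smul_apply, h, sum_apply]
  exact Finset.sum_congr rfl fun a _ => mul_comm _ _

omit [FiniteDimensional ℝ E] in
theorem SmoothOneForm.sum {ι : Type*} (s : Finset ι) {α : ι → OneForm I M}
    (hα : ∀ i, SmoothOneForm (α i)) : SmoothOneForm (fun x => ∑ i ∈ s, α i x) :=
  ContMDiff.sum_section fun i _ => hα i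

variable [T2Space M]

theorem exists_dFun_eq (x₀ : M) (c : TangentSpace I x₀ →L[ℝ] ℝ) :
    ∃ φ : M → ℝ, SmoothFun I φ ∧ (dFun φ : OneForm I M) x₀ = c := by
  obtain ⟨F⟩ := exists_coordinateFrame I x₀
  have key : ∀ s : Finset (Fin (Module.finrank ℝ E)), ∃ φ : M → ℝ, SmoothFun I φ ∧
      (dFun φ : OneForm I M) x₀ = ∑ a ∈ s, c (F.field a x₀) • dFun (F.coord a) x₀ := by
    intro s
    classical
    induction s using Finset.induction_on with
    | empty => exact ⟨fun _ => 0, contMDiff_const, by rw [dFun_const]; simp⟩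
    | insert a s ha ih =>
      obtain ⟨φ, hφ, h⟩ := ih
      have h1 : SmoothFun I (fun _ : M => c (F.field a x₀)) := contMDiff_const
      have h2 : SmoothFun I ((fun _ : M => c (F.field a x₀)) * F.coord a) :=
        ContMDiff.mul h1 (F.smooth_coord a)
      refine ⟨((fun _ : M => c (F.field a x₀)) * F.coord a) + φ, ContMDiff.add h2 hφ, ?_⟩
      rw [dFun_add h2 hφ, Finset.sum_insert ha, Pi.add_apply, h, dFun_mul h1 (F.smooth_coord a),
        dFun_const]
      simp
  obtain ⟨φ, hφ, h⟩ := key Finset.univ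
  exact ⟨φ, hφ, by rw [h, ← F.covector_decomp, F.cutoff_self, one_smul]⟩

theorem exists_smoothVField_eq (x₀ : M) (v : TangentSpace I x₀) :
    ∃ X : VField I M, SmoothVField X ∧ X x₀ = v := by
  obtain ⟨F⟩ := exists_coordinateFrame I x₀
  refine ⟨fun x => ∑ a, (dFun (F.coord a) x₀ v : ℝ) • F.field a x,
    SmoothVField.sum _ fun a => SmoothVField.smul contMDiff_const (F.smooth_field a), ?_⟩
  have h := F.decomp x₀ v
  rw [F.cutoff_self, one_smul] at h
  exact h.symm

theorem smoothOneForm_of_apply {θ : OneForm I M}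
    (h : ∀ X : VField I M, SmoothVField X → SmoothFun I (fun x => θ x (X x))) :
    SmoothOneForm θ := by
  refine smoothOneForm_of_eventuallyEq fun x₀ => ?_
  obtain ⟨F⟩ := exists_coordinateFrame I x₀
  refine ⟨fun x => ∑ a, θ x (F.field a x) • dFun (F.coord a) x,
    SmoothOneForm.sum _ fun a => SmoothOneForm.smul (h _ (F.smooth_field a))
      (F.smooth_coord a).dFun, ?_⟩
  filter_upwards [F.cutoff_eventuallyEq] with x hx
  rw [← F.covector_decomp, hx, one_smul]

end Frames

/-! ### Modules of smooth forms -/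

section Modules

variable {E : Type*} [NormedAddCommGroup E] [NormedSpace ℝ E]
  {H : Type*} [TopologicalSpace H] (I : ModelWithCorners ℝ E H)
  (M : Type*) [TopologicalSpace M] [ChartedSpace H M]

/-- The algebra `C^∞(M)`. -/
def smoothFunctions : Subalgebra ℝ (M → ℝ) where
  carrier := {φ | SmoothFun I φ}
  mul_mem' h h' := ContMDiff.mul h h'
  add_mem' h h' := ContMDiff.add h h'
  algebraMap_mem' _ := contMDiff_const

variable [IsManifold I ∞ M]

/-- The `C^∞(M)`-module of smooth `1`-forms. -/
def smoothOneForms : Submodule (smoothFunctions I M) (OneForm I M) where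
  carrier := {α | SmoothOneForm α}
  add_mem' h h' := h.add h'
  zero_mem' := SmoothOneForm.zero
  smul_mem' φ _ h := SmoothOneForm.smul φ.2 h

/-- The `C^∞(M)`-module of smooth `2`-forms. -/
def smoothTwoForms : Submodule (smoothFunctions I M) (CovTwoTensor I M) where
  carrier := {η | SmoothTwoForm η}
  add_mem' {η θ} h h' := ⟨h.1.add h'.1, fun x u => by
    have h1 := h.2 x u
    have h2 := h'.2 x u
    change η x u u + θ x u u = 0
    rw [h1, h2, add_zero]⟩
  zero_mem' := ⟨SmoothCovTwoTensor.zero, fun _ _ => rfl⟩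
  smul_mem' φ η h := ⟨SmoothCovTwoTensor.smul φ.2 h.1, fun x u => by
    have h1 := h.2 x u
    change φ.1 x * η x u u = 0
    rw [h1, mul_zero]⟩

/-- `C^∞(M)`, as a type. -/
def SmoothFunctions : Type _ := smoothFunctions I M

/-- The smooth `1`-forms, as a type. -/
def SmoothOneForms : Type _ := smoothOneForms I M

/-- The smooth `2`-forms, as a type. -/
def SmoothTwoForms : Type _ := smoothTwoForms I M

instance : CommRing (SmoothFunctions I M) := (smoothFunctions I M).toCommRing
instance : Algebra ℝ (SmoothFunctions I M) := (smoothFunctions I M).algebra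
instance : AddCommGroup (SmoothOneForms I M) := (smoothOneForms I M).addCommGroup
instance : Module (SmoothFunctions I M) (SmoothOneForms I M) := (smoothOneForms I M).module
instance : AddCommGroup (SmoothTwoForms I M) := (smoothTwoForms I M).addCommGroup
instance : Module (SmoothFunctions I M) (SmoothTwoForms I M) := (smoothTwoForms I M).module

variable {I M}

omit [IsManifold I ∞ M] in
@[simp]
theorem smoothFunctions_add_apply (φ ψ : SmoothFunctions I M) (x : M) :
    (φ + ψ).1 x = φ.1 x + ψ.1 x := rfl

omit [IsManifold I ∞ M] in
@[simp]
theorem smoothFunctions_mul_apply (φ ψ : SmoothFunctions I M) (x : M) :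
    (φ * ψ).1 x = φ.1 x * ψ.1 x := rfl

@[simp]
theorem smoothOneForms_add_apply (α β : SmoothOneForms I M) (x : M) :
    (α + β).1 x = α.1 x + β.1 x := rfl

@[simp]
theorem smoothOneForms_smul_apply (φ : SmoothFunctions I M) (α : SmoothOneForms I M) (x : M) :
    (φ • α).1 x = φ.1 x • α.1 x := rfl

@[simp]
theorem smoothTwoForms_add_apply (η θ : SmoothTwoForms I M) (x : M) :
    (η + θ).1 x = η.1 x + θ.1 x := rfl

@[simp]
theorem smoothTwoForms_smul_apply (φ : SmoothFunctions I M) (η : SmoothTwoForms I M) (x : M) :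
    (φ • η).1 x = φ.1 x • η.1 x := rfl

theorem smoothOneForms_sum_apply {ι : Type*} (s : Finset ι) (α : ι → SmoothOneForms I M) (x : M) :
    (∑ i ∈ s, α i).1 x = ∑ i ∈ s, (α i).1 x := by
  classical
  induction s using Finset.induction_on with
  | empty => simp; rfl
  | insert a s ha ih => rw [Finset.sum_insert ha, Finset.sum_insert ha, ← ih]; rfl

theorem smoothTwoForms_sum_apply {ι : Type*} (s : Finset ι) (α : ι → SmoothTwoForms I M) (x : M) :
    (∑ i ∈ s, α i).1 x = ∑ i ∈ s, (α i).1 x := by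
  classical
  induction s using Finset.induction_on with
  | empty => simp; rfl
  | insert a s ha ih => rw [Finset.sum_insert ha, Finset.sum_insert ha, ← ih]; rfl

theorem smoothOneForms_ext {α β : SmoothOneForms I M} (h : ∀ x, α.1 x = β.1 x) : α = β :=
  Subtype.ext (funext h)

theorem smoothTwoForms_ext {α β : SmoothTwoForms I M} (h : ∀ x, α.1 x = β.1 x) : α = β :=
  Subtype.ext (funext h)

/-- The differential of a smooth function, as a smooth `1`-form. -/
def differential (φ : SmoothFunctions I M) : SmoothOneForms I M := ⟨dFun φ.1, SmoothFun.dFun φ.2⟩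

theorem differential_add (φ ψ : SmoothFunctions I M) :
    differential (φ + ψ) = differential φ + differential ψ :=
  Subtype.ext (dFun_add φ.2 ψ.2)

theorem differential_mul (φ ψ : SmoothFunctions I M) :
    differential (φ * ψ) = φ • differential ψ + ψ • differential φ :=
  Subtype.ext (dFun_mul φ.2 ψ.2)

theorem differential_apply_of_eventuallyEq_one {χ : SmoothFunctions I M} {x : M}
    (h : ∀ᶠ y in 𝓝 x, χ.1 y = 1) : (differential χ).1 x = 0 := by
  have h1 : χ.1 =ᶠ[𝓝 x] fun _ => 1 := h
  exact (dFun_congr h1).trans (congrFun (dFun_const 1) x)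

omit [IsManifold I ∞ M] in
theorem wedge_apply (α β : OneForm I M) (x : M) (u v : TangentSpace I x) :
    wedge α β x u v = α x u * β x v - β x u * α x v := rfl

theorem SmoothOneForm.smoothTwoForm_wedge {α β : OneForm I M} (hα : SmoothOneForm α) (hβ : SmoothOneForm β) :
    SmoothTwoForm (wedge α β) := by
  refine ⟨?_, fun x u => by rw [wedge_apply]; ring⟩
  have h : wedge α β = (fun x => (α x).smulRight (β x)) +
      fun x => (fun _ : M => (-1 : ℝ)) x • (β x).smulRight (α x) := by
    funext x
    simp [wedge, sub_eq_add_neg]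
  rw [h]
  exact (hα.tensor hβ).add ((hβ.tensor hα).smul contMDiff_const)

/-- The wedge product of smooth `1`-forms, as a smooth `2`-form. -/
def wedgeForm (α β : SmoothOneForms I M) : SmoothTwoForms I M :=
  ⟨wedge α.1 β.1, SmoothOneForm.smoothTwoForm_wedge α.2 β.2⟩

theorem wedgeForm_apply (α β : SmoothOneForms I M) (x : M) (u v : TangentSpace I x) :
    (wedgeForm α β).1 x u v = α.1 x u * β.1 x v - β.1 x u * α.1 x v := rfl

theorem wedgeForm_comm (α β : SmoothOneForms I M) : wedgeForm α β = -wedgeForm β α :=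
  smoothTwoForms_ext fun x => by
    ext u v
    rw [wedgeForm_apply]
    change _ = -(β.1 x u * α.1 x v - α.1 x u * β.1 x v)
    ring

theorem wedgeForm_add_left (α α' β : SmoothOneForms I M) :
    wedgeForm (α + α') β = wedgeForm α β + wedgeForm α' β :=
  smoothTwoForms_ext fun x => by
    ext u v
    change (α.1 x u + α'.1 x u) * β.1 x v - β.1 x u * (α.1 x v + α'.1 x v) =
      (α.1 x u * β.1 x v - β.1 x u * α.1 x v) + (α'.1 x u * β.1 x v - β.1 x u * α'.1 x v)
    ring

theorem wedgeForm_smul_left (φ : SmoothFunctions I M) (α β : SmoothOneForms I M) :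
    wedgeForm (φ • α) β = φ • wedgeForm α β :=
  smoothTwoForms_ext fun x => by
    ext u v
    change (φ.1 x * α.1 x u) * β.1 x v - β.1 x u * (φ.1 x * α.1 x v) =
      φ.1 x * (α.1 x u * β.1 x v - β.1 x u * α.1 x v)
    ring

theorem wedgeForm_smul_right (φ : SmoothFunctions I M) (α β : SmoothOneForms I M) :
    wedgeForm α (φ • β) = φ • wedgeForm α β := by
  rw [wedgeForm_comm, wedgeForm_smul_left, wedgeForm_comm β]; simp

end Modules

section Local

variable {E : Type*} [NormedAddCommGroup E] [NormedSpace ℝ E] [FiniteDimensional ℝ E]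
  {H : Type*} [TopologicalSpace H] {I : ModelWithCorners ℝ E H}
  {M : Type*} [TopologicalSpace M] [ChartedSpace H M] [IsManifold I ∞ M]

namespace CoordinateFrame

variable {x₀ : M} (F : CoordinateFrame I x₀)

/-- The cut-off coordinates as elements of `C^∞(M)`. -/
def coordFun (a : Fin (Module.finrank ℝ E)) : SmoothFunctions I M := ⟨F.coord a, F.smooth_coord a⟩

/-- The cut-off function as an element of `C^∞(M)`. -/
def cutoffFun : SmoothFunctions I M := ⟨F.cutoff, F.smooth_cutoff⟩

/-- The components of a smooth `1`-form. -/
def coeff (a : Fin (Module.finrank ℝ E)) (α : SmoothOneForms I M) : SmoothFunctions I M :=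
  ⟨fun x => α.1 x (F.field a x), SmoothOneForm.apply α.2 (F.smooth_field a)⟩

/-- The components of a smooth `2`-form. -/
def coeff₂ (a b : Fin (Module.finrank ℝ E)) (η : SmoothTwoForms I M) : SmoothFunctions I M :=
  ⟨fun x => η.1 x (F.field a x) (F.field b x),
    SmoothCovTwoTensor.apply η.2.1 (F.smooth_field a) (F.smooth_field b)⟩

omit [FiniteDimensional ℝ E] in
theorem oneForm_decomp (α : SmoothOneForms I M) :
    F.cutoffFun • α = ∑ a, F.coeff a α • differential (F.coordFun a) :=
  smoothOneForms_ext fun x => by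
    rw [smoothOneForms_sum_apply]
    exact F.covector_decomp x (α.1 x)

omit [FiniteDimensional ℝ E] in
theorem twoForm_decomp (η : SmoothTwoForms I M) :
    (F.cutoffFun * F.cutoffFun) • η = ∑ a, ∑ b, (algebraMap ℝ (SmoothFunctions I M) (1 / 2) *
      F.coeff₂ a b η) • wedgeForm (differential (F.coordFun a)) (differential (F.coordFun b)) :=
  smoothTwoForms_ext fun x => by
    ext u v
    have hu := F.decomp x u
    have hv := F.decomp x v
    have hs : ∀ w z, η.1 x w z = - η.1 x z w := by
      intro w z
      have h1 := η.2.2 x (w + z)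
      have h2 := η.2.2 x w
      have h3 := η.2.2 x z
      simp only [map_add, add_apply] at h1
      linarith
    have key : F.cutoff x * F.cutoff x * η.1 x u v = ∑ a, ∑ b, dFun (F.coord a) x u *
        dFun (F.coord b) x v * η.1 x (F.field a x) (F.field b x) := by
      have h1 : F.cutoff x * F.cutoff x * η.1 x u v = η.1 x (F.cutoff x • u) (F.cutoff x • v) := by
        simp [mul_assoc]
      rw [h1, hu, hv]
      simp only [map_sum, sum_apply, map_smul, smul_apply,
        smul_eq_mul, Finset.mul_sum, mul_assoc]
      rw [Finset.sum_comm]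
      refine Finset.sum_congr rfl fun a _ => Finset.sum_congr rfl fun b _ => ?_
      ring
    have key2 : F.cutoff x * F.cutoff x * η.1 x u v = ∑ a, ∑ b, - (dFun (F.coord b) x u *
        dFun (F.coord a) x v * η.1 x (F.field a x) (F.field b x)) := by
      rw [key, Finset.sum_comm]
      refine Finset.sum_congr rfl fun a _ => Finset.sum_congr rfl fun b _ => ?_
      rw [hs (F.field b x)]
      ring
    have h3 : ((F.cutoffFun * F.cutoffFun) • η).1 x u v = F.cutoff x * F.cutoff x * η.1 x u v := rfl
    rw [h3, smoothTwoForms_sum_apply]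
    simp only [smoothTwoForms_sum_apply, sum_apply]
    have h4 : F.cutoff x * F.cutoff x * η.1 x u v = 1 / 2 * (F.cutoff x * F.cutoff x * η.1 x u v)
        + 1 / 2 * (F.cutoff x * F.cutoff x * η.1 x u v) := by ring
    rw [h4]
    nth_rewrite 1 [key]
    rw [key2, Finset.mul_sum, Finset.mul_sum, ← Finset.sum_add_distrib]
    refine Finset.sum_congr rfl fun a _ => ?_
    rw [Finset.mul_sum, Finset.mul_sum, ← Finset.sum_add_distrib]
    refine Finset.sum_congr rfl fun b _ => ?_
    change _ = 1 / 2 * η.1 x (F.field a x) (F.field b x) * (dFun (F.coord a) x u *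
        dFun (F.coord b) x v - dFun (F.coord b) x u * dFun (F.coord a) x v)
    ring

end CoordinateFrame

variable [T2Space M]

theorem oneForm_induction (x₀ : M) {p : SmoothOneForms I M → Prop}
    (exact_form : ∀ φ : SmoothFunctions I M, p (differential φ)) (add : ∀ α β, p α → p β → p (α + β))
    (smul : ∀ (φ : SmoothFunctions I M) α, p α → p (φ • α))
    (cancel : ∀ (χ : SmoothFunctions I M) (α), (∀ᶠ x in 𝓝 x₀, χ.1 x = 1) → p (χ • α) → p α)
    (α : SmoothOneForms I M) : p α := by
  obtain ⟨F⟩ := exists_coordinateFrame I x₀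
  refine cancel F.cutoffFun α F.cutoff_eventuallyEq ?_
  rw [F.oneForm_decomp]
  refine Finset.sum_induction _ p add ?_ fun a _ => smul _ _ (exact_form _)
  simpa using smul 0 _ (exact_form 0)

theorem twoForm_induction (x₀ : M) {p : SmoothTwoForms I M → Prop}
    (wedge_exact : ∀ φ ψ : SmoothFunctions I M, p (wedgeForm (differential φ) (differential ψ)))
    (add : ∀ α β, p α → p β → p (α + β)) (smul : ∀ (φ : SmoothFunctions I M) α, p α → p (φ • α))
    (cancel : ∀ (χ : SmoothFunctions I M) (α), (∀ᶠ x in 𝓝 x₀, χ.1 x = 1) → p (χ • α) → p α)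
    (η : SmoothTwoForms I M) : p η := by
  obtain ⟨F⟩ := exists_coordinateFrame I x₀
  have h0 : p 0 := by simpa using smul 0 _ (wedge_exact 0 0)
  refine cancel (F.cutoffFun * F.cutoffFun) η ?_ ?_
  · filter_upwards [F.cutoff_eventuallyEq] with x hx
    change F.cutoff x * F.cutoff x = 1
    rw [hx, one_mul]
  rw [F.twoForm_decomp]
  refine Finset.sum_induction _ p add h0 fun a _ => ?_
  exact Finset.sum_induction _ p add h0 fun b _ => smul _ _ (wedge_exact _ _)

theorem exists_differential_eq (x₀ : M) (c : TangentSpace I x₀ →L[ℝ] ℝ) :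
    ∃ φ : SmoothFunctions I M, (differential φ).1 x₀ = c := by
  obtain ⟨φ, hφ, h⟩ := exists_dFun_eq x₀ c
  exact ⟨⟨φ, hφ⟩, h⟩

/-- A map on smooth `1`-forms which is tensorial at `x₀` factors through evaluation at `x₀`. -/
theorem exists_linearMap_of_tensorial {V : Type*} [AddCommGroup V] [Module ℝ V] (x₀ : M)
    (L : SmoothOneForms I M → V) (add : ∀ α β, L (α + β) = L α + L β)
    (smul : ∀ (φ : SmoothFunctions I M) α, L (φ • α) = φ.1 x₀ • L α) :
    ∃ T : (TangentSpace I x₀ →L[ℝ] ℝ) →ₗ[ℝ] V, ∀ α, L α = T (α.1 x₀) := by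
  obtain ⟨F⟩ := exists_coordinateFrame I x₀
  let T : (TangentSpace I x₀ →L[ℝ] ℝ) →ₗ[ℝ] V :=
    { toFun := fun c => ∑ a, c (F.field a x₀) • L (differential (F.coordFun a))
      map_add' := fun c c' => by
        simp only [add_apply, add_smul, Finset.sum_add_distrib]
      map_smul' := fun r c => by
        simp only [smul_apply, smul_eq_mul, mul_smul, Finset.smul_sum,
          RingHom.id_apply] }
  refine ⟨T, fun α => ?_⟩
  let L' : SmoothOneForms I M →+ V := AddMonoidHom.mk' L add
  have h1 := smul F.cutoffFun α
  have h2 : F.cutoffFun.1 x₀ = 1 := F.cutoff_self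
  rw [h2, one_smul, F.oneForm_decomp] at h1
  rw [← h1]
  have h3 := map_sum L' (fun a => F.coeff a α • differential (F.coordFun a)) Finset.univ
  refine h3.trans (Finset.sum_congr rfl fun a _ => ?_)
  exact smul _ _

theorem eq_of_tensorial {V : Type*} [AddCommGroup V] [Module ℝ V] (x₀ : M)
    {L : SmoothOneForms I M → V} (add : ∀ α β, L (α + β) = L α + L β)
    (smul : ∀ (φ : SmoothFunctions I M) α, L (φ • α) = φ.1 x₀ • L α) {α β : SmoothOneForms I M}
    (h : α.1 x₀ = β.1 x₀) : L α = L β := by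
  obtain ⟨T, hT⟩ := exists_linearMap_of_tensorial x₀ L add smul
  rw [hT, hT, h]

/-- A real-valued map on smooth `1`-forms which is tensorial at `x₀` is evaluation on a tangent
vector at `x₀`. -/
theorem exists_vector_of_tensorial (x₀ : M)
    (L : SmoothOneForms I M → ℝ) (add : ∀ α β, L (α + β) = L α + L β)
    (smul : ∀ (φ : SmoothFunctions I M) α, L (φ • α) = φ.1 x₀ * L α) :
    ∃ v : TangentSpace I x₀, ∀ α, L α = α.1 x₀ v := by
  obtain ⟨T, hT⟩ := exists_linearMap_of_tensorial x₀ L add smul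
  obtain ⟨F⟩ := exists_coordinateFrame I x₀
  refine ⟨∑ a, T (dFun (F.coord a) x₀) • F.field a x₀, fun α => ?_⟩
  have h := F.covector_decomp x₀ (α.1 x₀)
  rw [F.cutoff_self, one_smul] at h
  rw [hT, h, map_sum, ← h, map_sum]
  refine Finset.sum_congr rfl fun a _ => ?_
  rw [map_smul, map_smul, smul_eq_mul, smul_eq_mul, mul_comm]

variable [I.Boundaryless]

theorem SmoothOneForm.smoothTwoForm_dOne {α : OneForm I M} (hα : SmoothOneForm α) :
    SmoothTwoForm (dOne α) := by
  refine ⟨smoothCovTwoTensor_of_eventuallyEq fun x₀ => ?_, fun x u => dOne_self α x u⟩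
  refine oneForm_induction x₀ (p := fun α => ∃ θ : CovTwoTensor I M, SmoothCovTwoTensor θ ∧
    ∀ᶠ y in 𝓝 x₀, dOne α.1 y = θ y) ?_ ?_ ?_ ?_ ⟨α, hα⟩
  · intro φ
    exact ⟨0, SmoothCovTwoTensor.zero, Filter.Eventually.of_forall
      fun y => congrFun (dOne_dFun φ.2) y⟩
  · rintro α β ⟨θ, hθ, h⟩ ⟨θ', hθ', h'⟩
    refine ⟨θ + θ', hθ.add hθ', ?_⟩
    filter_upwards [h, h'] with y hy hy'
    exact (congrFun (dOne_add α.2 β.2) y).trans (congrArg₂ (· + ·) hy hy')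
  · rintro φ α ⟨θ, hθ, h⟩
    refine ⟨wedge (dFun φ.1) α.1 + fun x => φ.1 x • θ x,
      ((SmoothFun.dFun φ.2).smoothTwoForm_wedge α.2).1.add (hθ.smul φ.2), ?_⟩
    filter_upwards [h] with y hy
    refine (congrFun (dOne_smul φ.2 α.2) y).trans ?_
    rw [hy]
    rfl
  · rintro χ α hχ ⟨θ, hθ, h⟩
    refine ⟨θ, hθ, ?_⟩
    filter_upwards [h, eventually_eventually_nhds.2 hχ] with y hy hy'
    rw [← hy]
    refine dOne_congr ?_
    filter_upwards [hy'] with z hz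
    rw [smoothOneForms_smul_apply, hz, one_smul]

/-- The exterior derivative of a smooth `1`-form, as a smooth `2`-form. -/
def exteriorDeriv (α : SmoothOneForms I M) : SmoothTwoForms I M :=
  ⟨dOne α.1, SmoothOneForm.smoothTwoForm_dOne α.2⟩

theorem exteriorDeriv_add (α β : SmoothOneForms I M) :
    exteriorDeriv (α + β) = exteriorDeriv α + exteriorDeriv β :=
  Subtype.ext (dOne_add α.2 β.2)

theorem exteriorDeriv_smul (φ : SmoothFunctions I M) (α : SmoothOneForms I M) :
    exteriorDeriv (φ • α) = wedgeForm (differential φ) α + φ • exteriorDeriv α :=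
  Subtype.ext (dOne_smul φ.2 α.2)

theorem exteriorDeriv_differential (φ : SmoothFunctions I M) :
    exteriorDeriv (differential φ) = 0 :=
  Subtype.ext (dOne_dFun φ.2)

end Local

/-! ### Algebra of contravariant connections -/

/-- The algebraic structure formed by functions (`A`), `1`-forms (`V`) and `2`-forms (`W`)
together with a contravariant connection which is torsion-free on exact forms. -/
structure ContravariantCalculus (A V W : Type*) [CommRing A] [AddCommGroup V] [Module A V]
    [AddCommGroup W] [Module A W] where
  d : A → V
  dd : V → W
  wedge : V → V → W
  anchor : V → A → A
  D : V → V → V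
  DD : V → W → W
  d_add : ∀ f h, d (f + h) = d f + d h
  d_mul : ∀ f h, d (f * h) = f • d h + h • d f
  dd_add : ∀ a b, dd (a + b) = dd a + dd b
  dd_smul : ∀ (f : A) a, dd (f • a) = wedge (d f) a + f • dd a
  dd_d : ∀ f, dd (d f) = 0
  wedge_comm : ∀ a b, wedge a b = -wedge b a
  wedge_smul : ∀ (f : A) a b, wedge (f • a) b = f • wedge a b
  wedge_add : ∀ a b c, wedge (a + b) c = wedge a c + wedge b c
  anchor_add_left : ∀ a b f, anchor (a + b) f = anchor a f + anchor b f
  anchor_smul_left : ∀ (f : A) a h, anchor (f • a) h = f * anchor a h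
  anchor_add : ∀ a f h, anchor a (f + h) = anchor a f + anchor a h
  anchor_mul : ∀ a f h, anchor a (f * h) = f * anchor a h + h * anchor a f
  anchor_d : ∀ f h, anchor (d f) h = -anchor (d h) f
  D_add_left : ∀ a b c, D (a + b) c = D a c + D b c
  D_smul_left : ∀ (f : A) a b, D (f • a) b = f • D a b
  D_add : ∀ a b c, D a (b + c) = D a b + D a c
  D_smul : ∀ a (f : A) b, D a (f • b) = f • D a b + anchor a f • b
  D_d : ∀ f h, D (d f) (d h) - D (d h) (d f) = d (anchor (d f) h)
  DD_add_left : ∀ a b η, DD (a + b) η = DD a η + DD b η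
  DD_smul_left : ∀ (f : A) a η, DD (f • a) η = f • DD a η
  DD_add : ∀ a η θ, DD a (η + θ) = DD a η + DD a θ
  DD_smul : ∀ a (f : A) η, DD a (f • η) = f • DD a η + anchor a f • η
  DD_wedge : ∀ a b c, DD a (wedge b c) = wedge (D a b) c + wedge b (D a c)

namespace ContravariantCalculus

variable {A V W : Type*} [CommRing A] [AddCommGroup V] [Module A V] [AddCommGroup W] [Module A W]
  (C : ContravariantCalculus A V W)

theorem wedge_add_right (a b c : V) : C.wedge a (b + c) = C.wedge a b + C.wedge a c := by
  rw [C.wedge_comm, C.wedge_add, C.wedge_comm a b, C.wedge_comm a c]; abel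

theorem wedge_smul_right (f : A) (a b : V) : C.wedge a (f • b) = f • C.wedge a b := by
  rw [C.wedge_comm, C.wedge_smul, C.wedge_comm b a, smul_neg, neg_neg]

theorem wedge_sub (a b c : V) : C.wedge (a - b) c = C.wedge a c - C.wedge b c := by
  rw [eq_sub_iff_add_eq, ← C.wedge_add, sub_add_cancel]

theorem wedge_sub_right (a b c : V) : C.wedge a (b - c) = C.wedge a b - C.wedge a c := by
  rw [eq_sub_iff_add_eq, ← C.wedge_add_right, sub_add_cancel]

theorem wedge_zero_left (c : V) : C.wedge 0 c = 0 := by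
  simpa using C.wedge_sub 0 0 c

theorem wedge_zero_right (c : V) : C.wedge c 0 = 0 := by
  rw [C.wedge_comm, wedge_zero_left, neg_zero]

theorem anchor_sub_left (a b : V) (f : A) : C.anchor (a - b) f = C.anchor a f - C.anchor b f := by
  rw [eq_sub_iff_add_eq, ← C.anchor_add_left, sub_add_cancel]

theorem anchor_neg (a : V) (f : A) : C.anchor a (-f) = -C.anchor a f := by
  have h := C.anchor_add a f (-f)
  have h0 := C.anchor_add a 0 0
  rw [add_zero, left_eq_add] at h0
  rw [add_neg_cancel, h0] at h
  exact (neg_eq_of_add_eq_zero_right h.symm).symm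

theorem D_sub_left (a b c : V) : C.D (a - b) c = C.D a c - C.D b c := by
  rw [eq_sub_iff_add_eq, ← C.D_add_left, sub_add_cancel]

theorem D_sub (a b c : V) : C.D a (b - c) = C.D a b - C.D a c := by
  rw [eq_sub_iff_add_eq, ← C.D_add, sub_add_cancel]

theorem D_zero (a : V) : C.D a 0 = 0 := by
  simpa using C.D_sub a 0 0

theorem DD_sub (a : V) (b c : W) : C.DD a (b - c) = C.DD a b - C.DD a c := by
  rw [eq_sub_iff_add_eq, ← C.DD_add, sub_add_cancel]

theorem DD_zero (a : V) : C.DD a 0 = 0 := by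
  simpa using C.DD_sub a 0 0

theorem DD_neg (a : V) (b : W) : C.DD a (-b) = -C.DD a b := by
  have h := C.DD_sub a 0 b
  rwa [zero_sub, C.DD_zero, zero_sub] at h

theorem dd_sub (a b : V) : C.dd (a - b) = C.dd a - C.dd b := by
  rw [eq_sub_iff_add_eq, ← C.dd_add, sub_add_cancel]

/-- The bracket of a torsion-free contravariant connection. -/
def bracket (a b : V) : V := C.D a b - C.D b a

theorem bracket_swap (a b : V) : C.bracket b a = -C.bracket a b := by simp [bracket]

theorem bracket_d (f h : A) : C.bracket (C.d f) (C.d h) = C.d (C.anchor (C.d f) h) := C.D_d f h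

theorem bracket_add_left (a a' b : V) :
    C.bracket (a + a') b = C.bracket a b + C.bracket a' b := by
  simp only [bracket, C.D_add_left, C.D_add]; abel

theorem bracket_smul_left (f : A) (a b : V) :
    C.bracket (f • a) b = f • C.bracket a b - C.anchor b f • a := by
  simp only [bracket, C.D_smul_left, C.D_smul]; module

/-- The Jacobiator, the defect of the anchor being a morphism of brackets. -/
def jacobiator (a b : V) (f : A) : A :=
  C.anchor a (C.anchor b f) - C.anchor b (C.anchor a f) - C.anchor (C.bracket a b) f

theorem jacobiator_swap (a b : V) (f : A) : C.jacobiator b a f = -C.jacobiator a b f := by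
  have h := C.anchor_sub_left 0 (C.bracket a b) f
  have h0 := C.anchor_sub_left 0 0 f
  simp only [sub_self] at h0
  simp only [zero_sub, h0] at h
  simp only [jacobiator, C.bracket_swap a b, h]; ring

theorem jacobiator_add_left (a a' b : V) (f : A) :
    C.jacobiator (a + a') b f = C.jacobiator a b f + C.jacobiator a' b f := by
  simp only [jacobiator, C.anchor_add_left, C.anchor_add, C.bracket_add_left]; ring

theorem jacobiator_smul_left (h : A) (a b : V) (f : A) :
    C.jacobiator (h • a) b f = h * C.jacobiator a b f := by
  simp only [jacobiator, C.bracket_smul_left, C.anchor_smul_left, C.anchor_sub_left,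
    C.anchor_mul]; ring

theorem jacobiator_d_cyclic (f h k : A) :
    C.jacobiator (C.d f) (C.d h) k = C.jacobiator (C.d h) (C.d k) f := by
  simp only [jacobiator, C.bracket_d]
  rw [C.anchor_d (C.anchor (C.d f) h) k, C.anchor_d (C.anchor (C.d h) k) f, C.anchor_d f k,
    C.anchor_d h f]
  simp only [C.anchor_neg]
  ring

/-- The curvature. -/
def curv (a b c : V) : V := C.D a (C.D b c) - C.D b (C.D a c) - C.D (C.bracket a b) c

theorem curv_swap (a b c : V) : C.curv b a c = -C.curv a b c := by
  have h := C.D_sub_left 0 (C.bracket a b) c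
  have h0 := C.D_sub_left 0 0 c
  simp only [sub_self] at h0
  simp only [zero_sub, h0] at h
  simp only [curv, C.bracket_swap a b, h]; abel

theorem curv_add_left (a a' b c : V) : C.curv (a + a') b c = C.curv a b c + C.curv a' b c := by
  simp only [curv, C.D_add_left, C.D_add, C.bracket_add_left]; abel

theorem curv_smul_left (f : A) (a b c : V) : C.curv (f • a) b c = f • C.curv a b c := by
  simp only [curv, C.bracket_smul_left, C.D_smul_left, C.D_sub_left, C.D_smul]; module

theorem curv_add_right (a b c c' : V) : C.curv a b (c + c') = C.curv a b c + C.curv a b c' := by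
  simp only [curv, C.D_add]; abel

theorem curv_smul_right (f : A) (a b c : V) :
    C.curv a b (f • c) = f • C.curv a b c + C.jacobiator a b f • c := by
  simp only [curv, jacobiator, C.D_smul, C.D_add]; module

/-- The curvature on `2`-forms. -/
def curvTwo (a b : V) (η : W) : W := C.DD a (C.DD b η) - C.DD b (C.DD a η) - C.DD (C.bracket a b) η

theorem curvTwo_add (a b : V) (η θ : W) :
    C.curvTwo a b (η + θ) = C.curvTwo a b η + C.curvTwo a b θ := by
  simp only [curvTwo, C.DD_add]; abel

theorem curvTwo_smul (a b : V) (f : A) (η : W) :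
    C.curvTwo a b (f • η) = f • C.curvTwo a b η + C.jacobiator a b f • η := by
  simp only [curvTwo, jacobiator, C.DD_smul, C.DD_add]; module

theorem curvTwo_wedge (a b c e : V) :
    C.curvTwo a b (C.wedge c e) = C.wedge (C.curv a b c) e + C.wedge c (C.curv a b e) := by
  simp only [curvTwo, curv, C.DD_wedge, C.DD_add, C.wedge_sub, C.wedge_sub_right]; abel

/-- The axioms of the bracket of two `1`-forms. -/
structure IsBracket (B : V → V → W) : Prop where
  add : ∀ a b c, B a (b + c) = B a b + B a c
  symm : ∀ a b, B a b = B b a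
  dd_D : ∀ f b, C.dd (C.D (C.d f) b) = B (C.d f) b + C.DD (C.d f) (C.dd b)
  smul : ∀ (f : A) a b, B a (f • b) = -C.wedge (C.D (C.d f) a) b + f • B a b

/-- The metacurvature. -/
def metacurv (B : V → V → W) (f : A) (a b : V) : W :=
  C.DD (C.d f) (B a b) - B (C.D (C.d f) a) b - B (C.D (C.d f) b) a

/-- The bracket `{df, b}` of an exact `1`-form and a `1`-form. -/
def exactBracket (f : A) (b : V) : W := C.dd (C.D (C.d f) b) - C.DD (C.d f) (C.dd b)

theorem exactBracket_add (f : A) (b c : V) :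
    C.exactBracket f (b + c) = C.exactBracket f b + C.exactBracket f c := by
  simp only [exactBracket, C.D_add, C.DD_add, C.dd_add]; abel

theorem exactBracket_smul (f h : A) (b : V) :
    C.exactBracket f (h • b) = h • C.exactBracket f b - C.wedge (C.D (C.d h) (C.d f)) b := by
  have e : C.D (C.d f) (C.d h) = C.d (C.anchor (C.d f) h) + C.D (C.d h) (C.d f) :=
    sub_eq_iff_eq_add.1 (C.D_d f h)
  simp only [exactBracket, C.D_smul, C.dd_smul, C.dd_add, C.DD_add, C.DD_smul, C.DD_wedge, e,
    C.wedge_add]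
  module

/-- The bracket `{∑ cᵢ dXᵢ, b}`, computed by the product rule. -/
def sumBracket {ι : Type*} [Fintype ι] (X c : ι → A) (b : V) : W :=
  ∑ i, (c i • C.exactBracket (X i) b - C.wedge (C.D (C.d (c i)) b) (C.d (X i)))

section SumBracket

variable {ι : Type*} [Fintype ι] (X c c' : ι → A)

theorem sumBracket_add (b b' : V) :
    C.sumBracket X c (b + b') = C.sumBracket X c b + C.sumBracket X c b' := by
  simp only [sumBracket, ← Finset.sum_add_distrib]
  refine Finset.sum_congr rfl fun i _ => ?_
  rw [C.exactBracket_add, C.D_add, C.wedge_add]; module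

theorem sumBracket_add_left (b : V) :
    C.sumBracket X (c + c') b = C.sumBracket X c b + C.sumBracket X c' b := by
  simp only [sumBracket, ← Finset.sum_add_distrib]
  refine Finset.sum_congr rfl fun i _ => ?_
  rw [Pi.add_apply, C.d_add, C.D_add_left, C.wedge_add]; module

theorem wedge_sum_right (a : V) (v : ι → V) : C.wedge a (∑ i, v i) = ∑ i, C.wedge a (v i) :=
  map_sum (AddMonoidHom.mk' (C.wedge a) (C.wedge_add_right a)) v Finset.univ

theorem wedge_sum_left (v : ι → V) (a : V) : C.wedge (∑ i, v i) a = ∑ i, C.wedge (v i) a :=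
  map_sum (AddMonoidHom.mk' (C.wedge · a) (fun b b' => C.wedge_add b b' a)) v Finset.univ

theorem D_sum (a : V) (v : ι → V) : C.D a (∑ i, v i) = ∑ i, C.D a (v i) :=
  map_sum (AddMonoidHom.mk' (C.D a) (C.D_add a)) v Finset.univ

theorem D_sum_left (v : ι → V) (a : V) : C.D (∑ i, v i) a = ∑ i, C.D (v i) a :=
  map_sum (AddMonoidHom.mk' (C.D · a) (fun b b' => C.D_add_left b b' a)) v Finset.univ

theorem DD_sum_left (v : ι → V) (η : W) : C.DD (∑ i, v i) η = ∑ i, C.DD (v i) η :=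
  map_sum (AddMonoidHom.mk' (C.DD · η) (fun b b' => C.DD_add_left b b' η)) v Finset.univ

theorem dd_sum (v : ι → V) : C.dd (∑ i, v i) = ∑ i, C.dd (v i) :=
  map_sum (AddMonoidHom.mk' C.dd C.dd_add) v Finset.univ

theorem sumBracket_smul (h : A) (b : V) :
    C.sumBracket X c (h • b) = h • C.sumBracket X c b -
      C.wedge (C.D (C.d h) (∑ i, c i • C.d (X i))) b := by
  rw [C.D_sum, C.wedge_sum_left]
  simp only [sumBracket, Finset.smul_sum, ← Finset.sum_sub_distrib]
  refine Finset.sum_congr rfl fun i _ => ?_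
  rw [C.exactBracket_smul, C.D_smul, C.D_smul, C.wedge_add, C.wedge_add, C.wedge_smul, C.wedge_smul,
    C.wedge_smul, C.wedge_smul, C.anchor_d (c i) h, C.wedge_comm b]
  module

theorem sumBracket_smul_left (h : A) (b : V) :
    C.sumBracket X (fun i => h * c i) b = h • C.sumBracket X c b -
      C.wedge (C.D (C.d h) b) (∑ i, c i • C.d (X i)) := by
  rw [C.wedge_sum_right]
  simp only [sumBracket, Finset.smul_sum, ← Finset.sum_sub_distrib]
  refine Finset.sum_congr rfl fun i _ => ?_
  rw [C.d_mul, C.D_add_left, C.D_smul_left, C.D_smul_left, C.wedge_add, C.wedge_smul, C.wedge_smul,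
    C.wedge_smul_right]
  module

theorem sumBracket_eq (b : V) :
    C.sumBracket X c b = C.dd (C.D (∑ i, c i • C.d (X i)) b) -
        C.DD (∑ i, c i • C.d (X i)) (C.dd b) -
      ∑ i, (C.wedge (C.d (c i)) (C.D (C.d (X i)) b) +
        C.wedge (C.D (C.d (c i)) b) (C.d (X i))) := by
  rw [C.D_sum_left, C.dd_sum, C.DD_sum_left]
  simp only [sumBracket, ← Finset.sum_sub_distrib]
  refine Finset.sum_congr rfl fun i _ => ?_
  rw [C.D_smul_left, C.dd_smul, C.DD_smul_left, exactBracket]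
  module

end SumBracket

namespace IsBracket

variable {C} {B : V → V → W}

theorem sub (hB : C.IsBracket B) (a b c : V) : B a (b - c) = B a b - B a c := by
  rw [eq_sub_iff_add_eq, ← hB.add, sub_add_cancel]

theorem add_left (hB : C.IsBracket B) (a b c : V) : B (a + b) c = B a c + B b c := by
  rw [hB.symm, hB.add, hB.symm c, hB.symm c]

theorem metacurv_symm (hB : C.IsBracket B) (f : A) (a b : V) : C.metacurv B f a b = C.metacurv B f b a := by
  simp only [metacurv, hB.symm b a]; abel

theorem metacurv_add_right (hB : C.IsBracket B) (f : A) (a b c : V) :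
    C.metacurv B f a (b + c) = C.metacurv B f a b + C.metacurv B f a c := by
  simp only [metacurv, hB.add, hB.add_left, C.D_add, C.DD_add]; abel

theorem metacurv_smul_right (hB : C.IsBracket B) (f h : A) (a b : V) (hR : C.curv (C.d f) (C.d h) a = 0) :
    C.metacurv B f a (h • b) = h • C.metacurv B f a b := by
  have h1 : C.wedge (C.D (C.d f) (C.D (C.d h) a)) b = C.wedge (C.D (C.d h) (C.D (C.d f) a)) b +
      C.wedge (C.D (C.d (C.anchor (C.d f) h)) a) b := by
    rw [← C.wedge_add]
    congr 1
    rw [curv, bracket_d, sub_sub, sub_eq_zero] at hR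
    exact hR
  simp only [metacurv, C.D_smul, hB.add_left]
  rw [hB.symm _ a, hB.symm _ a, hB.symm (C.D (C.d f) b) a]
  simp only [hB.smul, C.DD_add, C.DD_neg, C.DD_smul, C.DD_wedge, h1]
  module

theorem metacurv_d_comm (hB : C.IsBracket B) (f h : A) (b : V) (hR : C.curv (C.d f) (C.d h) b = 0)
    (hR₂ : C.curvTwo (C.d f) (C.d h) (C.dd b) = 0) :
    C.metacurv B f (C.d h) b = C.metacurv B h (C.d f) b := by
  have e : ∀ k c, B (C.d k) c = C.dd (C.D (C.d k) c) - C.DD (C.d k) (C.dd c) :=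
    fun k c => eq_sub_of_add_eq (hB.dd_D k c).symm
  have h1 : B (C.D (C.d f) (C.d h)) b = B (C.D (C.d h) (C.d f)) b +
      B (C.d (C.anchor (C.d f) h)) b := by
    rw [← C.D_d, ← hB.add_left, add_sub_cancel]
  rw [curv, bracket_d, sub_sub, sub_eq_zero] at hR
  rw [curvTwo, bracket_d, sub_sub, sub_eq_zero] at hR₂
  have hR' := congrArg C.dd hR
  rw [C.dd_add] at hR'
  simp only [metacurv]
  rw [h1, hB.symm (C.D (C.d f) b), hB.symm (C.D (C.d h) b), e, e, e, e, e, C.DD_sub, C.DD_sub, hR₂,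
    hR']
  abel

end IsBracket

end ContravariantCalculus

section Connection

variable {E : Type*} [NormedAddCommGroup E] [NormedSpace ℝ E] [FiniteDimensional ℝ E]
  {H : Type*} [TopologicalSpace H] {I : ModelWithCorners ℝ E H}
  {M : Type*} [TopologicalSpace M] [ChartedSpace H M]

theorem anchorDeriv_apply (P : ContraTwoTensor I M) (α : OneForm I M) (φ : M → ℝ) (x : M) :
    anchorDeriv P α φ x = P x (α x) (dFun φ x) :=
  apply_sharpAt P x (α x) (dFun φ x)

variable [IsManifold I ∞ M]

/-- A contravariant `2`-tensor field pairs smooth `1`-forms to smooth functions. -/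
def IsSmoothPairing (Q : ContraTwoTensor I M) : Prop :=
  ∀ α β : SmoothOneForms I M, SmoothFun I (pairing Q α.1 β.1)

/-- The function `Q(α, β)` as an element of `C^∞(M)`. -/
def pairingFun {Q : ContraTwoTensor I M} (hQ : IsSmoothPairing Q) (α β : SmoothOneForms I M) :
    SmoothFunctions I M :=
  ⟨pairing Q α.1 β.1, hQ α β⟩

/-- The derivative of a smooth function along the anchor of a smooth `1`-form. -/
def anchorFun {P : ContraTwoTensor I M} (hP : IsSmoothPairing P) (α : SmoothOneForms I M)
    (φ : SmoothFunctions I M) : SmoothFunctions I M :=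
  pairingFun hP α (differential φ)

section AnchorFun

variable {P : ContraTwoTensor I M} (hP : IsSmoothPairing P)

theorem anchorFun_val (α : SmoothOneForms I M) (φ : SmoothFunctions I M) :
    (anchorFun hP α φ).1 = anchorDeriv P α.1 φ.1 :=
  funext fun x => (anchorDeriv_apply P α.1 φ.1 x).symm

omit [FiniteDimensional ℝ E] [IsManifold I ∞ M] in
theorem smoothFunctions_ext {φ ψ : SmoothFunctions I M} (h : ∀ x, φ.1 x = ψ.1 x) : φ = ψ :=
  Subtype.ext (funext h)

theorem pairingFun_add_left (α α' β : SmoothOneForms I M) :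
    pairingFun hP (α + α') β = pairingFun hP α β + pairingFun hP α' β :=
  smoothFunctions_ext fun x => by
    change P x (α.1 x + α'.1 x) (β.1 x) = _
    rw [map_add]; rfl

theorem pairingFun_add_right (α β β' : SmoothOneForms I M) :
    pairingFun hP α (β + β') = pairingFun hP α β + pairingFun hP α β' :=
  smoothFunctions_ext fun x => by
    change P x (α.1 x) (β.1 x + β'.1 x) = _
    rw [map_add]; rfl

theorem pairingFun_smul_left (φ : SmoothFunctions I M) (α β : SmoothOneForms I M) :
    pairingFun hP (φ • α) β = φ * pairingFun hP α β :=
  smoothFunctions_ext fun x => by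
    change P x (φ.1 x • α.1 x) (β.1 x) = _
    rw [map_smul]; rfl

theorem pairingFun_smul_right (φ : SmoothFunctions I M) (α β : SmoothOneForms I M) :
    pairingFun hP α (φ • β) = φ * pairingFun hP α β :=
  smoothFunctions_ext fun x => by
    change P x (α.1 x) (φ.1 x • β.1 x) = _
    rw [map_smul]; rfl

theorem anchorFun_add_left (α β : SmoothOneForms I M) (φ : SmoothFunctions I M) :
    anchorFun hP (α + β) φ = anchorFun hP α φ + anchorFun hP β φ :=
  pairingFun_add_left hP _ _ _

theorem anchorFun_smul_left (φ : SmoothFunctions I M) (α : SmoothOneForms I M)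
    (ψ : SmoothFunctions I M) : anchorFun hP (φ • α) ψ = φ * anchorFun hP α ψ :=
  pairingFun_smul_left hP _ _ _

theorem anchorFun_add (α : SmoothOneForms I M) (φ ψ : SmoothFunctions I M) :
    anchorFun hP α (φ + ψ) = anchorFun hP α φ + anchorFun hP α ψ := by
  rw [anchorFun, differential_add, pairingFun_add_right]; rfl

theorem anchorFun_mul (α : SmoothOneForms I M) (φ ψ : SmoothFunctions I M) :
    anchorFun hP α (φ * ψ) = φ * anchorFun hP α ψ + ψ * anchorFun hP α φ := by
  rw [anchorFun, differential_mul, pairingFun_add_right, pairingFun_smul_right,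
    pairingFun_smul_right]; rfl

omit [FiniteDimensional ℝ E] [IsManifold I ∞ M] in
theorem pairing_swap_of_alternating {P : ContraTwoTensor I M}
    (hA : ∀ (x : M) (a : TangentSpace I x →L[ℝ] ℝ), P x a a = 0) (x : M)
    (a b : TangentSpace I x →L[ℝ] ℝ) : P x a b = -P x b a := by
  have h := hA x (a + b)
  simp only [map_add, add_apply, hA] at h
  linarith

theorem anchorFun_differential (hA : ∀ (x : M) (a : TangentSpace I x →L[ℝ] ℝ), P x a a = 0)
    (φ ψ : SmoothFunctions I M) :
    anchorFun hP (differential φ) ψ = -anchorFun hP (differential ψ) φ :=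
  smoothFunctions_ext fun x => pairing_swap_of_alternating hA x _ _

end AnchorFun

/-- The function `α(X)`. -/
def contract (α : SmoothOneForms I M) {X : VField I M} (hX : SmoothVField X) :
    SmoothFunctions I M :=
  ⟨fun x => α.1 x (X x), SmoothOneForm.apply α.2 hX⟩

/-- The function `η(X, Y)`. -/
def contractTwo (η : SmoothTwoForms I M) {X Y : VField I M} (hX : SmoothVField X)
    (hY : SmoothVField Y) : SmoothFunctions I M :=
  ⟨fun x => η.1 x (X x) (Y x), SmoothCovTwoTensor.apply η.2.1 hX hY⟩

variable {P : ContraTwoTensor I M} (hP : IsSmoothPairing P)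
  {D : OneForm I M → OneForm I M → OneForm I M} (hD : IsContravariantConnection P D)

/-- A contravariant connection on bundled smooth `1`-forms. -/
def connForm (hD : IsContravariantConnection P D) (α β : SmoothOneForms I M) :
    SmoothOneForms I M :=
  ⟨D α.1 β.1, hD.smooth _ _ α.2 β.2⟩

omit [FiniteDimensional ℝ E] in
theorem smoothTwoForms_swap (η : SmoothTwoForms I M) (x : M) (u v : TangentSpace I x) :
    η.1 x u v = -η.1 x v u := by
  have h1 := η.2.2 x (u + v)
  have h2 := η.2.2 x u
  have h3 := η.2.2 x v
  simp only [map_add, add_apply] at h1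
  linarith

include hP in
theorem connForm_smul (φ : SmoothFunctions I M) (α β : SmoothOneForms I M) :
    connForm hD α (φ • β) = φ • connForm hD α β + anchorFun hP α φ • β :=
  smoothOneForms_ext fun x => by
    have h := congrFun (hD.leibniz φ.1 α.1 β.1 φ.2 α.2 β.2) x
    rw [← anchorFun_val hP] at h
    exact h

theorem connForm_smul_left (φ : SmoothFunctions I M) (α β : SmoothOneForms I M) :
    connForm hD (φ • α) β = φ • connForm hD α β :=
  Subtype.ext (hD.smul_left φ.1 α.1 β.1 φ.2 α.2 β.2)

theorem connForm_add (α β γ : SmoothOneForms I M) :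
    connForm hD α (β + γ) = connForm hD α β + connForm hD α γ :=
  Subtype.ext (hD.add_right α.1 β.1 γ.1 α.2 β.2 γ.2)

theorem connForm_add_left (α β γ : SmoothOneForms I M) :
    connForm hD (α + β) γ = connForm hD α γ + connForm hD β γ :=
  Subtype.ext (hD.add_left α.1 β.1 γ.1 α.2 β.2 γ.2)

omit [IsManifold I ∞ M] in
theorem eq_of_covectors {x : M} {u v : TangentSpace I x}
    (h : ∀ c : TangentSpace I x →L[ℝ] ℝ, c u = c v) : u = v :=
  (Module.forall_dual_apply_eq_zero_iff ℝ (u - v)).1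
    (fun f => by
      have := h (LinearMap.toContinuousLinearMap f)
      rw [map_sub, sub_eq_zero]
      exact this) |> sub_eq_zero.1

variable [T2Space M]

include hP hD in
theorem apply_derivVField (α β : SmoothOneForms I M) {X : VField I M} (hX : SmoothVField X)
    (x : M) : β.1 x (derivVField P D α.1 X x) =
      (anchorFun hP α (contract β hX)).1 x - (connForm hD α β).1 x (X x) := by
  obtain ⟨v, hv⟩ := exists_vector_of_tensorial x
    (fun β => (anchorFun hP α (contract β hX)).1 x - (connForm hD α β).1 x (X x))
    (fun β γ => by
      have h : contract (β + γ) hX = contract β hX + contract γ hX := rfl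
      rw [h, anchorFun_add, connForm_add]
      simp only [smoothFunctions_add_apply, smoothOneForms_add_apply, add_apply]
      ring)
    (fun φ β => by
      have h : contract (φ • β) hX = φ * contract β hX := rfl
      rw [h, anchorFun_mul, connForm_smul hP]
      simp only [smoothFunctions_add_apply, smoothOneForms_add_apply, smoothFunctions_mul_apply,
        smoothOneForms_smul_apply, add_apply, smul_apply, smul_eq_mul]
      have h2 : (contract β hX).1 x = β.1 x (X x) := rfl
      rw [h2]
      ring)
  have h := Classical.epsilon_spec (p := fun v : TangentSpace I x =>
    ∀ β : OneForm I M, SmoothOneForm β →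
      β x v = anchorDeriv P α.1 (fun y => β y (X y)) x - D α.1 β x (X x))
    ⟨v, fun β hβ => by
      have h1 := hv ⟨β, hβ⟩
      rw [anchorFun_val] at h1
      exact h1.symm⟩
  rw [anchorFun_val]
  exact h β.1 β.2

include hP hD in
theorem derivVField_add_left (α α' : SmoothOneForms I M) {X : VField I M} (hX : SmoothVField X)
    (x : M) : derivVField P D (α + α').1 X x =
      derivVField P D α.1 X x + derivVField P D α'.1 X x := by
  refine eq_of_covectors fun c => ?_
  obtain ⟨φ, rfl⟩ := exists_differential_eq x c
  rw [map_add, apply_derivVField hP hD _ _ hX, apply_derivVField hP hD _ _ hX,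
    apply_derivVField hP hD _ _ hX, anchorFun_add_left, connForm_add_left]
  simp only [smoothFunctions_add_apply, smoothOneForms_add_apply, add_apply]
  ring

include hP hD in
theorem derivVField_smul_left (ψ : SmoothFunctions I M) (α : SmoothOneForms I M) {X : VField I M}
    (hX : SmoothVField X) (x : M) : derivVField P D (ψ • α).1 X x =
      ψ.1 x • derivVField P D α.1 X x := by
  refine eq_of_covectors fun c => ?_
  obtain ⟨φ, rfl⟩ := exists_differential_eq x c
  rw [map_smul, apply_derivVField hP hD _ _ hX, apply_derivVField hP hD _ _ hX,
    anchorFun_smul_left, connForm_smul_left]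
  simp only [smoothFunctions_mul_apply, smoothOneForms_smul_apply, smul_apply, smul_eq_mul]
  ring

/-- `θ` is the contravariant derivative of the `2`-form `η` at `x`. -/
def IsDerivTwoForm (hP : IsSmoothPairing P) (D : OneForm I M → OneForm I M → OneForm I M)
    (α : SmoothOneForms I M) (η : SmoothTwoForms I M) (x : M)
    (θ : TangentSpace I x →L[ℝ] TangentSpace I x →L[ℝ] ℝ) : Prop :=
  ∀ (X Y : VField I M) (hX : SmoothVField X) (hY : SmoothVField Y),
    θ (X x) (Y x) = (anchorFun hP α (contractTwo η hX hY)).1 x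
      - η.1 x (derivVField P D α.1 X x) (Y x) - η.1 x (X x) (derivVField P D α.1 Y x)

namespace IsDerivTwoForm

variable {hP} {α : SmoothOneForms I M} {η η' : SmoothTwoForms I M} {x : M}
  {θ θ' : TangentSpace I x →L[ℝ] TangentSpace I x →L[ℝ] ℝ}

theorem unique (h : IsDerivTwoForm hP D α η x θ) (h' : IsDerivTwoForm hP D α η x θ') :
    θ = θ' := by
  ext u v
  obtain ⟨X, hX, rfl⟩ := exists_smoothVField_eq x u
  obtain ⟨Y, hY, rfl⟩ := exists_smoothVField_eq x v
  rw [h X Y hX hY, h' X Y hX hY]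

omit [T2Space M] in
theorem add (h : IsDerivTwoForm hP D α η x θ) (h' : IsDerivTwoForm hP D α η' x θ') :
    IsDerivTwoForm hP D α (η + η') x (θ + θ') := by
  intro X Y hX hY
  have e : contractTwo (η + η') hX hY = contractTwo η hX hY + contractTwo η' hX hY := rfl
  rw [add_apply, add_apply, h X Y hX hY, h' X Y hX hY, e, anchorFun_add]
  simp only [smoothFunctions_add_apply, smoothTwoForms_add_apply, add_apply]
  ring

omit [T2Space M] in
theorem smul (φ : SmoothFunctions I M) (h : IsDerivTwoForm hP D α η x θ) :
    IsDerivTwoForm hP D α (φ • η) x (φ.1 x • θ + (anchorFun hP α φ).1 x • η.1 x) := by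
  intro X Y hX hY
  have e : contractTwo (φ • η) hX hY = φ * contractTwo η hX hY := rfl
  have e' : (contractTwo η hX hY).1 x = η.1 x (X x) (Y x) := rfl
  simp only [add_apply, smul_apply, smul_eq_mul]
  rw [h X Y hX hY, e, anchorFun_mul]
  simp only [smoothFunctions_add_apply, smoothFunctions_mul_apply, smoothTwoForms_smul_apply,
    smul_apply, smul_eq_mul, e']
  ring

theorem wedge (hD : IsContravariantConnection P D) (α β γ : SmoothOneForms I M) (x : M) :
    IsDerivTwoForm hP D α (wedgeForm β γ) x
      ((wedgeForm (connForm hD α β) γ + wedgeForm β (connForm hD α γ)).1 x) := by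
  intro X Y hX hY
  have hn : ∀ φ : SmoothFunctions I M, (anchorFun hP α (-φ)).1 x = -(anchorFun hP α φ).1 x := by
    intro φ
    have h1 := congrArg (fun f => f.1 x) (anchorFun_add hP α φ (-φ))
    have h0 := congrArg (fun f => f.1 x) (anchorFun_add hP α 0 0)
    simp only [add_zero, smoothFunctions_add_apply] at h0
    simp only [add_neg_cancel, smoothFunctions_add_apply] at h1
    linarith
  have e : contractTwo (wedgeForm β γ) hX hY =
      contract β hX * contract γ hY + -(contract γ hX * contract β hY) :=
    smoothFunctions_ext fun y => sub_eq_add_neg _ _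
  rw [e, anchorFun_add, smoothFunctions_add_apply, hn, anchorFun_mul, anchorFun_mul]
  simp only [smoothFunctions_add_apply, smoothFunctions_mul_apply, smoothTwoForms_add_apply,
    add_apply, wedgeForm_apply]
  simp only [apply_derivVField hP hD _ _ hX, apply_derivVField hP hD _ _ hY]
  have e1 : ∀ (δ : SmoothOneForms I M) {Z : VField I M} (hZ : SmoothVField Z),
    (contract δ hZ).1 x = δ.1 x (Z x) := fun _ _ _ => rfl
  simp only [e1]
  ring

theorem add_left (hD : IsContravariantConnection P D) {α' : SmoothOneForms I M}
    (h : IsDerivTwoForm hP D α η x θ)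
    (h' : IsDerivTwoForm hP D α' η x θ') : IsDerivTwoForm hP D (α + α') η x (θ + θ') := by
  intro X Y hX hY
  rw [add_apply, add_apply, h X Y hX hY, h' X Y hX hY, anchorFun_add_left,
    derivVField_add_left hP hD _ _ hX, derivVField_add_left hP hD _ _ hY]
  simp only [smoothFunctions_add_apply, map_add, add_apply]
  ring

theorem smul_left (hD : IsContravariantConnection P D) (φ : SmoothFunctions I M)
    (h : IsDerivTwoForm hP D α η x θ) : IsDerivTwoForm hP D (φ • α) η x (φ.1 x • θ) := by
  intro X Y hX hY
  rw [smul_apply, smul_apply, h X Y hX hY, anchorFun_smul_left,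
    derivVField_smul_left hP hD _ _ hX, derivVField_smul_left hP hD _ _ hY]
  simp only [smoothFunctions_mul_apply, map_smul, smul_apply, smul_eq_mul]
  ring

omit [T2Space M] in
theorem cancel {χ : SmoothFunctions I M} (hχ : ∀ᶠ y in 𝓝 x, χ.1 y = 1)
    (h : IsDerivTwoForm hP D α (χ • η) x θ) : IsDerivTwoForm hP D α η x θ := by
  intro X Y hX hY
  rw [h X Y hX hY, smoothTwoForms_smul_apply, hχ.self_of_nhds, one_smul]
  have h1 : (contractTwo (χ • η) hX hY).1 =ᶠ[𝓝 x] (contractTwo η hX hY).1 := by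
    filter_upwards [hχ] with y hy
    change χ.1 y * η.1 y (X y) (Y y) = _
    rw [hy, one_mul]; rfl
  rw [anchorFun_val, anchorFun_val, anchorDeriv_apply, anchorDeriv_apply, dFun_congr h1]

include hD in
theorem exists_isDerivTwoForm (hP : IsSmoothPairing P) (α : SmoothOneForms I M)
    (η : SmoothTwoForms I M) (x : M) : ∃ θ, IsDerivTwoForm hP D α η x θ := by
  refine twoForm_induction x (p := fun η => ∃ θ, IsDerivTwoForm hP D α η x θ) ?_ ?_ ?_ ?_ η
  · exact fun φ ψ => ⟨_, wedge hD α _ _ x⟩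
  · rintro η η' ⟨θ, h⟩ ⟨θ', h'⟩
    exact ⟨_, h.add h'⟩
  · rintro φ η ⟨θ, h⟩
    exact ⟨_, h.smul φ⟩
  · rintro χ η hχ ⟨θ, h⟩
    exact ⟨θ, h.cancel hχ⟩

end IsDerivTwoForm

include hD in
theorem isDerivTwoForm (α : SmoothOneForms I M) (η : SmoothTwoForms I M) (x : M) :
    IsDerivTwoForm hP D α η x (derivTwoForm P D α.1 η.1 x) := by
  obtain ⟨θ, hθ⟩ := IsDerivTwoForm.exists_isDerivTwoForm hD hP α η x
  have h := Classical.epsilon_spec (p := fun θ : TangentSpace I x →L[ℝ] TangentSpace I x →L[ℝ] ℝ =>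
    ∀ X Y : VField I M, SmoothVField X → SmoothVField Y →
      θ (X x) (Y x) = anchorDeriv P α.1 (fun y => η.1 y (X y) (Y y)) x
        - η.1 x (derivVField P D α.1 X x) (Y x) - η.1 x (X x) (derivVField P D α.1 Y x))
    ⟨θ, fun X Y hX hY => by
      have h1 := hθ X Y hX hY
      rw [anchorFun_val] at h1
      exact h1⟩
  intro X Y hX hY
  rw [anchorFun_val]
  exact h X Y hX hY

theorem IsDerivTwoForm.eq {hP : IsSmoothPairing P} (hD : IsContravariantConnection P D)
    {α : SmoothOneForms I M} {η : SmoothTwoForms I M} {x : M}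
    {θ : TangentSpace I x →L[ℝ] TangentSpace I x →L[ℝ] ℝ} (h : IsDerivTwoForm hP D α η x θ) :
    derivTwoForm P D α.1 η.1 x = θ :=
  (isDerivTwoForm hP hD α η x).unique h

include hP hD in
theorem smoothTwoForm_derivTwoForm (α : SmoothOneForms I M) (η : SmoothTwoForms I M) :
    SmoothTwoForm (derivTwoForm P D α.1 η.1) := by
  refine ⟨smoothCovTwoTensor_of_eventuallyEq fun x₀ => ?_, fun x u => ?_⟩
  · refine twoForm_induction x₀ (p := fun η => ∃ θ : CovTwoTensor I M, SmoothCovTwoTensor θ ∧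
      ∀ᶠ y in 𝓝 x₀, derivTwoForm P D α.1 η.1 y = θ y) ?_ ?_ ?_ ?_ η
    · exact fun φ ψ => ⟨_, (wedgeForm (connForm hD α _) _ + wedgeForm _ (connForm hD α _)).2.1,
        Filter.Eventually.of_forall fun y =>
          (IsDerivTwoForm.wedge (hP := hP) hD α (differential φ) (differential ψ) y).eq hD⟩
    · rintro η η' ⟨θ, hθ, h⟩ ⟨θ', hθ', h'⟩
      refine ⟨θ + θ', hθ.add hθ', ?_⟩
      filter_upwards [h, h'] with y hy hy'
      rw [((isDerivTwoForm hP hD α η y).add (isDerivTwoForm hP hD α η' y)).eq hD, hy, hy']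
      rfl
    · rintro φ η ⟨θ, hθ, h⟩
      refine ⟨(fun x => φ.1 x • θ x) + fun x => (anchorFun hP α φ).1 x • η.1 x,
        (hθ.smul φ.2).add (η.2.1.smul (anchorFun hP α φ).2), ?_⟩
      filter_upwards [h] with y hy
      rw [((isDerivTwoForm hP hD α η y).smul φ).eq hD, hy]
      rfl
    · rintro χ η hχ ⟨θ, hθ, h⟩
      refine ⟨θ, hθ, ?_⟩
      filter_upwards [h, eventually_eventually_nhds.2 hχ] with y hy hy'
      rw [← hy]
      exact ((isDerivTwoForm hP hD α (χ • η) y).cancel hy').eq hD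
  · obtain ⟨X, hX, rfl⟩ := exists_smoothVField_eq x u
    rw [isDerivTwoForm hP hD α η x X X hX hX]
    have h : contractTwo η hX hX = 0 := smoothFunctions_ext fun y => η.2.2 y _
    have h0 := congrArg (fun f => f.1 x) (anchorFun_add hP α 0 0)
    simp only [add_zero, smoothFunctions_add_apply] at h0
    have h1 := smoothTwoForms_swap η x (X x) (derivVField P D α.1 X x)
    rw [h]
    linarith

/-- The contravariant derivative of a smooth `2`-form, as a smooth `2`-form. -/
def connTwoForm (hP : IsSmoothPairing P) (hD : IsContravariantConnection P D)
    (α : SmoothOneForms I M) (η : SmoothTwoForms I M) : SmoothTwoForms I M :=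
  ⟨derivTwoForm P D α.1 η.1, smoothTwoForm_derivTwoForm hP hD α η⟩

theorem connTwoForm_add (α : SmoothOneForms I M) (η θ : SmoothTwoForms I M) :
    connTwoForm hP hD α (η + θ) = connTwoForm hP hD α η + connTwoForm hP hD α θ :=
  smoothTwoForms_ext fun x =>
    ((isDerivTwoForm hP hD α η x).add (isDerivTwoForm hP hD α θ x)).eq hD

theorem connTwoForm_add_left (α β : SmoothOneForms I M) (η : SmoothTwoForms I M) :
    connTwoForm hP hD (α + β) η = connTwoForm hP hD α η + connTwoForm hP hD β η :=
  smoothTwoForms_ext fun x =>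
    ((isDerivTwoForm hP hD α η x).add_left hD (isDerivTwoForm hP hD β η x)).eq hD

theorem connTwoForm_smul_left (φ : SmoothFunctions I M) (α : SmoothOneForms I M)
    (η : SmoothTwoForms I M) : connTwoForm hP hD (φ • α) η = φ • connTwoForm hP hD α η :=
  smoothTwoForms_ext fun x => ((isDerivTwoForm hP hD α η x).smul_left hD φ).eq hD

theorem connTwoForm_smul (α : SmoothOneForms I M) (φ : SmoothFunctions I M)
    (η : SmoothTwoForms I M) : connTwoForm hP hD α (φ • η) =
      φ • connTwoForm hP hD α η + anchorFun hP α φ • η :=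
  smoothTwoForms_ext fun x => ((isDerivTwoForm hP hD α η x).smul φ).eq hD

theorem connTwoForm_wedge (α β γ : SmoothOneForms I M) :
    connTwoForm hP hD α (wedgeForm β γ) =
      wedgeForm (connForm hD α β) γ + wedgeForm β (connForm hD α γ) :=
  smoothTwoForms_ext fun x => (IsDerivTwoForm.wedge (hP := hP) hD α β γ x).eq hD

theorem connTwoForm_cancel (α : SmoothOneForms I M) {χ : SmoothFunctions I M}
    (η : SmoothTwoForms I M) {x : M} (hχ : ∀ᶠ y in 𝓝 x, χ.1 y = 1) :
    (connTwoForm hP hD α (χ • η)).1 x = (connTwoForm hP hD α η).1 x :=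
  (((isDerivTwoForm hP hD α (χ • η) x).cancel hχ).eq hD).symm

end Connection

section Koszul

variable {E : Type*} [NormedAddCommGroup E] [NormedSpace ℝ E] [FiniteDimensional ℝ E]
  {H : Type*} [TopologicalSpace H] {I : ModelWithCorners ℝ E H}
  {M : Type*} [TopologicalSpace M] [ChartedSpace H M] [IsManifold I ∞ M] [I.Boundaryless]
  [T2Space M]

/-- All values of the contravariant tensor `P` are alternating. -/
def IsAlternatingField (P : ContraTwoTensor I M) : Prop :=
  ∀ (x : M) (a : TangentSpace I x →L[ℝ] ℝ), P x a a = 0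

variable {P : ContraTwoTensor I M} (hP : IsSmoothPairing P) (hA : IsAlternatingField P)

include hA in
theorem koszulBracket_apply (α β : SmoothOneForms I M) (x : M) :
    koszulBracket P α.1 β.1 x = (exteriorDeriv β).1 x (sharp P α.1 x) -
      (exteriorDeriv α).1 x (sharp P β.1 x) + (differential (pairingFun hP α β)).1 x := by
  have h1 : ∀ α β : SmoothOneForms I M, (fun y => β.1 y (sharp P α.1 y)) = pairing P α.1 β.1 :=
    fun α β => funext fun y => apply_sharpAt P y (α.1 y) (β.1 y)
  have h2 : pairing P β.1 α.1 = -pairing P α.1 β.1 :=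
    funext fun y => pairing_swap_of_alternating hA y _ _
  have h3 : (dFun (pairing P β.1 α.1) : OneForm I M) x = -dFun (pairing P α.1 β.1) x := by
    have h := congrFun (congrArg Subtype.val
      (differential_add (pairingFun hP α β) (pairingFun hP β α))) x
    have h0 : (pairingFun hP α β + pairingFun hP β α) = ⟨fun _ => 0, contMDiff_const⟩ :=
      smoothFunctions_ext fun y => by
        change pairing P α.1 β.1 y + pairing P β.1 α.1 y = 0
        rw [h2]; exact add_neg_cancel _
    rw [h0] at h
    have h4 : (differential (⟨fun _ => 0, contMDiff_const⟩ : SmoothFunctions I M)).1 x = 0 :=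
      congrFun (dFun_const 0) x
    rw [h4] at h
    exact (neg_eq_of_add_eq_zero_right h.symm).symm
  simp only [koszulBracket, lieDerivOne, h1, h3]
  change (exteriorDeriv β).1 x (sharp P α.1 x) + (differential (pairingFun hP α β)).1 x -
    ((exteriorDeriv α).1 x (sharp P β.1 x) + -(differential (pairingFun hP α β)).1 x) -
    (differential (pairingFun hP α β)).1 x = _
  abel

include hA in
theorem koszulBracket_differential (φ ψ : SmoothFunctions I M) :
    koszulBracket P (differential φ).1 (differential ψ).1 =
      (differential (anchorFun hP (differential φ) ψ)).1 := by
  funext x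
  rw [koszulBracket_apply hP hA, exteriorDeriv_differential, exteriorDeriv_differential]
  change (0 : TangentSpace I x →L[ℝ] TangentSpace I x →L[ℝ] ℝ) _ -
    (0 : TangentSpace I x →L[ℝ] TangentSpace I x →L[ℝ] ℝ) _ + _ = _
  simp [anchorFun]

include hP hA in
theorem koszulBracket_swap (α β : SmoothOneForms I M) :
    koszulBracket P β.1 α.1 = -koszulBracket P α.1 β.1 := by
  funext x
  have h2 : pairingFun hP β α = -pairingFun hP α β :=
    smoothFunctions_ext fun y => pairing_swap_of_alternating hA y _ _
  have h3 : (differential (pairingFun hP β α)).1 x = -(differential (pairingFun hP α β)).1 x := by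
    have h := congrFun (congrArg Subtype.val
      (differential_add (pairingFun hP α β) (-pairingFun hP α β))) x
    have h4 : (differential (0 : SmoothFunctions I M)).1 x = 0 :=
      congrFun (dFun_const 0) x
    rw [add_neg_cancel, h4] at h
    rw [h2]
    exact (neg_eq_of_add_eq_zero_right h.symm).symm
  rw [koszulBracket_apply hP hA, Pi.neg_apply, koszulBracket_apply hP hA, h3]
  abel

include hP hA in
theorem koszulBracket_add_right (α β γ : SmoothOneForms I M) :
    koszulBracket P α.1 (β + γ).1 = koszulBracket P α.1 β.1 + koszulBracket P α.1 γ.1 := by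
  funext x
  rw [Pi.add_apply, koszulBracket_apply hP hA, koszulBracket_apply hP hA,
    koszulBracket_apply hP hA, exteriorDeriv_add, pairingFun_add_right, differential_add]
  have h : sharp P (β + γ).1 x = sharp P β.1 x + sharp P γ.1 x := by
    refine eq_of_covectors fun c => ?_
    rw [map_add]
    simp only [sharp, apply_sharpAt, smoothOneForms_add_apply, map_add, add_apply]
  rw [h]
  simp only [smoothOneForms_add_apply, smoothTwoForms_add_apply, map_add, add_apply]
  abel

include hP hA in
theorem koszulBracket_smul_right (φ : SmoothFunctions I M) (α β : SmoothOneForms I M) (x : M) :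
    koszulBracket P α.1 (φ • β).1 x =
      φ.1 x • koszulBracket P α.1 β.1 x + (anchorFun hP α φ).1 x • β.1 x := by
  rw [koszulBracket_apply hP hA, koszulBracket_apply hP hA, exteriorDeriv_smul,
    pairingFun_smul_right, differential_mul]
  have h : sharp P (φ • β).1 x = φ.1 x • sharp P β.1 x := by
    refine eq_of_covectors fun c => ?_
    rw [map_smul]
    simp only [sharp, apply_sharpAt, smoothOneForms_smul_apply, map_smul, smul_apply]
  rw [h]
  ext v
  have h1 : (differential φ).1 x (sharp P α.1 x) = (anchorFun hP α φ).1 x := apply_sharpAt _ _ _ _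
  have h2 : β.1 x (sharp P α.1 x) = (pairingFun hP α β).1 x := apply_sharpAt _ _ _ _
  simp only [smoothOneForms_add_apply, smoothTwoForms_add_apply, map_smul, add_apply, sub_apply,
    smoothOneForms_smul_apply, smoothTwoForms_smul_apply, smul_apply, wedgeForm_apply, smul_eq_mul,
    h1, h2]
  ring

include hP hA in
theorem smoothOneForm_koszulBracket (α β : SmoothOneForms I M) :
    SmoothOneForm (koszulBracket P α.1 β.1) := by
  refine smoothOneForm_of_eventuallyEq fun x₀ => ?_
  have hloc : ∀ {χ : SmoothFunctions I M} {y : M} (α β : SmoothOneForms I M),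
      (∀ᶠ z in 𝓝 y, χ.1 z = 1) →
      koszulBracket P α.1 (χ • β).1 y = koszulBracket P α.1 β.1 y := by
    intro χ y α β hχ
    rw [koszulBracket_smul_right hP hA, hχ.self_of_nhds, one_smul, anchorFun]
    have : (pairingFun hP α (differential χ)).1 y = 0 := by
      change P y (α.1 y) ((differential χ).1 y) = 0
      rw [differential_apply_of_eventuallyEq_one hχ, map_zero]
    rw [this, zero_smul, add_zero]
  have hind : ∀ α : SmoothOneForms I M, (∀ φ : SmoothFunctions I M, ∃ θ : OneForm I M,
      SmoothOneForm θ ∧ ∀ᶠ y in 𝓝 x₀, koszulBracket P α.1 (differential φ).1 y = θ y) →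
      ∀ β : SmoothOneForms I M, ∃ θ : OneForm I M,
      SmoothOneForm θ ∧ ∀ᶠ y in 𝓝 x₀, koszulBracket P α.1 β.1 y = θ y := by
    intro α h β
    refine oneForm_induction x₀ (p := fun β => ∃ θ : OneForm I M,
      SmoothOneForm θ ∧ ∀ᶠ y in 𝓝 x₀, koszulBracket P α.1 β.1 y = θ y) h ?_ ?_ ?_ β
    · rintro β β' ⟨θ, hθ, h⟩ ⟨θ', hθ', h'⟩
      refine ⟨θ + θ', hθ.add hθ', ?_⟩
      filter_upwards [h, h'] with y hy hy'
      rw [koszulBracket_add_right hP hA, Pi.add_apply, hy, hy']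
      rfl
    · rintro φ β ⟨θ, hθ, h⟩
      refine ⟨(fun x => φ.1 x • θ x) + fun x => (anchorFun hP α φ).1 x • β.1 x,
        (hθ.smul φ.2).add (SmoothOneForm.smul (anchorFun hP α φ).2 β.2), ?_⟩
      filter_upwards [h] with y hy
      rw [koszulBracket_smul_right hP hA, hy]
      rfl
    · rintro χ β hχ ⟨θ, hθ, h⟩
      refine ⟨θ, hθ, ?_⟩
      filter_upwards [h, eventually_eventually_nhds.2 hχ] with y hy hy'
      rw [← hy, hloc α β hy']
  refine hind α (fun φ => ?_) β
  obtain ⟨θ, hθ, h⟩ := hind (differential φ) (fun ψ => ⟨_, (differential _).2,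
    Filter.Eventually.of_forall fun y => congrFun (koszulBracket_differential hP hA φ ψ) y⟩) α
  refine ⟨fun x => (-1 : ℝ) • θ x, hθ.smul contMDiff_const, ?_⟩
  filter_upwards [h] with y hy
  rw [koszulBracket_swap hP hA, Pi.neg_apply, hy, neg_one_smul]

/-- The Koszul bracket of smooth `1`-forms, as a smooth `1`-form. -/
def koszulForm (α β : SmoothOneForms I M) : SmoothOneForms I M :=
  ⟨koszulBracket P α.1 β.1, smoothOneForm_koszulBracket hP hA α β⟩

theorem koszulForm_swap (α β : SmoothOneForms I M) :
    koszulForm hP hA β α = -koszulForm hP hA α β :=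
  Subtype.ext (koszulBracket_swap hP hA α β)

theorem koszulForm_add_right (α β γ : SmoothOneForms I M) :
    koszulForm hP hA α (β + γ) = koszulForm hP hA α β + koszulForm hP hA α γ :=
  Subtype.ext (koszulBracket_add_right hP hA α β γ)

theorem koszulForm_smul_right (φ : SmoothFunctions I M) (α β : SmoothOneForms I M) :
    koszulForm hP hA α (φ • β) = φ • koszulForm hP hA α β + anchorFun hP α φ • β :=
  Subtype.ext (funext (koszulBracket_smul_right hP hA φ α β))

variable {D : OneForm I M → OneForm I M → OneForm I M} (hD : IsContravariantConnection P D)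

/-- The connection `D` is torsion-free with respect to the Koszul bracket of `P`. -/
def IsTorsionFree (P : ContraTwoTensor I M) (D : OneForm I M → OneForm I M → OneForm I M) : Prop :=
  ∀ α β : OneForm I M, SmoothOneForm α → SmoothOneForm β → D α β - D β α = koszulBracket P α β

variable (hT : IsTorsionFree P D)

/-- The calculus of smooth forms of a torsion-free contravariant connection. -/
def calculus : ContravariantCalculus (SmoothFunctions I M) (SmoothOneForms I M)
    (SmoothTwoForms I M) where
  d := differential
  dd := exteriorDeriv
  wedge := wedgeForm
  anchor := anchorFun hP
  D := connForm hD
  DD := connTwoForm hP hD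
  d_add := differential_add
  d_mul := differential_mul
  dd_add := exteriorDeriv_add
  dd_smul := exteriorDeriv_smul
  dd_d := exteriorDeriv_differential
  wedge_comm := wedgeForm_comm
  wedge_smul := wedgeForm_smul_left
  wedge_add := wedgeForm_add_left
  anchor_add_left := anchorFun_add_left hP
  anchor_smul_left := anchorFun_smul_left hP
  anchor_add := anchorFun_add hP
  anchor_mul := anchorFun_mul hP
  anchor_d := anchorFun_differential hP hA
  D_add_left := connForm_add_left hD
  D_smul_left := connForm_smul_left hD
  D_add := connForm_add hD
  D_smul := fun α φ β => connForm_smul hP hD φ α β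
  D_d := fun φ ψ => Subtype.ext <|
    (hT _ _ (differential φ).2 (differential ψ).2).trans (koszulBracket_differential hP hA φ ψ)
  DD_add_left := connTwoForm_add_left hP hD
  DD_smul_left := connTwoForm_smul_left hP hD
  DD_add := connTwoForm_add hP hD
  DD_smul := connTwoForm_smul hP hD
  DD_wedge := connTwoForm_wedge hP hD

end Koszul

theorem ContravariantCalculus.exactBracket_symm {A V W : Type*} [CommRing A] [AddCommGroup V]
    [Module A V] [AddCommGroup W] [Module A W] (C : ContravariantCalculus A V W) (f h : A) :
    C.exactBracket f (C.d h) = C.exactBracket h (C.d f) := by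
  rw [← sub_eq_zero]
  simp only [exactBracket, C.dd_d, C.DD_zero, sub_zero]
  rw [← C.dd_sub, C.D_d, C.dd_d]

/-! ### Existence of the generalized pre-Poisson bracket -/

section BracketExistence

variable {E : Type*} [NormedAddCommGroup E] [NormedSpace ℝ E] [FiniteDimensional ℝ E]
  {H : Type*} [TopologicalSpace H] {I : ModelWithCorners ℝ E H}
  {M : Type*} [TopologicalSpace M] [ChartedSpace H M] [IsManifold I ∞ M] [I.Boundaryless]
  [T2Space M]
  {P : ContraTwoTensor I M} (hP : IsSmoothPairing P) (hA : IsAlternatingField P)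
  {D : OneForm I M → OneForm I M → OneForm I M} (hD : IsContravariantConnection P D)
  (hT : IsTorsionFree P D)

theorem eq_zero_of_tensorial_of_swap (x : M) {F : Type*} [AddCommGroup F] [Module ℝ F]
    {T : SmoothOneForms I M → SmoothOneForms I M → F}
    (add : ∀ α α' β, T (α + α') β = T α β + T α' β)
    (smul : ∀ (φ : SmoothFunctions I M) (α β : SmoothOneForms I M), T (φ • α) β = φ.1 x • T α β)
    (swap : ∀ α β, T α β = -T β α)
    (exact : ∀ φ ψ : SmoothFunctions I M, T (differential φ) (differential ψ) = 0)
    (α β : SmoothOneForms I M) : T α β = 0 := by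
  obtain ⟨φ, hφ⟩ := exists_differential_eq x (α.1 x)
  obtain ⟨ψ, hψ⟩ := exists_differential_eq x (β.1 x)
  have h1 : ∀ γ, T α γ = T (differential φ) γ := fun γ =>
    eq_of_tensorial x (L := fun δ => T δ γ) (fun _ _ => add _ _ _) (fun _ _ => smul _ _ _) hφ.symm
  have h2 : ∀ γ, T β γ = T (differential ψ) γ := fun γ =>
    eq_of_tensorial x (L := fun δ => T δ γ) (fun _ _ => add _ _ _) (fun _ _ => smul _ _ _) hψ.symm
  rw [h1, swap, h2, swap, neg_neg, exact]

theorem wedgeForm_congr {α α' β β' : SmoothOneForms I M} {x : M} (h : α.1 x = α'.1 x)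
    (h' : β.1 x = β'.1 x) : (wedgeForm α β).1 x = (wedgeForm α' β').1 x := by
  ext u v
  rw [wedgeForm_apply, wedgeForm_apply, h, h']

theorem anchorFun_cutoff {χ : SmoothFunctions I M} {x : M} (hχ : ∀ᶠ y in 𝓝 x, χ.1 y = 1)
    (α : SmoothOneForms I M) : (anchorFun hP α χ).1 x = 0 := by
  change P x (α.1 x) ((differential χ).1 x) = 0
  rw [differential_apply_of_eventuallyEq_one hχ, map_zero]

include hP in
theorem connForm_cancel {χ : SmoothFunctions I M} {x : M} (hχ : ∀ᶠ y in 𝓝 x, χ.1 y = 1)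
    (α β : SmoothOneForms I M) : (connForm hD α (χ • β)).1 x = (connForm hD α β).1 x := by
  rw [connForm_smul hP, smoothOneForms_add_apply, smoothOneForms_smul_apply,
    smoothOneForms_smul_apply, anchorFun_cutoff hP hχ, hχ.self_of_nhds, one_smul, zero_smul,
    add_zero]

theorem exteriorDeriv_cancel {χ : SmoothFunctions I M} {x : M} (hχ : ∀ᶠ y in 𝓝 x, χ.1 y = 1)
    (α : SmoothOneForms I M) : (exteriorDeriv (χ • α)).1 x = (exteriorDeriv α).1 x := by
  refine dOne_congr ?_
  filter_upwards [hχ] with y hy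
  rw [smoothOneForms_smul_apply, hy, one_smul]

/-- The bracket of two smooth `1`-forms at `x`, computed in a frame at `x`. -/
def bracketAt (α β : SmoothOneForms I M) (x : M) :
    TangentSpace I x →L[ℝ] TangentSpace I x →L[ℝ] ℝ :=
  let F : CoordinateFrame I x := Classical.choice (exists_coordinateFrame I x)
  ((calculus hP hA hD hT).sumBracket F.coordFun (fun a => F.coeff a α) β).1 x

theorem bracketAt_add (α β γ : SmoothOneForms I M) (x : M) :
    bracketAt hP hA hD hT α (β + γ) x =
      bracketAt hP hA hD hT α β x + bracketAt hP hA hD hT α γ x := by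
  simp only [bracketAt, ContravariantCalculus.sumBracket_add]
  rfl

theorem bracketAt_add_left (α β γ : SmoothOneForms I M) (x : M) :
    bracketAt hP hA hD hT (α + β) γ x =
      bracketAt hP hA hD hT α γ x + bracketAt hP hA hD hT β γ x := by
  let F : CoordinateFrame I x := Classical.choice (exists_coordinateFrame I x)
  exact congrArg (fun η : SmoothTwoForms I M => η.1 x)
    ((calculus hP hA hD hT).sumBracket_add_left F.coordFun (fun a => F.coeff a α)
      (fun a => F.coeff a β) γ)

theorem bracketAt_smul (φ : SmoothFunctions I M) (α β : SmoothOneForms I M) (x : M) :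
    bracketAt hP hA hD hT α (φ • β) x =
      φ.1 x • bracketAt hP hA hD hT α β x - (wedgeForm (connForm hD (differential φ) α) β).1 x := by
  let F : CoordinateFrame I x := Classical.choice (exists_coordinateFrame I x)
  have h := congrArg (fun η : SmoothTwoForms I M => η.1 x)
    ((calculus hP hA hD hT).sumBracket_smul F.coordFun (fun a => F.coeff a α) φ β)
  have h1 : ∑ a, F.coeff a α • (calculus hP hA hD hT).d (F.coordFun a) = F.cutoffFun • α :=
    (F.oneForm_decomp α).symm
  rw [h1] at h
  refine h.trans ?_
  refine congrArg (fun t => φ.1 x • bracketAt hP hA hD hT α β x - t) ?_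
  exact wedgeForm_congr (connForm_cancel hP hD F.cutoff_eventuallyEq _ _) rfl

theorem bracketAt_smul_left (φ : SmoothFunctions I M) (α β : SmoothOneForms I M) (x : M) :
    bracketAt hP hA hD hT (φ • α) β x =
      φ.1 x • bracketAt hP hA hD hT α β x - (wedgeForm (connForm hD (differential φ) β) α).1 x := by
  let F : CoordinateFrame I x := Classical.choice (exists_coordinateFrame I x)
  have h := congrArg (fun η : SmoothTwoForms I M => η.1 x)
    ((calculus hP hA hD hT).sumBracket_smul_left F.coordFun (fun a => F.coeff a α) φ β)
  have h1 : ∑ a, F.coeff a α • (calculus hP hA hD hT).d (F.coordFun a) = F.cutoffFun • α :=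
    (F.oneForm_decomp α).symm
  rw [h1] at h
  refine h.trans ?_
  refine congrArg (fun t => φ.1 x • bracketAt hP hA hD hT α β x - t) ?_
  refine wedgeForm_congr rfl ?_
  have h2 : F.cutoffFun.1 x = 1 := F.cutoff_self
  rw [smoothOneForms_smul_apply, h2, one_smul]

theorem bracketAt_differential (φ : SmoothFunctions I M) (β : SmoothOneForms I M) (x : M) :
    bracketAt hP hA hD hT (differential φ) β x =
      ((calculus hP hA hD hT).exactBracket φ β).1 x := by
  let F : CoordinateFrame I x := Classical.choice (exists_coordinateFrame I x)
  let C := calculus hP hA hD hT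
  have hχ : ∀ᶠ y in 𝓝 x, F.cutoffFun.1 y = 1 := F.cutoff_eventuallyEq
  have hχ1 : F.cutoffFun.1 x = 1 := F.cutoff_self
  have h1 : ∑ a, F.coeff a (differential φ) • C.d (F.coordFun a) = F.cutoffFun • differential φ :=
    (F.oneForm_decomp _).symm
  have h := congrArg (fun η : SmoothTwoForms I M => η.1 x)
    (C.sumBracket_eq F.coordFun (fun a => F.coeff a (differential φ)) β)
  rw [h1] at h
  refine h.trans ?_
  have h3 : (∑ a, (C.wedge (C.d (F.coeff a (differential φ))) (C.D (C.d (F.coordFun a)) β) +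
      C.wedge (C.D (C.d (F.coeff a (differential φ))) β) (C.d (F.coordFun a)))).1 x = 0 := by
    have hclosed : (∑ a, C.wedge (C.d (F.coeff a (differential φ))) (C.d (F.coordFun a))).1 x
        = 0 := by
      have h4 := congrArg C.dd h1
      rw [C.dd_sum] at h4
      have h5 : (∑ a, C.wedge (C.d (F.coeff a (differential φ))) (C.d (F.coordFun a))) =
          C.dd (F.cutoffFun • differential φ) := by
        rw [← h4]
        refine Finset.sum_congr rfl fun a _ => ?_
        rw [C.dd_smul, C.dd_d, smul_zero, add_zero]
      rw [h5]
      refine (exteriorDeriv_cancel hχ _).trans ?_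
      rw [exteriorDeriv_differential]
      rfl
    have htr : ∀ u : TangentSpace I x, ∃ u' : TangentSpace I x, ∀ γ : SmoothOneForms I M,
        (C.D γ β).1 x u = γ.1 x u' := fun u =>
      exists_vector_of_tensorial x (fun γ => (C.D γ β).1 x u)
        (fun γ γ' => by rw [C.D_add_left]; rfl) (fun ψ γ => by rw [C.D_smul_left]; rfl)
    ext u v
    obtain ⟨u', hu⟩ := htr u
    obtain ⟨v', hv⟩ := htr v
    have e1 := congrArg (fun B : TangentSpace I x →L[ℝ] TangentSpace I x →L[ℝ] ℝ => B u v') hclosed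
    have e2 := congrArg (fun B : TangentSpace I x →L[ℝ] TangentSpace I x →L[ℝ] ℝ => B u' v) hclosed
    rw [smoothTwoForms_sum_apply] at e1 e2 ⊢
    simp only [sum_apply] at e1 e2 ⊢
    have e3 := congrArg₂ (· + ·) e1 e2
    simp only [← Finset.sum_add_distrib] at e3
    refine Eq.trans (Finset.sum_congr rfl fun a _ => ?_) (e3.trans (add_zero _))
    rw [smoothTwoForms_add_apply, add_apply, add_apply]
    have w : ∀ (α β : SmoothOneForms I M) (u v : TangentSpace I x),
      (C.wedge α β).1 x u v = α.1 x u * β.1 x v - β.1 x u * α.1 x v := fun α β u v => wedgeForm_apply α β x u v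
    simp only [w, hu, hv]
    ring
  have h6 : (C.dd (C.D (F.cutoffFun • differential φ) β)).1 x =
      (C.dd (C.D (differential φ) β)).1 x := by
    rw [C.D_smul_left]
    exact exteriorDeriv_cancel hχ _
  have h7 : (C.DD (F.cutoffFun • differential φ) (C.dd β)).1 x =
      (C.DD (differential φ) (C.dd β)).1 x := by
    rw [C.DD_smul_left, smoothTwoForms_smul_apply, hχ1, one_smul]
  change (C.dd (C.D (F.cutoffFun • differential φ) β)).1 x -
    (C.DD (F.cutoffFun • differential φ) (C.dd β)).1 x - _ = _
  rw [h3, h6, h7, sub_zero]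
  rfl

theorem bracketAt_symm (α β : SmoothOneForms I M) (x : M) :
    bracketAt hP hA hD hT α β x = bracketAt hP hA hD hT β α x := by
  rw [← sub_eq_zero]
  refine eq_zero_of_tensorial_of_swap x (T := fun α β =>
    bracketAt hP hA hD hT α β x - bracketAt hP hA hD hT β α x) (fun α α' β => ?_)
    (fun φ α β => ?_) (fun α β => (neg_sub _ _).symm) (fun φ ψ => ?_) α β
  · rw [bracketAt_add, bracketAt_add_left]; abel
  · rw [bracketAt_smul, bracketAt_smul_left]; module
  · rw [bracketAt_differential, bracketAt_differential, sub_eq_zero]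
    exact congrArg (fun η : SmoothTwoForms I M => η.1 x)
      ((calculus hP hA hD hT).exactBracket_symm φ ψ)

theorem smoothTwoForm_bracketAt (α β : SmoothOneForms I M) :
    SmoothTwoForm (bracketAt hP hA hD hT α β) := by
  refine ⟨smoothCovTwoTensor_of_eventuallyEq fun x₀ => ?_, fun x u => by
    unfold bracketAt
    exact ((calculus hP hA hD hT).sumBracket _ _ β : SmoothTwoForms I M).2.2 x u⟩
  refine oneForm_induction x₀ (p := fun α => ∃ θ : CovTwoTensor I M,
    SmoothCovTwoTensor θ ∧ ∀ᶠ y in 𝓝 x₀, bracketAt hP hA hD hT α β y = θ y) ?_ ?_ ?_ ?_ α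
  · exact fun φ => ⟨_, ((calculus hP hA hD hT).exactBracket φ β).2.1,
      Filter.Eventually.of_forall fun y => bracketAt_differential hP hA hD hT φ β y⟩
  · rintro α α' ⟨θ, hθ, h⟩ ⟨θ', hθ', h'⟩
    refine ⟨θ + θ', hθ.add hθ', ?_⟩
    filter_upwards [h, h'] with y hy hy'
    rw [bracketAt_add_left, hy, hy']
    rfl
  · rintro φ α ⟨θ, hθ, h⟩
    refine ⟨(fun x => φ.1 x • θ x) +
      (-wedgeForm (connForm hD (differential φ) β) α : SmoothTwoForms I M).1,
      (hθ.smul φ.2).add (-wedgeForm (connForm hD (differential φ) β) α : SmoothTwoForms I M).2.1, ?_⟩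
    filter_upwards [h] with y hy
    rw [bracketAt_smul_left, hy, sub_eq_add_neg]
    rfl
  · rintro χ α hχ ⟨θ, hθ, h⟩
    refine ⟨θ, hθ, ?_⟩
    filter_upwards [h, eventually_eventually_nhds.2 hχ] with y hy hy'
    rw [← hy, bracketAt_smul_left, hy'.self_of_nhds, one_smul]
    have h0 : (connForm hD (differential χ) β).1 y = 0 := by
      have := eq_of_tensorial y (L := fun γ => (connForm hD γ β).1 y)
        (fun γ γ' => by rw [connForm_add_left]; rfl) (fun ψ γ => by rw [connForm_smul_left]; rfl)
        (α := differential χ) (β := 0) (differential_apply_of_eventuallyEq_one hy')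
      refine this.trans ?_
      have h1 := connForm_smul_left hD 0 0 β
      rw [zero_smul, zero_smul] at h1
      rw [h1]
      rfl
    have h2 : (wedgeForm (connForm hD (differential χ) β) α).1 y = 0 := by
      ext u v
      rw [wedgeForm_apply, h0]
      simp
    rw [h2, sub_zero]

include hP hA hD hT in
/-- A torsion-free contravariant connection has a generalized pre-Poisson bracket. -/
theorem exists_isOneFormBracket :
    ∃ B : OneForm I M → OneForm I M → CovTwoTensor I M, IsOneFormBracket P D B := by
  classical
  let B : OneForm I M → OneForm I M → CovTwoTensor I M := fun α β =>
    if h : SmoothOneForm α ∧ SmoothOneForm β then bracketAt hP hA hD hT ⟨α, h.1⟩ ⟨β, h.2⟩ else 0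
  have hB : ∀ α β (hα : SmoothOneForm α) (hβ : SmoothOneForm β),
      B α β = bracketAt hP hA hD hT ⟨α, hα⟩ ⟨β, hβ⟩ := fun α β hα hβ => dif_pos ⟨hα, hβ⟩
  refine ⟨B, ?_, ?_, ?_, ?_, ?_⟩
  · intro α β hα hβ
    rw [hB α β hα hβ]
    exact smoothTwoForm_bracketAt hP hA hD hT _ _
  · intro α β β' hα hβ hβ'
    rw [hB _ _ hα hβ, hB _ _ hα hβ', hB _ _ hα (hβ.add hβ')]
    exact funext fun x => bracketAt_add hP hA hD hT ⟨α, hα⟩ ⟨β, hβ⟩ ⟨β', hβ'⟩ x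
  · intro α β hα hβ
    rw [hB _ _ hα hβ, hB _ _ hβ hα]
    exact funext fun x => bracketAt_symm hP hA hD hT _ _ x
  · intro φ β hφ hβ
    rw [hB _ _ hφ.dFun hβ]
    funext x
    refine Eq.trans ?_ (congrArg (· + _)
      (bracketAt_differential hP hA hD hT ⟨φ, hφ⟩ ⟨β, hβ⟩ x).symm)
    exact (sub_add_cancel _ _).symm
  · intro φ α β hφ hα hβ
    rw [hB _ _ hα (SmoothOneForm.smul hφ hβ), hB _ _ hα hβ]
    funext x
    refine (bracketAt_smul hP hA hD hT ⟨φ, hφ⟩ ⟨α, hα⟩ ⟨β, hβ⟩ x).trans ?_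
    ext u v
    change φ x * _ - (D (dFun φ) α x u * β x v - β x u * D (dFun φ) α x v) =
      (-(D (dFun φ) α x u) * β x v - β x u * -(D (dFun φ) α x v)) + φ x * _
    ring

end BracketExistence

/-! ### The Levi-Civita contravariant connection -/

section LeviCivita

variable {E : Type*} [NormedAddCommGroup E] [NormedSpace ℝ E] [FiniteDimensional ℝ E]
  {H : Type*} [TopologicalSpace H] {I : ModelWithCorners ℝ E H}
  {M : Type*} [TopologicalSpace M] [ChartedSpace H M] [IsManifold I ∞ M] [I.Boundaryless]
  [T2Space M]

/-- Evaluation of smooth functions at a point. -/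
def evalAt (x : M) : SmoothFunctions I M →+* ℝ where
  toFun φ := φ.1 x
  map_one' := rfl
  map_mul' _ _ := rfl
  map_zero' := rfl
  map_add' _ _ := rfl

/-- The solution of a linear system with smooth coefficients is smooth where the determinant does
not vanish. -/
theorem contMDiffAt_of_linear_system {n : Type*} [Fintype n] [DecidableEq n]
    (G : Matrix n n (SmoothFunctions I M)) (r : n → SmoothFunctions I M) (s : n → M → ℝ) {x₀ : M}
    (hdet : (G.map (evalAt x₀)).det ≠ 0)
    (h : ∀ x a, ∑ b, (G a b).1 x * s b x = (r a).1 x) (b : n) :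
    ContMDiffAt I 𝓘(ℝ, ℝ) ∞ (s b) x₀ := by
  have hd : ∀ x, (G.map (evalAt x)).det = G.det.1 x := fun x => (RingHom.map_det (evalAt x) G).symm
  have hs : ∀ x, G.det.1 x * s b x = (G.adjugate.mulVec r b).1 x := fun x => by
    have h1 : (G.map (evalAt x)).mulVec (fun b => s b x) = fun a => (r a).1 x := funext (h x)
    have h2 := congrArg (fun v => (G.map (evalAt x)).adjugate.mulVec v b) h1
    simp only [Matrix.mulVec_mulVec, Matrix.adjugate_mul, Matrix.smul_mulVec, Matrix.one_mulVec,
      Pi.smul_apply, smul_eq_mul, hd] at h2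
    rw [h2]
    have h3 := RingHom.map_adjugate (evalAt x) G
    have h4 : (G.adjugate.mulVec r b).1 x = ((evalAt x).mapMatrix G.adjugate).mulVec
        (fun a => (r a).1 x) b := by
      change evalAt x (∑ a, G.adjugate b a * r a) = _
      rw [map_sum]
      simp only [map_mul]
      rfl
    rw [h4, h3]
    rfl
  rw [hd] at hdet
  have h5 : ContMDiffAt I 𝓘(ℝ, ℝ) ∞ (fun x => (G.adjugate.mulVec r b).1 x / G.det.1 x) x₀ :=
    ((G.adjugate.mulVec r b).2 x₀).div₀ (G.det.2 x₀) hdet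
  refine h5.congr_of_eventuallyEq ?_
  have h6 : ContinuousAt G.det.1 x₀ := (G.det.2 x₀).continuousAt
  filter_upwards [h6.eventually_ne hdet] with x hx
  rw [← hs, mul_div_cancel_left₀ _ hx]

/-- A contravariant `2`-tensor field which is a smooth symmetric nondegenerate bilinear form on
covectors. -/
structure IsContravariantMetric (g : ContraTwoTensor I M) : Prop where
  smooth : IsSmoothPairing g
  symm : ∀ (x : M) (a b : TangentSpace I x →L[ℝ] ℝ), g x a b = g x b a
  nondegenerate : ∀ (x : M) (a : TangentSpace I x →L[ℝ] ℝ), (∀ b, g x a b = 0) → a = 0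

namespace IsContravariantMetric

variable {g : ContraTwoTensor I M} (hg : IsContravariantMetric g)
include hg

theorem pairingFun_comm (α β : SmoothOneForms I M) :
    pairingFun hg.smooth α β = pairingFun hg.smooth β α :=
  smoothFunctions_ext fun x => hg.symm x _ _

theorem ext_of_pairing {α β : SmoothOneForms I M}
    (h : ∀ γ, pairingFun hg.smooth α γ = pairingFun hg.smooth β γ) : α = β := by
  refine smoothOneForms_ext fun x => sub_eq_zero.1 (hg.nondegenerate x _ fun c => ?_)
  obtain ⟨φ, rfl⟩ := exists_differential_eq x c
  rw [map_sub, sub_apply, sub_eq_zero]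
  exact congrFun (congrArg Subtype.val (h (differential φ))) x

theorem exists_covector (x : M) (v : TangentSpace I x) :
    ∃ c : TangentSpace I x →L[ℝ] ℝ, ∀ b, g x c b = b v := by
  have e : (TangentSpace I x →L[ℝ] ℝ) ≃ₗ[ℝ] Module.Dual ℝ (TangentSpace I x) :=
    LinearMap.toContinuousLinearMap.symm
  have : FiniteDimensional ℝ (TangentSpace I x →L[ℝ] ℝ) :=
    Module.Finite.equiv e.symm
  let G : (TangentSpace I x →L[ℝ] ℝ) →ₗ[ℝ] Module.Dual ℝ (TangentSpace I x →L[ℝ] ℝ) :=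
    { toFun := fun a => (g x a).toLinearMap
      map_add' := fun a b => by rw [map_add]; rfl
      map_smul' := fun r a => by rw [map_smul]; rfl }
  have hinj : Function.Injective G := (injective_iff_map_eq_zero G).2 fun a ha =>
    hg.nondegenerate x a fun b => LinearMap.congr_fun ha b
  have hsurj : Function.Surjective G :=
    (LinearMap.injective_iff_surjective_of_finrank_eq_finrank
      (Subspace.dual_finrank_eq (K := ℝ) (V := TangentSpace I x →L[ℝ] ℝ)).symm).1 hinj
  obtain ⟨c, hc⟩ := hsurj
    { toFun := fun b => b v, map_add' := fun _ _ => rfl, map_smul' := fun _ _ => rfl }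
  exact ⟨c, fun b => LinearMap.congr_fun hc b⟩

theorem smoothOneForm_of_pairing {θ : OneForm I M}
    (h : ∀ γ : SmoothOneForms I M, SmoothFun I (pairing g θ γ.1)) : SmoothOneForm θ := by
  refine smoothOneForm_of_apply fun X hX x₀ => ?_
  obtain ⟨F⟩ := exists_coordinateFrame I x₀
  let s : Fin (Module.finrank ℝ E) → M → ℝ := fun b x => θ x (F.field b x)
  let G : Matrix (Fin (Module.finrank ℝ E)) (Fin (Module.finrank ℝ E)) (SmoothFunctions I M) :=
    fun a b => pairingFun hg.smooth (differential (F.coordFun a)) (differential (F.coordFun b))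
  have hs : ∀ b, ContMDiffAt I 𝓘(ℝ, ℝ) ∞ (s b) x₀ := by
    refine contMDiffAt_of_linear_system G
      (fun a => F.cutoffFun * ⟨_, h (differential (F.coordFun a))⟩) s ?_ fun x a => ?_
    · intro h0
      obtain ⟨v, hv, hGv⟩ := Matrix.exists_mulVec_eq_zero_iff.2 h0
      apply hv
      have hw : ∑ b, v b • dFun (I := I) (F.coord b) x₀ = 0 := by
        refine hg.nondegenerate x₀ _ fun c => ?_
        have hc := F.covector_decomp x₀ c
        rw [F.cutoff_self, one_smul] at hc
        rw [hc, map_sum]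
        refine Finset.sum_eq_zero fun a _ => ?_
        rw [map_smul, hg.symm, map_sum]
        have h1 := congrFun hGv a
        have h2 : ∑ b, g x₀ (dFun (F.coord a) x₀) (v b • dFun (F.coord b) x₀) = 0 := by
          refine Eq.trans (Finset.sum_congr rfl fun b _ => ?_) h1
          rw [map_smul]
          exact mul_comm _ _
        rw [h2, smul_zero]
      funext b
      have h3 := congrArg (fun c : TangentSpace I x₀ →L[ℝ] ℝ => c (F.field b x₀)) hw
      simp only [sum_apply, smul_apply, F.dual, F.cutoff_self, smul_eq_mul, mul_ite, mul_one,
        mul_zero, Finset.sum_ite_eq', Finset.mem_univ, if_true] at h3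
      exact h3
    · have h1 := congrArg (g x (dFun (F.coord a) x)) (F.covector_decomp x (θ x))
      rw [map_smul, map_sum] at h1
      change _ = F.cutoff x * g x (θ x) (dFun (F.coord a) x)
      rw [hg.symm x (θ x)]
      refine Eq.trans (Finset.sum_congr rfl fun b _ => ?_) h1.symm
      rw [map_smul]
      exact mul_comm _ _
  have h4 : ∀ b, ContMDiffAt I 𝓘(ℝ, ℝ) ∞ (fun x => dFun (F.coord b) x (X x)) x₀ := fun b =>
    SmoothOneForm.apply (F.smooth_coord b).dFun hX x₀
  have h5 : ContMDiffAt I 𝓘(ℝ, ℝ) ∞ (fun x => ∑ b, s b x * dFun (F.coord b) x (X x)) x₀ :=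
    ContMDiffAt.sum fun b _ => (hs b).mul (h4 b)
  refine h5.congr_of_eventuallyEq ?_
  filter_upwards [F.cutoff_eventuallyEq] with x hx
  have h6 := F.covector_decomp x (θ x)
  rw [hx, one_smul] at h6
  have h7 := congrArg (fun c : TangentSpace I x →L[ℝ] ℝ => c (X x)) h6
  simp only [sum_apply, smul_apply] at h7
  exact h7

end IsContravariantMetric

variable {P : ContraTwoTensor I M} (hP : IsSmoothPairing P) (hA : IsAlternatingField P)

theorem pairingFun_neg_left {Q : ContraTwoTensor I M} (hQ : IsSmoothPairing Q)
    (α β : SmoothOneForms I M) : pairingFun hQ (-α) β = -pairingFun hQ α β :=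
  map_neg (AddMonoidHom.mk' (pairingFun hQ · β) fun _ _ => pairingFun_add_left hQ _ _ _) α

theorem pairingFun_sub_left {Q : ContraTwoTensor I M} (hQ : IsSmoothPairing Q)
    (α α' β : SmoothOneForms I M) :
    pairingFun hQ (α - α') β = pairingFun hQ α β - pairingFun hQ α' β :=
  map_sub (AddMonoidHom.mk' (pairingFun hQ · β) fun _ _ => pairingFun_add_left hQ _ _ _) α α'

theorem koszulForm_add_left (α β γ : SmoothOneForms I M) :
    koszulForm hP hA (α + β) γ = koszulForm hP hA α γ + koszulForm hP hA β γ := by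
  rw [koszulForm_swap, koszulForm_add_right, koszulForm_swap hP hA α, koszulForm_swap hP hA β]
  abel

theorem koszulForm_smul_left (φ : SmoothFunctions I M) (α β : SmoothOneForms I M) :
    koszulForm hP hA (φ • α) β = φ • koszulForm hP hA α β - anchorFun hP β φ • α := by
  rw [koszulForm_swap, koszulForm_smul_right, koszulForm_swap hP hA α]
  module

variable {g : ContraTwoTensor I M} (hg : IsContravariantMetric g)

/-- The right-hand side of the contravariant Koszul formula for `2 g(D_α β, γ)`. -/
def koszulTerm (α β γ : SmoothOneForms I M) : SmoothFunctions I M :=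
  anchorFun hP α (pairingFun hg.smooth β γ) + anchorFun hP β (pairingFun hg.smooth α γ)
    - anchorFun hP γ (pairingFun hg.smooth α β) + pairingFun hg.smooth (koszulForm hP hA α β) γ
    + pairingFun hg.smooth (koszulForm hP hA γ α) β + pairingFun hg.smooth (koszulForm hP hA γ β) α

theorem koszulTerm_add (α β γ γ' : SmoothOneForms I M) :
    koszulTerm hP hA hg α β (γ + γ') = koszulTerm hP hA hg α β γ + koszulTerm hP hA hg α β γ' := by
  simp only [koszulTerm, pairingFun_add_right, pairingFun_add_left, anchorFun_add,
    anchorFun_add_left, koszulForm_add_left]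
  ring

theorem koszulTerm_smul (φ : SmoothFunctions I M) (α β γ : SmoothOneForms I M) :
    koszulTerm hP hA hg α β (φ • γ) = φ * koszulTerm hP hA hg α β γ := by
  simp only [koszulTerm, pairingFun_smul_right, pairingFun_smul_left, anchorFun_mul,
    anchorFun_smul_left, koszulForm_smul_left, pairingFun_sub_left]
  rw [hg.pairingFun_comm γ β, hg.pairingFun_comm γ α]
  ring

theorem koszulTerm_add_left (α α' β γ : SmoothOneForms I M) :
    koszulTerm hP hA hg (α + α') β γ = koszulTerm hP hA hg α β γ + koszulTerm hP hA hg α' β γ := by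
  simp only [koszulTerm, pairingFun_add_right, pairingFun_add_left, anchorFun_add,
    anchorFun_add_left, koszulForm_add_left, koszulForm_add_right]
  ring

theorem koszulTerm_smul_left (φ : SmoothFunctions I M) (α β γ : SmoothOneForms I M) :
    koszulTerm hP hA hg (φ • α) β γ = φ * koszulTerm hP hA hg α β γ := by
  simp only [koszulTerm, pairingFun_smul_right, pairingFun_smul_left, anchorFun_mul,
    anchorFun_smul_left, koszulForm_smul_left, koszulForm_smul_right, pairingFun_sub_left,
    pairingFun_add_left]
  ring

theorem koszulTerm_add_middle (α β β' γ : SmoothOneForms I M) :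
    koszulTerm hP hA hg α (β + β') γ = koszulTerm hP hA hg α β γ + koszulTerm hP hA hg α β' γ := by
  simp only [koszulTerm, pairingFun_add_right, pairingFun_add_left, anchorFun_add,
    anchorFun_add_left, koszulForm_add_right]
  ring

theorem koszulTerm_smul_middle (φ : SmoothFunctions I M) (α β γ : SmoothOneForms I M) :
    koszulTerm hP hA hg α (φ • β) γ =
      φ * koszulTerm hP hA hg α β γ + 2 * (anchorFun hP α φ * pairingFun hg.smooth β γ) := by
  simp only [koszulTerm, pairingFun_smul_right, pairingFun_smul_left, anchorFun_mul,
    anchorFun_smul_left, koszulForm_smul_right,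
    pairingFun_add_left]
  rw [hg.pairingFun_comm β α]
  ring

theorem koszulTerm_parallel (α β γ : SmoothOneForms I M) :
    koszulTerm hP hA hg α β γ + koszulTerm hP hA hg α γ β =
      2 * anchorFun hP α (pairingFun hg.smooth β γ) := by
  simp only [koszulTerm]
  rw [hg.pairingFun_comm γ β, koszulForm_swap hP hA β α, koszulForm_swap hP hA γ α,
    koszulForm_swap hP hA γ β]
  simp only [pairingFun_neg_left]
  ring

theorem koszulTerm_torsionFree (α β γ : SmoothOneForms I M) :
    koszulTerm hP hA hg α β γ - koszulTerm hP hA hg β α γ =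
      2 * pairingFun hg.smooth (koszulForm hP hA α β) γ := by
  simp only [koszulTerm]
  rw [hg.pairingFun_comm β α, koszulForm_swap hP hA α β]
  simp only [pairingFun_neg_left]
  ring

theorem two_mul_cancel {φ ψ : SmoothFunctions I M} (h : 2 * φ = 2 * ψ) : φ = ψ :=
  smoothFunctions_ext fun x => by
    have h1 : (2 : ℝ) * φ.1 x = 2 * ψ.1 x := congrArg (evalAt x) h
    linarith

theorem exists_koszulTerm_eq (α β : SmoothOneForms I M) :
    ∃ δ : SmoothOneForms I M, ∀ γ, 2 * pairingFun hg.smooth δ γ = koszulTerm hP hA hg α β γ := by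
  have h1 : ∀ x, ∃ c : TangentSpace I x →L[ℝ] ℝ, ∀ γ : SmoothOneForms I M,
      g x c (γ.1 x) = (koszulTerm hP hA hg α β γ).1 x / 2 := fun x => by
    obtain ⟨v, hv⟩ := exists_vector_of_tensorial x
      (fun γ => (koszulTerm hP hA hg α β γ).1 x / 2)
      (fun γ γ' => by rw [koszulTerm_add, smoothFunctions_add_apply, add_div])
      (fun φ γ => by rw [koszulTerm_smul, smoothFunctions_mul_apply, mul_div_assoc])
    obtain ⟨c, hc⟩ := hg.exists_covector x v
    exact ⟨c, fun γ => by rw [hc, hv]⟩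
  choose δ hδ using h1
  have h2 : ∀ γ : SmoothOneForms I M, pairing g δ γ.1 = fun x =>
      (koszulTerm hP hA hg α β γ).1 x * 2⁻¹ := fun γ => funext fun x => hδ x γ
  have hs : SmoothOneForm δ := hg.smoothOneForm_of_pairing fun γ => by
    rw [h2]
    exact (koszulTerm hP hA hg α β γ).2.mul contMDiff_const
  refine ⟨⟨δ, hs⟩, fun γ => smoothFunctions_ext fun x => ?_⟩
  change (2 : ℝ) * g x (δ x) (γ.1 x) = _
  rw [hδ]
  ring

include hP hA hg in
/-- The Levi-Civita contravariant connection exists. -/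
theorem exists_isLeviCivita :
    ∃ D : OneForm I M → OneForm I M → OneForm I M, IsLeviCivita g P D := by
  classical
  choose L hL using exists_koszulTerm_eq hP hA hg
  let D : OneForm I M → OneForm I M → OneForm I M := fun α β =>
    if h : SmoothOneForm α ∧ SmoothOneForm β then (L ⟨α, h.1⟩ ⟨β, h.2⟩).1 else 0
  have hD : ∀ α β (hα : SmoothOneForm α) (hβ : SmoothOneForm β),
      D α β = (L ⟨α, hα⟩ ⟨β, hβ⟩).1 := fun α β hα hβ => dif_pos ⟨hα, hβ⟩
  have hext : ∀ {α β : SmoothOneForms I M}, (∀ γ, 2 * pairingFun hg.smooth α γ =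
      2 * pairingFun hg.smooth β γ) → α = β := fun h =>
    hg.ext_of_pairing fun γ => two_mul_cancel (h γ)
  have hadd_left : ∀ α α' β, L (α + α') β = L α β + L α' β := fun α α' β => hext fun γ => by
    rw [hL, koszulTerm_add_left, pairingFun_add_left, mul_add, hL, hL]
  have hadd : ∀ α β β', L α (β + β') = L α β + L α β' := fun α β β' => hext fun γ => by
    rw [hL, koszulTerm_add_middle, pairingFun_add_left, mul_add, hL, hL]
  have hsmul_left : ∀ (φ : SmoothFunctions I M) α β, L (φ • α) β = φ • L α β :=
    fun φ α β => hext fun γ => by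
      rw [hL, koszulTerm_smul_left, pairingFun_smul_left, mul_left_comm, hL]
  have hsmul : ∀ (φ : SmoothFunctions I M) α β, L α (φ • β) = φ • L α β + anchorFun hP α φ • β :=
    fun φ α β => hext fun γ => by
      rw [hL, koszulTerm_smul_middle, pairingFun_add_left, pairingFun_smul_left,
        pairingFun_smul_left, ← hL]
      ring
  have hpar : ∀ α β γ, anchorFun hP α (pairingFun hg.smooth β γ) =
      pairingFun hg.smooth (L α β) γ + pairingFun hg.smooth β (L α γ) := fun α β γ =>
    two_mul_cancel (by
      rw [← koszulTerm_parallel hP hA hg, mul_add, hg.pairingFun_comm β, hL, hL])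
  have htor : ∀ α β, L α β - L β α = koszulForm hP hA α β := fun α β => hext fun γ => by
    rw [← koszulTerm_torsionFree, pairingFun_sub_left, mul_sub, hL, hL]
  refine ⟨D, ⟨⟨?_, ?_, ?_, ?_, ?_⟩, ?_, ?_⟩⟩
  · intro α β hα hβ
    rw [hD α β hα hβ]
    exact (L _ _).2
  · intro α α' β hα hα' hβ
    rw [hD _ _ hα hβ, hD _ _ hα' hβ, hD _ _ (hα.add hα') hβ]
    exact congrArg Subtype.val (hadd_left ⟨α, hα⟩ ⟨α', hα'⟩ ⟨β, hβ⟩)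
  · intro α β β' hα hβ hβ'
    rw [hD _ _ hα hβ, hD _ _ hα hβ', hD _ _ hα (hβ.add hβ')]
    exact congrArg Subtype.val (hadd ⟨α, hα⟩ ⟨β, hβ⟩ ⟨β', hβ'⟩)
  · intro φ α β hφ hα hβ
    rw [hD _ _ hα hβ, hD _ _ (SmoothOneForm.smul hφ hα) hβ]
    exact congrArg Subtype.val (hsmul_left ⟨φ, hφ⟩ ⟨α, hα⟩ ⟨β, hβ⟩)
  · intro φ α β hφ hα hβ
    rw [hD _ _ hα hβ, hD _ _ hα (SmoothOneForm.smul hφ hβ)]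
    have h1 := anchorFun_val hP ⟨α, hα⟩ ⟨φ, hφ⟩
    change _ = anchorDeriv P α φ at h1
    rw [← h1]
    exact congrArg Subtype.val (hsmul ⟨φ, hφ⟩ ⟨α, hα⟩ ⟨β, hβ⟩)
  · intro α β γ hα hβ hγ x
    rw [hD _ _ hα hβ, hD _ _ hα hγ]
    have h1 := anchorFun_val hP ⟨α, hα⟩ (pairingFun hg.smooth ⟨β, hβ⟩ ⟨γ, hγ⟩)
    refine (congrFun h1 x).symm.trans ?_
    exact congrFun (congrArg Subtype.val (hpar ⟨α, hα⟩ ⟨β, hβ⟩ ⟨γ, hγ⟩)) x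
  · intro α β hα hβ
    rw [hD _ _ hα hβ, hD _ _ hβ hα]
    exact congrArg Subtype.val (htor ⟨α, hα⟩ ⟨β, hβ⟩)

/-- The contravariant Koszul formula. -/
theorem two_mul_pairingFun_connForm {D : OneForm I M → OneForm I M → OneForm I M}
    (hD : IsLeviCivita g P D) (α β γ : SmoothOneForms I M) :
    2 * pairingFun hg.smooth (connForm hD.toIsContravariantConnection α β) γ =
      koszulTerm hP hA hg α β γ := by
  have hpar : ∀ α β γ : SmoothOneForms I M, anchorFun hP α (pairingFun hg.smooth β γ) =
      pairingFun hg.smooth (connForm hD.toIsContravariantConnection α β) γ +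
        pairingFun hg.smooth (connForm hD.toIsContravariantConnection α γ) β :=
    fun α β γ => smoothFunctions_ext fun x => by
      rw [hg.pairingFun_comm _ β]
      exact (congrFun (anchorFun_val hP α (pairingFun hg.smooth β γ)) x).trans
        (hD.parallel α.1 β.1 γ.1 α.2 β.2 γ.2 x)
  have htor : ∀ α β : SmoothOneForms I M, koszulForm hP hA α β =
      connForm hD.toIsContravariantConnection α β - connForm hD.toIsContravariantConnection β α :=
    fun α β => Subtype.ext (hD.torsionFree α.1 β.1 α.2 β.2).symm
  simp only [koszulTerm, hpar, htor, pairingFun_sub_left]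
  ring

end LeviCivita

/-! ### Pullbacks of forms -/

section Pullback

variable {E : Type*} [NormedAddCommGroup E] [NormedSpace ℝ E] [FiniteDimensional ℝ E]
  {H : Type*} [TopologicalSpace H] {I : ModelWithCorners ℝ E H}
  {M : Type*} [TopologicalSpace M] [ChartedSpace H M] [IsManifold I ∞ M] [I.Boundaryless]
  [T2Space M]
  {F : Type*} [NormedAddCommGroup F] [NormedSpace ℝ F] [FiniteDimensional ℝ F]
  {K : Type*} [TopologicalSpace K] {J : ModelWithCorners ℝ F K}
  {N : Type*} [TopologicalSpace N] [ChartedSpace K N] [IsManifold J ∞ N] [J.Boundaryless]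
  [T2Space N]
  {q : N → M} (hq : ContMDiff J I ∞ q)

/-- The pullback of a smooth function. -/
def pullbackFun (φ : SmoothFunctions I M) : SmoothFunctions J N :=
  ⟨φ.1 ∘ q, ContMDiff.comp φ.2 hq⟩

theorem differential_pullbackFun_apply (φ : SmoothFunctions I M) (z : N) :
    (differential (pullbackFun hq φ)).1 z =
      ((differential φ).1 (q z)).comp (mfderiv J I q z) :=
  mfderiv_comp z (SmoothFun.mdifferentiableAt φ.2 _) ((hq z).mdifferentiableAt (by simp))

include hq in
theorem smoothOneForm_pullback (α : SmoothOneForms I M) :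
    SmoothOneForm (fun z => (α.1 (q z)).comp (mfderiv J I q z) : OneForm J N) := by
  refine smoothOneForm_of_eventuallyEq fun z₀ => ?_
  refine oneForm_induction (q z₀) (p := fun α => ∃ β : OneForm J N, SmoothOneForm β ∧
    ∀ᶠ z in 𝓝 z₀, (α.1 (q z)).comp (mfderiv J I q z) = β z) ?_ ?_ ?_ ?_ α
  · exact fun φ => ⟨_, (differential (pullbackFun hq φ)).2, Filter.Eventually.of_forall fun z =>
      (differential_pullbackFun_apply hq φ z).symm⟩
  · rintro α α' ⟨β, hβ, h⟩ ⟨β', hβ', h'⟩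
    refine ⟨β + β', hβ.add hβ', ?_⟩
    filter_upwards [h, h'] with z hz hz'
    exact (ContinuousLinearMap.add_comp _ _ _).trans (congrArg₂ _ hz hz')
  · rintro φ α ⟨β, hβ, h⟩
    refine ⟨_, SmoothOneForm.smul (pullbackFun hq φ).2 hβ, ?_⟩
    filter_upwards [h] with z hz
    exact (ContinuousLinearMap.smul_comp _ _ _).trans (congrArg (φ.1 (q z) • ·) hz)
  · rintro χ α hχ ⟨β, hβ, h⟩
    refine ⟨β, hβ, ?_⟩
    filter_upwards [h, hq.continuous.continuousAt.eventually hχ] with z hz hz'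
    rw [← hz, smoothOneForms_smul_apply, hz', one_smul]

/-- The pullback of a smooth `1`-form. -/
def pullbackOne (α : SmoothOneForms I M) : SmoothOneForms J N :=
  ⟨fun z => (α.1 (q z)).comp (mfderiv J I q z), smoothOneForm_pullback hq α⟩

theorem pullbackOne_apply (α : SmoothOneForms I M) (z : N) :
    (pullbackOne hq α).1 z = (α.1 (q z)).comp (mfderiv J I q z) := rfl

theorem pullbackOne_differential (φ : SmoothFunctions I M) :
    pullbackOne hq (differential φ) = differential (pullbackFun hq φ) :=
  smoothOneForms_ext fun z => (differential_pullbackFun_apply hq φ z).symm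

theorem pullbackOne_add (α β : SmoothOneForms I M) :
    pullbackOne hq (α + β) = pullbackOne hq α + pullbackOne hq β :=
  smoothOneForms_ext fun _ => ContinuousLinearMap.add_comp _ _ _

theorem pullbackOne_smul (φ : SmoothFunctions I M) (α : SmoothOneForms I M) :
    pullbackOne hq (φ • α) = pullbackFun hq φ • pullbackOne hq α :=
  smoothOneForms_ext fun _ => ContinuousLinearMap.smul_comp _ _ _

/-- The pullback of a bilinear form along a linear map. -/
def pullbackForm {V V' : Type*} [NormedAddCommGroup V] [NormedSpace ℝ V] [NormedAddCommGroup V']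
    [NormedSpace ℝ V'] (T : V →L[ℝ] V') : (V' →L[ℝ] V' →L[ℝ] ℝ) →ₗ[ℝ] (V →L[ℝ] V →L[ℝ] ℝ) where
  toFun η := ((ContinuousLinearMap.precomp ℝ T).comp η).comp T
  map_add' _ _ := rfl
  map_smul' _ _ := rfl

include hq in
theorem smoothTwoForm_pullback (η : SmoothTwoForms I M) :
    SmoothTwoForm (I := J) (M := N)
      (fun z => pullbackForm (V := F) (V' := E) (mfderiv J I q z) (η.1 (q z))) := by
  refine ⟨smoothCovTwoTensor_of_eventuallyEq fun z₀ => ?_, fun z u => η.2.2 _ _⟩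
  refine twoForm_induction (q z₀) (p := fun η => ∃ β : CovTwoTensor J N, SmoothCovTwoTensor β ∧
    ∀ᶠ z in 𝓝 z₀, pullbackForm (V := F) (V' := E) (mfderiv J I q z) (η.1 (q z)) = β z)
    ?_ ?_ ?_ ?_ η
  · exact fun φ ψ => ⟨_, (wedgeForm (pullbackOne hq (differential φ))
      (pullbackOne hq (differential ψ))).2.1, Filter.Eventually.of_forall fun z => rfl⟩
  · rintro α α' ⟨β, hβ, h⟩ ⟨β', hβ', h'⟩
    refine ⟨β + β', hβ.add hβ', ?_⟩
    filter_upwards [h, h'] with z hz hz'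
    exact ((pullbackForm (V := F) (V' := E) (mfderiv J I q z)).map_add _ _).trans
      (congrArg₂ _ hz hz')
  · rintro φ α ⟨β, hβ, h⟩
    refine ⟨_, SmoothCovTwoTensor.smul (pullbackFun hq φ).2 hβ, ?_⟩
    filter_upwards [h] with z hz
    exact ((pullbackForm (V := F) (V' := E) (mfderiv J I q z)).map_smul _ _).trans
      (congrArg (φ.1 (q z) • ·) hz)
  · rintro χ α hχ ⟨β, hβ, h⟩
    refine ⟨β, hβ, ?_⟩
    filter_upwards [h, hq.continuous.continuousAt.eventually hχ] with z hz hz'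
    rw [← hz, smoothTwoForms_smul_apply, hz', one_smul]

/-- The pullback of a smooth `2`-form. -/
def pullbackTwo (η : SmoothTwoForms I M) : SmoothTwoForms J N :=
  ⟨fun z => pullbackForm (V := F) (V' := E) (mfderiv J I q z) (η.1 (q z)),
    smoothTwoForm_pullback hq η⟩

theorem pullbackTwo_add (η θ : SmoothTwoForms I M) :
    pullbackTwo hq (η + θ) = pullbackTwo hq η + pullbackTwo hq θ := rfl

theorem pullbackTwo_smul (φ : SmoothFunctions I M) (η : SmoothTwoForms I M) :
    pullbackTwo hq (φ • η) = pullbackFun hq φ • pullbackTwo hq η := rfl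

theorem pullbackTwo_wedge (α β : SmoothOneForms I M) :
    pullbackTwo hq (wedgeForm α β) = wedgeForm (pullbackOne hq α) (pullbackOne hq β) := rfl

theorem pullbackTwo_zero : pullbackTwo hq 0 = 0 := rfl

theorem exteriorDeriv_pullbackOne (α : SmoothOneForms I M) :
    exteriorDeriv (pullbackOne hq α) = pullbackTwo hq (exteriorDeriv α) := by
  refine smoothTwoForms_ext fun z => ?_
  refine oneForm_induction (q z) (p := fun α => (exteriorDeriv (pullbackOne hq α)).1 z =
    (pullbackTwo hq (exteriorDeriv α)).1 z) ?_ ?_ ?_ ?_ α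
  · intro φ
    rw [pullbackOne_differential, exteriorDeriv_differential, exteriorDeriv_differential,
      pullbackTwo_zero]
  · intro α β h h'
    rw [pullbackOne_add, exteriorDeriv_add, exteriorDeriv_add, pullbackTwo_add,
      smoothTwoForms_add_apply, smoothTwoForms_add_apply, h, h']
  · intro φ α h
    rw [pullbackOne_smul, exteriorDeriv_smul, exteriorDeriv_smul, pullbackTwo_add,
      pullbackTwo_smul, pullbackTwo_wedge, pullbackOne_differential, smoothTwoForms_add_apply,
      smoothTwoForms_add_apply, smoothTwoForms_smul_apply, smoothTwoForms_smul_apply, h]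
  · intro χ α hχ h
    have hχ' : ∀ᶠ y in 𝓝 z, (pullbackFun hq χ).1 y = 1 :=
      hq.continuous.continuousAt.eventually hχ
    rw [pullbackOne_smul, exteriorDeriv_cancel hχ'] at h
    rw [h]
    exact congrArg (pullbackForm (V := F) (V' := E) (mfderiv J I q z)) (exteriorDeriv_cancel hχ α)

end Pullback

/-! ### Morphisms of contravariant calculi -/

namespace ContravariantCalculus

section Zero

variable {A V W : Type*} [CommRing A] [AddCommGroup V] [Module A V] [AddCommGroup W] [Module A W]
  (C : ContravariantCalculus A V W)

theorem D_zero_left (b : V) : C.D 0 b = 0 := by simpa using C.D_smul_left 0 0 b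

theorem anchor_zero_left (f : A) : C.anchor 0 f = 0 := by simpa using C.anchor_smul_left 0 0 f

theorem anchor_zero (a : V) : C.anchor a 0 = 0 := by simpa using C.anchor_add a 0 0

theorem dd_zero : C.dd 0 = 0 := by simpa using C.dd_sub 0 0

theorem IsBracket.d_eq {C : ContravariantCalculus A V W} {B : V → V → W} (hB : C.IsBracket B)
    (f : A) (b : V) : B (C.d f) b = C.dd (C.D (C.d f) b) - C.DD (C.d f) (C.dd b) :=
  eq_sub_of_add_eq (hB.dd_D f b).symm

theorem IsBracket.zero_right {C : ContravariantCalculus A V W} {B : V → V → W}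
    (hB : C.IsBracket B) (a : V) : B a 0 = 0 := by
  simpa using hB.sub a 0 0

end Zero

variable {A₁ V₁ W₁ : Type*} [CommRing A₁] [AddCommGroup V₁] [Module A₁ V₁] [AddCommGroup W₁]
  [Module A₁ W₁] {A₂ V₂ W₂ : Type*} [CommRing A₂] [AddCommGroup V₂] [Module A₂ V₂]
  [AddCommGroup W₂] [Module A₂ W₂] {A V W : Type*} [CommRing A] [AddCommGroup V] [Module A V]
  [AddCommGroup W] [Module A W]

/-- A morphism of the differential structures which is compatible with the contravariant
structures up to a constant factor. -/
structure Lift (C₁ : ContravariantCalculus A₁ V₁ W₁) (C : ContravariantCalculus A V W) where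
  mapA : A₁ → A
  mapV : V₁ → V
  mapW : W₁ → W
  factor : A
  mapA_sub : ∀ f h, mapA (f - h) = mapA f - mapA h
  mapV_sub : ∀ a b, mapV (a - b) = mapV a - mapV b
  mapW_sub : ∀ η θ, mapW (η - θ) = mapW η - mapW θ
  d_map : ∀ f, C.d (mapA f) = mapV (C₁.d f)
  dd_map : ∀ a, C.dd (mapV a) = mapW (C₁.dd a)
  d_factor : C.d factor = 0
  anchor_factor : ∀ a, C.anchor a factor = 0
  anchor_map : ∀ a f, C.anchor (mapV a) (mapA f) = factor * mapA (C₁.anchor a f)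
  D_map : ∀ a b, C.D (mapV a) (mapV b) = factor • mapV (C₁.D a b)
  DD_map : ∀ a η, C.DD (mapV a) (mapW η) = factor • mapW (C₁.DD a η)

namespace Lift

variable {C₁ : ContravariantCalculus A₁ V₁ W₁} {C₂ : ContravariantCalculus A₂ V₂ W₂}
  {C : ContravariantCalculus A V W} (L : Lift C₁ C)

theorem mapA_zero : L.mapA 0 = 0 := by simpa using L.mapA_sub 0 0

theorem mapV_zero : L.mapV 0 = 0 := by simpa using L.mapV_sub 0 0

theorem mapW_zero : L.mapW 0 = 0 := by simpa using L.mapW_sub 0 0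

theorem anchor_factor_mul (a : V) (f : A) :
    C.anchor a (L.factor * f) = L.factor * C.anchor a f := by
  rw [C.anchor_mul, L.anchor_factor, mul_zero, add_zero]

theorem D_factor_smul (a b : V) : C.D a (L.factor • b) = L.factor • C.D a b := by
  rw [C.D_smul, L.anchor_factor, zero_smul, add_zero]

theorem DD_factor_smul (a : V) (η : W) : C.DD a (L.factor • η) = L.factor • C.DD a η := by
  rw [C.DD_smul, L.anchor_factor, zero_smul, add_zero]

theorem dd_factor_smul (a : V) : C.dd (L.factor • a) = L.factor • C.dd a := by
  rw [C.dd_smul, L.d_factor, C.wedge_zero_left, zero_add]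

theorem bracket_map (a b : V₁) :
    C.bracket (L.mapV a) (L.mapV b) = L.factor • L.mapV (C₁.bracket a b) := by
  rw [bracket, bracket, L.D_map, L.D_map, L.mapV_sub, smul_sub]

theorem jacobiator_map (a b : V₁) (f : A₁) :
    C.jacobiator (L.mapV a) (L.mapV b) (L.mapA f) =
      L.factor * L.factor * L.mapA (C₁.jacobiator a b f) := by
  simp only [jacobiator, L.bracket_map, C.anchor_smul_left, L.anchor_map, L.anchor_factor_mul,
    L.mapA_sub]
  ring

theorem curv_map (a b c : V₁) :
    C.curv (L.mapV a) (L.mapV b) (L.mapV c) =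
      (L.factor * L.factor) • L.mapV (C₁.curv a b c) := by
  simp only [curv, L.bracket_map, C.D_smul_left, L.D_map, L.D_factor_smul, L.mapV_sub]
  module

section Bracket

variable {B : V → V → W} (hB : C.IsBracket B)
include hB

theorem bracket_factor_smul (a b : V) : B a (L.factor • b) = L.factor • B a b := by
  rw [hB.smul, L.d_factor, C.D_zero_left, C.wedge_zero_left, neg_zero, zero_add]

theorem bracket_d_map {B₁ : V₁ → V₁ → W₁} (hB₁ : C₁.IsBracket B₁) (f : A₁) (b : V₁) :
    B (L.mapV (C₁.d f)) (L.mapV b) = L.factor • L.mapW (B₁ (C₁.d f) b) := by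
  rw [← L.d_map, hB.d_eq, hB₁.d_eq, L.d_map, L.D_map, L.dd_factor_smul, L.dd_map, L.dd_map,
    L.DD_map, L.mapW_sub, smul_sub]

theorem metacurv_map {B₁ : V₁ → V₁ → W₁} (hB₁ : C₁.IsBracket B₁) (f h k : A₁) :
    C.metacurv B (L.mapA f) (L.mapV (C₁.d h)) (L.mapV (C₁.d k)) =
      (L.factor * L.factor) • L.mapW (C₁.metacurv B₁ f (C₁.d h) (C₁.d k)) := by
  simp only [metacurv, L.d_map, L.mapW_sub, L.D_map]
  rw [hB.symm (L.factor • _), hB.symm (L.factor • _), hB₁.symm (C₁.D _ _), hB₁.symm (C₁.D _ _)]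
  simp only [L.bracket_factor_smul hB, L.bracket_d_map hB hB₁, L.DD_factor_smul, L.DD_map]
  module

end Bracket

/-- Two lifts without interaction. -/
structure IsDisjoint (L₁ : Lift C₁ C) (L₂ : Lift C₂ C) : Prop where
  anchor_left : ∀ a f, C.anchor (L₁.mapV a) (L₂.mapA f) = 0
  anchor_right : ∀ a f, C.anchor (L₂.mapV a) (L₁.mapA f) = 0
  D_left : ∀ a b, C.D (L₁.mapV a) (L₂.mapV b) = 0
  D_right : ∀ a b, C.D (L₂.mapV a) (L₁.mapV b) = 0
  DD_left : ∀ a η, C.DD (L₁.mapV a) (L₂.mapW η) = 0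
  DD_right : ∀ a η, C.DD (L₂.mapV a) (L₁.mapW η) = 0

namespace IsDisjoint

variable {L₁ : Lift C₁ C} {L₂ : Lift C₂ C}

theorem symm (h : IsDisjoint L₁ L₂) : IsDisjoint L₂ L₁ :=
  ⟨h.anchor_right, h.anchor_left, h.D_right, h.D_left, h.DD_right, h.DD_left⟩

variable (h : IsDisjoint L₁ L₂)
include h

theorem bracket_eq_zero (a : V₁) (b : V₂) : C.bracket (L₁.mapV a) (L₂.mapV b) = 0 := by
  rw [bracket, h.D_left, h.D_right, sub_zero]

theorem jacobiator_snd (a b : V₁) (f : A₂) :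
    C.jacobiator (L₁.mapV a) (L₁.mapV b) (L₂.mapA f) = 0 := by
  simp only [jacobiator, h.anchor_left, C.anchor_zero, L₁.bracket_map, C.anchor_smul_left,
    mul_zero, sub_zero]

theorem jacobiator_mixed (a : V₁) (b : V₂) (f : A₁) :
    C.jacobiator (L₁.mapV a) (L₂.mapV b) (L₁.mapA f) = 0 := by
  simp only [jacobiator, h.anchor_right, L₁.anchor_map, L₁.anchor_factor_mul, C.anchor_zero,
    h.bracket_eq_zero, C.anchor_zero_left, mul_zero, sub_zero]

theorem jacobiator_mixed' (a : V₂) (b : V₁) (f : A₁) :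
    C.jacobiator (L₂.mapV a) (L₁.mapV b) (L₁.mapA f) = 0 := by
  rw [C.jacobiator_swap, h.jacobiator_mixed, neg_zero]

theorem curv_snd (a b : V₁) (c : V₂) : C.curv (L₁.mapV a) (L₁.mapV b) (L₂.mapV c) = 0 := by
  simp only [curv, h.D_left, C.D_zero, L₁.bracket_map, C.D_smul_left, smul_zero, sub_zero]

theorem curv_mixed (a : V₁) (b : V₂) (c : V₁) :
    C.curv (L₁.mapV a) (L₂.mapV b) (L₁.mapV c) = 0 := by
  simp only [curv, h.D_right, L₁.D_map, L₁.D_factor_smul, C.D_zero, h.bracket_eq_zero,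
    C.D_zero_left, smul_zero, sub_zero]

theorem curv_mixed' (a : V₂) (b : V₁) (c : V₁) :
    C.curv (L₂.mapV a) (L₁.mapV b) (L₁.mapV c) = 0 := by
  rw [C.curv_swap, h.curv_mixed, neg_zero]

variable {B : V → V → W} (hB : C.IsBracket B)
include hB

theorem bracket_d (f : A₁) (b : V₂) : B (L₁.mapV (C₁.d f)) (L₂.mapV b) = 0 := by
  rw [← L₁.d_map, hB.d_eq, L₁.d_map, h.D_left, L₂.dd_map, h.DD_left, C.dd_zero, sub_zero]

theorem metacurv_snd (f k : A₁) (l : A₂) :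
    C.metacurv B (L₁.mapA f) (L₁.mapV (C₁.d k)) (L₂.mapV (C₂.d l)) = 0 := by
  simp only [metacurv, L₁.d_map, h.bracket_d hB, C.DD_zero, L₁.D_map, h.D_left]
  rw [hB.symm _ (L₂.mapV _), L₁.bracket_factor_smul hB, h.symm.bracket_d hB, hB.symm 0,
    hB.zero_right, smul_zero, sub_zero, sub_zero]

theorem metacurv_mixed (f : A₁) (k : A₂) (l : A₁) :
    C.metacurv B (L₁.mapA f) (L₂.mapV (C₂.d k)) (L₁.mapV (C₁.d l)) = 0 := by
  rw [hB.metacurv_symm, h.metacurv_snd hB]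

theorem metacurv_fst {B₂ : V₂ → V₂ → W₂} (hB₂ : C₂.IsBracket B₂) (f : A₁) (k l : A₂) :
    C.metacurv B (L₁.mapA f) (L₂.mapV (C₂.d k)) (L₂.mapV (C₂.d l)) = 0 := by
  simp only [metacurv, L₁.d_map, L₂.bracket_d_map hB hB₂, L₂.DD_factor_smul, h.DD_left, h.D_left]
  rw [hB.symm 0, hB.symm 0, hB.zero_right, hB.zero_right, smul_zero, sub_zero, sub_zero]

end IsDisjoint

end Lift

end ContravariantCalculus

/-! ### Splittings -/

section Data

variable {E : Type*} [NormedAddCommGroup E] [NormedSpace ℝ E] [FiniteDimensional ℝ E]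
  {H : Type*} [TopologicalSpace H] (I : ModelWithCorners ℝ E H)
  (M : Type*) [TopologicalSpace M] [ChartedSpace H M] [IsManifold I ∞ M] [I.Boundaryless]
  [T2Space M]

/-- A contravariant metric and a bivector field, with their Levi-Civita contravariant
connection. -/
structure LeviCivitaData where
  g : ContraTwoTensor I M
  P : ContraTwoTensor I M
  D : OneForm I M → OneForm I M → OneForm I M
  metric : IsContravariantMetric g
  smooth : IsSmoothPairing P
  alternating : IsAlternatingField P
  leviCivita : IsLeviCivita g P D

namespace LeviCivitaData

variable {I M} (S : LeviCivitaData I M)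

/-- The anchor, acting on functions. -/
abbrev anchor : SmoothOneForms I M → SmoothFunctions I M → SmoothFunctions I M :=
  anchorFun S.smooth

/-- The pairing of `1`-forms with the metric. -/
abbrev inner : SmoothOneForms I M → SmoothOneForms I M → SmoothFunctions I M :=
  pairingFun S.metric.smooth

/-- The pairing of `1`-forms with the bivector field. -/
abbrev biv : SmoothOneForms I M → SmoothOneForms I M → SmoothFunctions I M :=
  pairingFun S.smooth

/-- The Koszul bracket. -/
abbrev koszul : SmoothOneForms I M → SmoothOneForms I M → SmoothOneForms I M :=
  koszulForm S.smooth S.alternating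

/-- The Levi-Civita connection. -/
abbrev conn : SmoothOneForms I M → SmoothOneForms I M → SmoothOneForms I M :=
  connForm S.leviCivita.toIsContravariantConnection

/-- The Levi-Civita connection on `2`-forms. -/
abbrev connTwo : SmoothOneForms I M → SmoothTwoForms I M → SmoothTwoForms I M :=
  connTwoForm S.smooth S.leviCivita.toIsContravariantConnection

theorem connTwo_wedge (α β γ : SmoothOneForms I M) :
    S.connTwo α (wedgeForm β γ) = wedgeForm (S.conn α β) γ + wedgeForm β (S.conn α γ) :=
  connTwoForm_wedge S.smooth S.leviCivita.toIsContravariantConnection α β γ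

theorem connTwo_add (α : SmoothOneForms I M) (η θ : SmoothTwoForms I M) :
    S.connTwo α (η + θ) = S.connTwo α η + S.connTwo α θ :=
  connTwoForm_add S.smooth S.leviCivita.toIsContravariantConnection α η θ

theorem connTwo_smul (α : SmoothOneForms I M) (φ : SmoothFunctions I M) (η : SmoothTwoForms I M) :
    S.connTwo α (φ • η) = φ • S.connTwo α η + S.anchor α φ • η :=
  connTwoForm_smul S.smooth S.leviCivita.toIsContravariantConnection α φ η

theorem connTwo_cancel (α : SmoothOneForms I M) {χ : SmoothFunctions I M} (η : SmoothTwoForms I M)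
    {x : M} (hχ : ∀ᶠ y in 𝓝 x, χ.1 y = 1) : (S.connTwo α (χ • η)).1 x = (S.connTwo α η).1 x :=
  connTwoForm_cancel S.smooth S.leviCivita.toIsContravariantConnection α η hχ

/-- The contravariant calculus. -/
abbrev forms : ContravariantCalculus (SmoothFunctions I M) (SmoothOneForms I M)
    (SmoothTwoForms I M) :=
  calculus S.smooth S.alternating S.leviCivita.toIsContravariantConnection S.leviCivita.torsionFree

theorem two_mul_inner_conn (α β γ : SmoothOneForms I M) :
    2 * S.inner (S.conn α β) γ = S.anchor α (S.inner β γ) + S.anchor β (S.inner α γ)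
      - S.anchor γ (S.inner α β) + S.inner (S.koszul α β) γ + S.inner (S.koszul γ α) β +
      S.inner (S.koszul γ β) α :=
  two_mul_pairingFun_connForm S.smooth S.alternating S.metric S.leviCivita α β γ

theorem anchor_zero_right (α : SmoothOneForms I M) : S.anchor α 0 = 0 := S.forms.anchor_zero α

end LeviCivitaData

end Data

section Splitting

variable {E₁ : Type*} [NormedAddCommGroup E₁] [NormedSpace ℝ E₁] [FiniteDimensional ℝ E₁]
  {H₁ : Type*} [TopologicalSpace H₁] {I₁ : ModelWithCorners ℝ E₁ H₁}
  {M₁ : Type*} [TopologicalSpace M₁] [ChartedSpace H₁ M₁] [IsManifold I₁ ∞ M₁] [I₁.Boundaryless]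
  [T2Space M₁]
  {E₂ : Type*} [NormedAddCommGroup E₂] [NormedSpace ℝ E₂] [FiniteDimensional ℝ E₂]
  {H₂ : Type*} [TopologicalSpace H₂] {I₂ : ModelWithCorners ℝ E₂ H₂}
  {M₂ : Type*} [TopologicalSpace M₂] [ChartedSpace H₂ M₂] [IsManifold I₂ ∞ M₂] [I₂.Boundaryless]
  [T2Space M₂]
  {F : Type*} [NormedAddCommGroup F] [NormedSpace ℝ F] [FiniteDimensional ℝ F]
  {K : Type*} [TopologicalSpace K] {J : ModelWithCorners ℝ F K}
  {N : Type*} [TopologicalSpace N] [ChartedSpace K N] [IsManifold J ∞ N] [J.Boundaryless]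
  [T2Space N]

/-- Two maps `p` and `q` that split the cotangent spaces of `N`, the metric and the bivector field
into parts which are constant, respectively Casimir, multiples of pullbacks. -/
structure IsSplitting (S : LeviCivitaData J N) (S₁ : LeviCivitaData I₁ M₁)
    (S₂ : LeviCivitaData I₂ M₂) (p : N → M₁) (q : N → M₂) (m₁ w₁ m₂ w₂ : SmoothFunctions J N) :
    Prop where
  smooth_fst : ContMDiff J I₁ ∞ p
  smooth_snd : ContMDiff J I₂ ∞ q
  span : ∀ (z : N) (c : TangentSpace J z →L[ℝ] ℝ), ∃ (a : TangentSpace I₁ (p z) →L[ℝ] ℝ)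
    (b : TangentSpace I₂ (q z) →L[ℝ] ℝ), c = a.comp (mfderiv J I₁ p z) + b.comp (mfderiv J I₂ q z)
  biv_fst : ∀ (z : N) (a b : TangentSpace I₁ (p z) →L[ℝ] ℝ),
    S.P z (a.comp (mfderiv J I₁ p z)) (b.comp (mfderiv J I₁ p z)) = m₁.1 z * S₁.P (p z) a b
  biv_snd : ∀ (z : N) (a b : TangentSpace I₂ (q z) →L[ℝ] ℝ),
    S.P z (a.comp (mfderiv J I₂ q z)) (b.comp (mfderiv J I₂ q z)) = m₂.1 z * S₂.P (q z) a b
  biv_mixed : ∀ (z : N) (a : TangentSpace I₁ (p z) →L[ℝ] ℝ) (b : TangentSpace I₂ (q z) →L[ℝ] ℝ),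
    S.P z (a.comp (mfderiv J I₁ p z)) (b.comp (mfderiv J I₂ q z)) = 0
  metric_fst : ∀ (z : N) (a b : TangentSpace I₁ (p z) →L[ℝ] ℝ),
    S.g z (a.comp (mfderiv J I₁ p z)) (b.comp (mfderiv J I₁ p z)) = w₁.1 z * S₁.g (p z) a b
  metric_snd : ∀ (z : N) (a b : TangentSpace I₂ (q z) →L[ℝ] ℝ),
    S.g z (a.comp (mfderiv J I₂ q z)) (b.comp (mfderiv J I₂ q z)) = w₂.1 z * S₂.g (q z) a b
  metric_mixed : ∀ (z : N) (a : TangentSpace I₁ (p z) →L[ℝ] ℝ)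
    (b : TangentSpace I₂ (q z) →L[ℝ] ℝ),
    S.g z (a.comp (mfderiv J I₁ p z)) (b.comp (mfderiv J I₂ q z)) = 0
  constant_fst : differential m₁ = 0
  constant_snd : differential m₂ = 0
  casimir_fst : ∀ α, S.anchor α w₁ = 0
  casimir_snd : ∀ α, S.anchor α w₂ = 0

namespace IsSplitting

variable {S : LeviCivitaData J N} {S₁ : LeviCivitaData I₁ M₁} {S₂ : LeviCivitaData I₂ M₂}
  {p : N → M₁} {q : N → M₂} {m₁ w₁ m₂ w₂ : SmoothFunctions J N}

theorem symm (h : IsSplitting S S₁ S₂ p q m₁ w₁ m₂ w₂) : IsSplitting S S₂ S₁ q p m₂ w₂ m₁ w₁ where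
  smooth_fst := h.smooth_snd
  smooth_snd := h.smooth_fst
  span z c := by
    obtain ⟨a, b, hab⟩ := h.span z c
    exact ⟨b, a, hab.trans (add_comm _ _)⟩
  biv_fst := h.biv_snd
  biv_snd := h.biv_fst
  biv_mixed z a b := by
    rw [pairing_swap_of_alternating S.alternating, h.biv_mixed, neg_zero]
  metric_fst := h.metric_snd
  metric_snd := h.metric_fst
  metric_mixed z a b := by rw [S.metric.symm, h.metric_mixed]
  constant_fst := h.constant_snd
  constant_snd := h.constant_fst
  casimir_fst := h.casimir_snd
  casimir_snd := h.casimir_fst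

variable (h : IsSplitting S S₁ S₂ p q m₁ w₁ m₂ w₂)

theorem biv_pullback (α β : SmoothOneForms I₁ M₁) :
    S.biv (pullbackOne h.smooth_fst α) (pullbackOne h.smooth_fst β) =
      m₁ * pullbackFun h.smooth_fst (S₁.biv α β) :=
  smoothFunctions_ext fun z => h.biv_fst z _ _

theorem biv_pullback_mixed (α : SmoothOneForms I₁ M₁) (β : SmoothOneForms I₂ M₂) :
    S.biv (pullbackOne h.smooth_fst α) (pullbackOne h.smooth_snd β) = 0 :=
  smoothFunctions_ext fun z => h.biv_mixed z _ _

theorem inner_pullback (α β : SmoothOneForms I₁ M₁) :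
    S.inner (pullbackOne h.smooth_fst α) (pullbackOne h.smooth_fst β) =
      w₁ * pullbackFun h.smooth_fst (S₁.inner α β) :=
  smoothFunctions_ext fun z => h.metric_fst z _ _

theorem inner_pullback_mixed (α : SmoothOneForms I₁ M₁) (β : SmoothOneForms I₂ M₂) :
    S.inner (pullbackOne h.smooth_fst α) (pullbackOne h.smooth_snd β) = 0 :=
  smoothFunctions_ext fun z => h.metric_mixed z _ _

theorem anchor_pullback (α : SmoothOneForms I₁ M₁) (φ : SmoothFunctions I₁ M₁) :
    S.anchor (pullbackOne h.smooth_fst α) (pullbackFun h.smooth_fst φ) =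
      m₁ * pullbackFun h.smooth_fst (S₁.anchor α φ) := by
  have h1 := h.biv_pullback α (differential φ)
  rwa [pullbackOne_differential] at h1

theorem anchor_pullback_mixed (α : SmoothOneForms I₁ M₁) (φ : SmoothFunctions I₂ M₂) :
    S.anchor (pullbackOne h.smooth_fst α) (pullbackFun h.smooth_snd φ) = 0 := by
  have h1 := h.biv_pullback_mixed α (differential φ)
  rwa [pullbackOne_differential] at h1

include h in
theorem anchor_factor (α : SmoothOneForms J N) : S.anchor α m₁ = 0 := by
  rw [LeviCivitaData.anchor, anchorFun, h.constant_fst]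
  exact smoothFunctions_ext fun z => map_zero _

theorem mfderiv_sharp (α : SmoothOneForms I₁ M₁) (z : N) :
    mfderiv J I₁ p z (sharp S.P (pullbackOne h.smooth_fst α).1 z) =
      m₁.1 z • sharp S₁.P α.1 (p z) := by
  refine eq_of_covectors fun c => ?_
  rw [map_smul]
  refine (apply_sharpAt S.P z _ (c.comp (mfderiv J I₁ p z))).trans ?_
  refine (h.biv_fst z _ _).trans ?_
  rw [sharp, apply_sharpAt]
  rfl

theorem mfderiv_sharp_mixed (α : SmoothOneForms I₂ M₂) (z : N) :
    mfderiv J I₁ p z (sharp S.P (pullbackOne h.smooth_snd α).1 z) = 0 := by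
  refine eq_of_covectors fun c => ?_
  rw [map_zero]
  refine (apply_sharpAt S.P z _ (c.comp (mfderiv J I₁ p z))).trans ?_
  exact h.symm.biv_mixed z _ _

theorem exteriorDeriv_pullback_apply (α : SmoothOneForms I₁ M₁) (z : N) (u v : TangentSpace J z) :
    (exteriorDeriv (pullbackOne h.smooth_fst α)).1 z u v =
      (exteriorDeriv α).1 (p z) (mfderiv J I₁ p z u) (mfderiv J I₁ p z v) := by
  rw [exteriorDeriv_pullbackOne]
  rfl

theorem koszul_pullback (α β : SmoothOneForms I₁ M₁) :
    S.koszul (pullbackOne h.smooth_fst α) (pullbackOne h.smooth_fst β) =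
      m₁ • pullbackOne h.smooth_fst (S₁.koszul α β) := by
  refine smoothOneForms_ext fun z => ?_
  have h1 : differential (S.biv (pullbackOne h.smooth_fst α) (pullbackOne h.smooth_fst β)) =
      m₁ • pullbackOne h.smooth_fst (differential (S₁.biv α β)) := by
    rw [h.biv_pullback, differential_mul, h.constant_fst, smul_zero, add_zero,
      pullbackOne_differential]
  refine (koszulBracket_apply S.smooth S.alternating _ _ z).trans ?_
  rw [h1]
  ext v
  change (exteriorDeriv (pullbackOne h.smooth_fst β)).1 z _ v -
    (exteriorDeriv (pullbackOne h.smooth_fst α)).1 z _ v +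
      m₁.1 z * (differential (S₁.biv α β)).1 (p z) (mfderiv J I₁ p z v) =
    m₁.1 z * koszulBracket S₁.P α.1 β.1 (p z) (mfderiv J I₁ p z v)
  rw [koszulBracket_apply S₁.smooth S₁.alternating, h.exteriorDeriv_pullback_apply,
    h.exteriorDeriv_pullback_apply, h.mfderiv_sharp, h.mfderiv_sharp, map_smul, map_smul]
  simp only [smul_apply, sub_apply, add_apply, smul_eq_mul]
  ring

theorem koszul_pullback_mixed (α : SmoothOneForms I₁ M₁) (β : SmoothOneForms I₂ M₂) :
    S.koszul (pullbackOne h.smooth_fst α) (pullbackOne h.smooth_snd β) = 0 := by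
  refine smoothOneForms_ext fun z => ?_
  refine (koszulBracket_apply S.smooth S.alternating _ _ z).trans ?_
  have h1 : differential (S.biv (pullbackOne h.smooth_fst α) (pullbackOne h.smooth_snd β)) = 0 := by
    rw [h.biv_pullback_mixed]
    exact (by simpa using S.forms.d_add 0 0 : S.forms.d 0 = 0)
  rw [h1]
  ext v
  change (exteriorDeriv (pullbackOne h.smooth_snd β)).1 z _ v -
    (exteriorDeriv (pullbackOne h.smooth_fst α)).1 z _ v + 0 = 0
  rw [h.symm.exteriorDeriv_pullback_apply, h.exteriorDeriv_pullback_apply, h.mfderiv_sharp_mixed,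
    h.symm.mfderiv_sharp_mixed, map_zero, map_zero]
  simp

theorem koszul_pullback_mixed' (α : SmoothOneForms I₂ M₂) (β : SmoothOneForms I₁ M₁) :
    S.koszul (pullbackOne h.smooth_snd α) (pullbackOne h.smooth_fst β) = 0 :=
  h.symm.koszul_pullback_mixed α β

theorem eq_of_inner {α β : SmoothOneForms J N}
    (h₁ : ∀ γ, 2 * S.inner α (pullbackOne h.smooth_fst γ) =
      2 * S.inner β (pullbackOne h.smooth_fst γ))
    (h₂ : ∀ γ, 2 * S.inner α (pullbackOne h.smooth_snd γ) =
      2 * S.inner β (pullbackOne h.smooth_snd γ)) : α = β := by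
  refine smoothOneForms_ext fun z => sub_eq_zero.1 (S.metric.nondegenerate z _ fun c => ?_)
  obtain ⟨a, b, rfl⟩ := h.span z c
  obtain ⟨φ, rfl⟩ := exists_differential_eq (p z) a
  obtain ⟨ψ, rfl⟩ := exists_differential_eq (q z) b
  have e₁ := congrArg (evalAt z) (two_mul_cancel (h₁ (differential φ)))
  have e₂ := congrArg (evalAt z) (two_mul_cancel (h₂ (differential ψ)))
  rw [map_sub, sub_apply, map_add, map_add, sub_eq_zero]
  exact congrArg₂ (· + ·) e₁ e₂

theorem inner_pullback_mixed' (α : SmoothOneForms I₂ M₂) (β : SmoothOneForms I₁ M₁) :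
    S.inner (pullbackOne h.smooth_snd α) (pullbackOne h.smooth_fst β) = 0 :=
  h.symm.inner_pullback_mixed α β

theorem anchor_pullback_mixed' (α : SmoothOneForms I₂ M₂) (φ : SmoothFunctions I₁ M₁) :
    S.anchor (pullbackOne h.smooth_snd α) (pullbackFun h.smooth_fst φ) = 0 :=
  h.symm.anchor_pullback_mixed α φ

theorem inner_zero_left (α : SmoothOneForms J N) : S.inner 0 α = 0 :=
  smoothFunctions_ext fun z => by
    change S.g z 0 (α.1 z) = 0
    rw [map_zero]; rfl

include h in
theorem anchor_mul_weight (α : SmoothOneForms J N) (φ : SmoothFunctions J N) :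
    S.anchor α (w₁ * φ) = w₁ * S.anchor α φ := by
  rw [LeviCivitaData.anchor, anchorFun_mul]
  have h1 := h.casimir_fst α
  rw [LeviCivitaData.anchor] at h1
  rw [h1, mul_zero, add_zero]

theorem conn_pullback (α β : SmoothOneForms I₁ M₁) :
    S.conn (pullbackOne h.smooth_fst α) (pullbackOne h.smooth_fst β) =
      m₁ • pullbackOne h.smooth_fst (S₁.conn α β) := by
  refine h.eq_of_inner (fun γ => ?_) fun γ => ?_
  · have h1 := congrArg (pullbackFun h.smooth_fst) (S₁.two_mul_inner_conn α β γ)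
    have h2 : 2 * pullbackFun h.smooth_fst (S₁.inner (S₁.conn α β) γ) =
      pullbackFun h.smooth_fst (S₁.anchor α (S₁.inner β γ)) +
        pullbackFun h.smooth_fst (S₁.anchor β (S₁.inner α γ)) -
        pullbackFun h.smooth_fst (S₁.anchor γ (S₁.inner α β)) +
        pullbackFun h.smooth_fst (S₁.inner (S₁.koszul α β) γ) +
        pullbackFun h.smooth_fst (S₁.inner (S₁.koszul γ α) β) +
        pullbackFun h.smooth_fst (S₁.inner (S₁.koszul γ β) α) := h1
    rw [S.two_mul_inner_conn]
    simp only [h.koszul_pullback, h.inner_pullback, pairingFun_smul_left, h.anchor_mul_weight,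
      h.anchor_pullback]
    linear_combination (-(m₁ * w₁)) * h2
  · rw [S.two_mul_inner_conn]
    simp only [h.koszul_pullback, h.inner_pullback, pairingFun_smul_left, h.anchor_mul_weight,
      h.inner_pullback_mixed, h.koszul_pullback_mixed', h.anchor_pullback_mixed',
      S.anchor_zero_right, inner_zero_left]
    ring

theorem conn_pullback_mixed (α : SmoothOneForms I₁ M₁) (β : SmoothOneForms I₂ M₂) :
    S.conn (pullbackOne h.smooth_fst α) (pullbackOne h.smooth_snd β) = 0 := by
  refine h.eq_of_inner (fun γ => ?_) fun γ => ?_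
  · rw [S.two_mul_inner_conn]
    simp only [h.koszul_pullback, h.inner_pullback, pairingFun_smul_left, h.anchor_mul_weight,
      h.inner_pullback_mixed, h.inner_pullback_mixed', h.koszul_pullback_mixed,
      h.anchor_pullback_mixed', S.anchor_zero_right, inner_zero_left]
    ring
  · rw [S.two_mul_inner_conn]
    simp only [h.symm.koszul_pullback, h.symm.inner_pullback, pairingFun_smul_left,
      h.symm.anchor_mul_weight, h.inner_pullback_mixed, h.inner_pullback_mixed',
      h.koszul_pullback_mixed, h.koszul_pullback_mixed',
      h.anchor_pullback_mixed, S.anchor_zero_right, inner_zero_left]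
    ring

theorem connTwo_pullback_wedge (α β γ : SmoothOneForms I₁ M₁) :
    S.connTwo (pullbackOne h.smooth_fst α) (pullbackTwo h.smooth_fst (wedgeForm β γ)) =
      m₁ • pullbackTwo h.smooth_fst (S₁.connTwo α (wedgeForm β γ)) := by
  rw [S₁.connTwo_wedge, pullbackTwo_wedge, pullbackTwo_add, pullbackTwo_wedge, pullbackTwo_wedge,
    S.connTwo_wedge, h.conn_pullback, h.conn_pullback, wedgeForm_smul_left, wedgeForm_smul_right,
    smul_add]

theorem connTwo_pullback (α : SmoothOneForms I₁ M₁) (η : SmoothTwoForms I₁ M₁) :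
    S.connTwo (pullbackOne h.smooth_fst α) (pullbackTwo h.smooth_fst η) =
      m₁ • pullbackTwo h.smooth_fst (S₁.connTwo α η) := by
  refine smoothTwoForms_ext fun z => ?_
  refine twoForm_induction (p z) (p := fun η =>
    (S.connTwo (pullbackOne h.smooth_fst α) (pullbackTwo h.smooth_fst η)).1 z =
      (m₁ • pullbackTwo h.smooth_fst (S₁.connTwo α η)).1 z) ?_ ?_ ?_ ?_ η
  · intro φ ψ
    rw [h.connTwo_pullback_wedge]
  · intro η θ hη hθ
    rw [pullbackTwo_add, S.connTwo_add, S₁.connTwo_add, pullbackTwo_add, smul_add,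
      smoothTwoForms_add_apply, smoothTwoForms_add_apply, hη, hθ]
  · intro φ η hη
    rw [pullbackTwo_smul, S.connTwo_smul, S₁.connTwo_smul, pullbackTwo_add, pullbackTwo_smul,
      pullbackTwo_smul, h.anchor_pullback, smul_add, smul_comm m₁]
    exact congrArg₂ (· + ·) (congrArg (φ.1 (p z) • ·) hη) (mul_smul (m₁.1 z) _ _)
  · intro χ η hχ hη
    have hχ' : ∀ᶠ y in 𝓝 z, (pullbackFun h.smooth_fst χ).1 y = 1 :=
      h.smooth_fst.continuous.continuousAt.eventually hχ
    refine (S.connTwo_cancel _ _ hχ').symm.trans (hη.trans ?_)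
    exact congrArg (fun θ => m₁.1 z • pullbackForm (V := F) (V' := E₁) (mfderiv J I₁ p z) θ)
      (S₁.connTwo_cancel α η hχ)

theorem connTwo_pullback_mixed (α : SmoothOneForms I₂ M₂) (η : SmoothTwoForms I₁ M₁) :
    S.connTwo (pullbackOne h.smooth_snd α) (pullbackTwo h.smooth_fst η) = 0 := by
  refine smoothTwoForms_ext fun z => ?_
  refine twoForm_induction (p z) (p := fun η =>
    (S.connTwo (pullbackOne h.smooth_snd α) (pullbackTwo h.smooth_fst η)).1 z = 0) ?_ ?_ ?_ ?_ η
  · intro φ ψ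
    have hw : ∀ β : SmoothOneForms J N, wedgeForm β 0 = 0 := S.forms.wedge_zero_right
    rw [pullbackTwo_wedge, S.connTwo_wedge, h.symm.conn_pullback_mixed, h.symm.conn_pullback_mixed,
      wedgeForm_comm, hw, hw, neg_zero, zero_add]
    rfl
  · intro η θ hη hθ
    rw [pullbackTwo_add, S.connTwo_add, smoothTwoForms_add_apply, hη, hθ, add_zero]
  · intro φ η hη
    rw [pullbackTwo_smul, S.connTwo_smul, h.anchor_pullback_mixed', zero_smul, add_zero,
      smoothTwoForms_smul_apply, hη, smul_zero]
  · intro χ η hχ hη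
    have hχ' : ∀ᶠ y in 𝓝 z, (pullbackFun h.smooth_fst χ).1 y = 1 :=
      h.smooth_fst.continuous.continuousAt.eventually hχ
    exact (S.connTwo_cancel _ _ hχ').symm.trans hη

/-- The pullback along the first map of a splitting. -/
def lift : ContravariantCalculus.Lift S₁.forms S.forms where
  mapA := pullbackFun h.smooth_fst
  mapV := pullbackOne h.smooth_fst
  mapW := pullbackTwo h.smooth_fst
  factor := m₁
  mapA_sub _ _ := rfl
  mapV_sub _ _ := map_sub (AddMonoidHom.mk' _ (pullbackOne_add h.smooth_fst)) _ _
  mapW_sub _ _ := map_sub (AddMonoidHom.mk' _ (pullbackTwo_add h.smooth_fst)) _ _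
  d_map φ := (pullbackOne_differential h.smooth_fst φ).symm
  dd_map α := exteriorDeriv_pullbackOne h.smooth_fst α
  d_factor := h.constant_fst
  anchor_factor := h.anchor_factor
  anchor_map := h.anchor_pullback
  D_map := h.conn_pullback
  DD_map := h.connTwo_pullback

theorem isDisjoint_lift : h.lift.IsDisjoint h.symm.lift where
  anchor_left := h.anchor_pullback_mixed
  anchor_right := h.anchor_pullback_mixed'
  D_left := h.conn_pullback_mixed
  D_right := h.symm.conn_pullback_mixed
  DD_left := h.symm.connTwo_pullback_mixed
  DD_right := h.connTwo_pullback_mixed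

end IsSplitting

end Splitting

/-! ### Metaflatness of splittings -/

section MetaflatData

variable {E : Type*} [NormedAddCommGroup E] [NormedSpace ℝ E] [FiniteDimensional ℝ E]
  {H : Type*} [TopologicalSpace H] {I : ModelWithCorners ℝ E H}
  {M : Type*} [TopologicalSpace M] [ChartedSpace H M] [IsManifold I ∞ M] [I.Boundaryless]
  [T2Space M]

namespace LeviCivitaData

variable (S : LeviCivitaData I M)

theorem curvature_eq (α β γ : SmoothOneForms I M) :
    curvature S.P S.D α.1 β.1 γ.1 = (S.forms.curv α β γ).1 := by
  have h := S.leviCivita.torsionFree α.1 β.1 α.2 β.2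
  rw [curvature, ← h]
  rfl

theorem isFlat_iff : IsFlat S.P S.D ↔ ∀ α β γ, S.forms.curv α β γ = 0 := by
  refine ⟨fun h α β γ => Subtype.ext ?_, fun h α β γ hα hβ hγ => ?_⟩
  · rw [← S.curvature_eq]
    exact h _ _ _ α.2 β.2 γ.2
  · exact (S.curvature_eq ⟨α, hα⟩ ⟨β, hβ⟩ ⟨γ, hγ⟩).trans (congrArg Subtype.val (h _ _ _))

/-- The bracket of bundled smooth `1`-forms. -/
def bracketForm {B : OneForm I M → OneForm I M → CovTwoTensor I M}
    (hB : IsOneFormBracket S.P S.D B) (α β : SmoothOneForms I M) : SmoothTwoForms I M :=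
  ⟨B α.1 β.1, hB.smooth _ _ α.2 β.2⟩

variable {S} {B : OneForm I M → OneForm I M → CovTwoTensor I M}
  (hB : IsOneFormBracket S.P S.D B)

theorem isBracket_bracketForm : S.forms.IsBracket (S.bracketForm hB) where
  add α β γ := Subtype.ext (hB.add_right _ _ _ α.2 β.2 γ.2)
  symm α β := Subtype.ext (hB.symm _ _ α.2 β.2)
  dd_D φ β := Subtype.ext (hB.differential _ _ φ.2 β.2)
  smul φ α β := by
    refine Subtype.ext ((hB.product _ _ _ φ.2 α.2 β.2).trans ?_)
    funext x
    ext u v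
    change (-(S.D (dFun φ.1) α.1 x u) * β.1 x v - β.1 x u * -(S.D (dFun φ.1) α.1 x v)) +
      φ.1 x * B α.1 β.1 x u v = -(S.D (dFun φ.1) α.1 x u * β.1 x v -
        β.1 x u * S.D (dFun φ.1) α.1 x v) + φ.1 x * B α.1 β.1 x u v
    ring

theorem metacurvature_eq_zero_iff :
    (∀ (φ : M → ℝ) (α β : OneForm I M), SmoothFun I φ → SmoothOneForm α → SmoothOneForm β →
      metacurvature S.P S.D B φ α β = 0) ↔
    ∀ φ α β, S.forms.metacurv (S.bracketForm hB) φ α β = 0 :=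
  ⟨fun h φ α β => Subtype.ext (h φ.1 α.1 β.1 φ.2 α.2 β.2),
    fun h φ α β hφ hα hβ => congrArg Subtype.val (h ⟨φ, hφ⟩ ⟨α, hα⟩ ⟨β, hβ⟩)⟩

theorem jacobiator_eq_zero (h : ∀ α β γ, S.forms.curv α β γ = 0) (α β : SmoothOneForms I M)
    (φ : SmoothFunctions I M) : S.forms.jacobiator α β φ = 0 := by
  refine smoothFunctions_ext fun x => ?_
  by_cases hx : α.1 x = 0
  · have h0 : S.forms.jacobiator 0 β φ = 0 := by
      have := S.forms.jacobiator_smul_left 0 0 β φ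
      rwa [zero_smul, zero_mul] at this
    refine (eq_of_tensorial x (L := fun α => (S.forms.jacobiator α β φ).1 x)
      (fun α α' => by rw [S.forms.jacobiator_add_left]; rfl)
      (fun φ α => by rw [S.forms.jacobiator_smul_left]; rfl) (β := 0) hx).trans ?_
    exact congrArg (evalAt x) h0
  · have h1 := S.forms.curv_smul_right φ α β α
    rw [h, h, smul_zero, zero_add] at h1
    have h2 : (S.forms.jacobiator α β φ).1 x • α.1 x = 0 :=
      (congrFun (congrArg Subtype.val h1) x).symm
    exact (smul_eq_zero.1 h2).resolve_right hx

end LeviCivitaData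

end MetaflatData

section Splitting

variable {E₁ : Type*} [NormedAddCommGroup E₁] [NormedSpace ℝ E₁] [FiniteDimensional ℝ E₁]
  {H₁ : Type*} [TopologicalSpace H₁] {I₁ : ModelWithCorners ℝ E₁ H₁}
  {M₁ : Type*} [TopologicalSpace M₁] [ChartedSpace H₁ M₁] [IsManifold I₁ ∞ M₁] [I₁.Boundaryless]
  [T2Space M₁]
  {E₂ : Type*} [NormedAddCommGroup E₂] [NormedSpace ℝ E₂] [FiniteDimensional ℝ E₂]
  {H₂ : Type*} [TopologicalSpace H₂] {I₂ : ModelWithCorners ℝ E₂ H₂}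
  {M₂ : Type*} [TopologicalSpace M₂] [ChartedSpace H₂ M₂] [IsManifold I₂ ∞ M₂] [I₂.Boundaryless]
  [T2Space M₂]
  {F : Type*} [NormedAddCommGroup F] [NormedSpace ℝ F] [FiniteDimensional ℝ F]
  {K : Type*} [TopologicalSpace K] {J : ModelWithCorners ℝ F K}
  {N : Type*} [TopologicalSpace N] [ChartedSpace K N] [IsManifold J ∞ N] [J.Boundaryless]
  [T2Space N]

namespace IsSplitting

variable {S : LeviCivitaData J N} {S₁ : LeviCivitaData I₁ M₁} {S₂ : LeviCivitaData I₂ M₂}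
  {p : N → M₁} {q : N → M₂} {m₁ w₁ m₂ w₂ : SmoothFunctions J N}
  (h : IsSplitting S S₁ S₂ p q m₁ w₁ m₂ w₂)

theorem eq_zero_of_tensorial {V : Type*} [AddCommGroup V] [Module ℝ V] (z : N)
    {L : SmoothOneForms J N → V} (add : ∀ α β, L (α + β) = L α + L β)
    (smul : ∀ (φ : SmoothFunctions J N) α, L (φ • α) = φ.1 z • L α)
    (h₁ : ∀ φ, L (differential (pullbackFun h.smooth_fst φ)) = 0)
    (h₂ : ∀ φ, L (differential (pullbackFun h.smooth_snd φ)) = 0) (α : SmoothOneForms J N) :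
    L α = 0 := by
  obtain ⟨a, b, hab⟩ := h.span z (α.1 z)
  obtain ⟨φ, rfl⟩ := exists_differential_eq (p z) a
  obtain ⟨ψ, rfl⟩ := exists_differential_eq (q z) b
  rw [← pullbackOne_apply h.smooth_fst, ← pullbackOne_apply h.smooth_snd, pullbackOne_differential,
    pullbackOne_differential, ← smoothOneForms_add_apply] at hab
  rw [eq_of_tensorial z add smul hab, add, h₁, h₂, add_zero]

section Descent

variable (hp : ∀ y, ∃ z, p z = y ∧ m₁.1 z ≠ 0)
  (hs : ∀ z, Function.Surjective (mfderiv J I₁ p z))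
include hp hs

theorem eq_zero_of_pullbackOne {α : SmoothOneForms I₁ M₁}
    (hα : (m₁ * m₁) • pullbackOne h.smooth_fst α = 0) : α = 0 := by
  refine smoothOneForms_ext fun y => ?_
  obtain ⟨z, rfl, hz⟩ := hp y
  have h1 : (m₁.1 z * m₁.1 z) • (α.1 (p z)).comp (mfderiv J I₁ p z) = 0 :=
    congrFun (congrArg Subtype.val hα) z
  have h2 := (smul_eq_zero.1 h1).resolve_left (mul_ne_zero hz hz)
  ext v
  obtain ⟨u, rfl⟩ := hs z v
  exact congrArg (fun c : TangentSpace J z →L[ℝ] ℝ => c u) h2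

theorem eq_zero_of_pullbackTwo {η : SmoothTwoForms I₁ M₁}
    (hη : (m₁ * m₁) • pullbackTwo h.smooth_fst η = 0) : η = 0 := by
  refine smoothTwoForms_ext fun y => ?_
  obtain ⟨z, rfl, hz⟩ := hp y
  have h1 : (m₁.1 z * m₁.1 z) • (pullbackTwo h.smooth_fst η).1 z = 0 :=
    congrFun (congrArg Subtype.val hη) z
  have h2 := (smul_eq_zero.1 h1).resolve_left (mul_ne_zero hz hz)
  ext v v'
  obtain ⟨u, rfl⟩ := hs z v
  obtain ⟨u', rfl⟩ := hs z v'
  exact congrArg (fun c : TangentSpace J z →L[ℝ] TangentSpace J z →L[ℝ] ℝ => c u u') h2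

include h in
theorem curv_fst (hS : ∀ α β γ, S.forms.curv α β γ = 0) (α β γ : SmoothOneForms I₁ M₁) :
    S₁.forms.curv α β γ = 0 :=
  h.eq_zero_of_pullbackOne hp hs ((h.lift.curv_map α β γ).symm.trans (hS _ _ _))

include h in
theorem metacurv_fst (hS : ∀ α β γ, S.forms.curv α β γ = 0)
    {B : SmoothOneForms J N → SmoothOneForms J N → SmoothTwoForms J N}
    (hB : S.forms.IsBracket B) (hM : ∀ φ α β, S.forms.metacurv B φ α β = 0)
    {B₁ : SmoothOneForms I₁ M₁ → SmoothOneForms I₁ M₁ → SmoothTwoForms I₁ M₁}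
    (hB₁ : S₁.forms.IsBracket B₁) (φ : SmoothFunctions I₁ M₁) (α β : SmoothOneForms I₁ M₁) :
    S₁.forms.metacurv B₁ φ α β = 0 := by
  have hS₁ := h.curv_fst hp hs hS
  have hexact : ∀ ψ χ : SmoothFunctions I₁ M₁,
      S₁.forms.metacurv B₁ φ (differential ψ) (differential χ) = 0 := fun ψ χ =>
    h.eq_zero_of_pullbackTwo hp hs ((h.lift.metacurv_map hB hB₁ φ ψ χ).symm.trans (hM _ _ _))
  have hred : ∀ α (y : M₁), (∀ ψ, S₁.forms.metacurv B₁ φ α (differential ψ) = 0) →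
      ∀ β, (S₁.forms.metacurv B₁ φ α β).1 y = 0 := fun α y hα β => by
    obtain ⟨ψ, hψ⟩ := exists_differential_eq y (β.1 y)
    refine (eq_of_tensorial y (L := fun β => (S₁.forms.metacurv B₁ φ α β).1 y)
      (fun β β' => by rw [hB₁.metacurv_add_right]; rfl)
      (fun χ β => by rw [hB₁.metacurv_smul_right φ χ α β (hS₁ _ _ _)]; rfl) hψ.symm).trans ?_
    rw [hα]; rfl
  refine smoothTwoForms_ext fun y => hred α y (fun ψ => ?_) β
  rw [hB₁.metacurv_symm]
  exact smoothTwoForms_ext fun y => hred _ y (fun χ => hexact ψ χ) α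

end Descent

section Ascent

variable (h₁ : ∀ α β γ, S₁.forms.curv α β γ = 0) (h₂ : ∀ α β γ, S₂.forms.curv α β γ = 0)

include h h₁ in
theorem jacobiator_lift (φ ψ χ : SmoothFunctions I₁ M₁) :
    S.forms.jacobiator (differential (pullbackFun h.smooth_fst φ))
      (differential (pullbackFun h.smooth_fst ψ)) (pullbackFun h.smooth_fst χ) = 0 := by
  have e := h.lift.jacobiator_map (differential φ) (differential ψ) χ
  rw [LeviCivitaData.jacobiator_eq_zero h₁, h.lift.mapA_zero, mul_zero] at e
  rw [← pullbackOne_differential, ← pullbackOne_differential]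
  exact e

theorem jacobiator_lift_snd (φ ψ : SmoothFunctions I₁ M₁) (χ : SmoothFunctions I₂ M₂) :
    S.forms.jacobiator (differential (pullbackFun h.smooth_fst φ))
      (differential (pullbackFun h.smooth_fst ψ)) (pullbackFun h.smooth_snd χ) = 0 := by
  rw [← pullbackOne_differential, ← pullbackOne_differential]
  exact h.isDisjoint_lift.jacobiator_snd _ _ _

theorem jacobiator_lift_mixed (φ : SmoothFunctions I₁ M₁) (ψ : SmoothFunctions I₂ M₂)
    (χ : SmoothFunctions I₁ M₁) :
    S.forms.jacobiator (differential (pullbackFun h.smooth_fst φ))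
      (differential (pullbackFun h.smooth_snd ψ)) (pullbackFun h.smooth_fst χ) = 0 := by
  rw [← pullbackOne_differential, ← pullbackOne_differential]
  exact h.isDisjoint_lift.jacobiator_mixed _ _ _

theorem jacobiator_lift_mixed' (φ : SmoothFunctions I₂ M₂) (ψ χ : SmoothFunctions I₁ M₁) :
    S.forms.jacobiator (differential (pullbackFun h.smooth_snd φ))
      (differential (pullbackFun h.smooth_fst ψ)) (pullbackFun h.smooth_fst χ) = 0 := by
  rw [← pullbackOne_differential, ← pullbackOne_differential]
  exact h.isDisjoint_lift.jacobiator_mixed' _ _ _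

theorem eq_zero_of_tensorial_jacobiator {β : SmoothOneForms J N} {χ : SmoothFunctions J N}
    (e₁ : ∀ φ, S.forms.jacobiator (differential (pullbackFun h.smooth_fst φ)) β χ = 0)
    (e₂ : ∀ φ, S.forms.jacobiator (differential (pullbackFun h.smooth_snd φ)) β χ = 0)
    (α : SmoothOneForms J N) : S.forms.jacobiator α β χ = 0 :=
  smoothFunctions_ext fun z =>
    h.eq_zero_of_tensorial z (L := fun α => (S.forms.jacobiator α β χ).1 z)
      (fun α α' => by rw [S.forms.jacobiator_add_left]; rfl)
      (fun φ α => by rw [S.forms.jacobiator_smul_left]; rfl)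
      (fun φ => congrArg (evalAt z) (e₁ φ)) (fun φ => congrArg (evalAt z) (e₂ φ)) α

include h h₁ h₂

theorem jacobiator_eq_zero (α β : SmoothOneForms J N) (χ : SmoothFunctions J N) :
    S.forms.jacobiator α β χ = 0 := by
  have cyc : ∀ φ ψ χ, S.forms.jacobiator (differential φ) (differential ψ) χ =
    S.forms.jacobiator (differential ψ) (differential χ) φ := S.forms.jacobiator_d_cyclic
  have swap : ∀ α β χ, S.forms.jacobiator β α χ = 0 → S.forms.jacobiator α β χ = 0 :=
    fun α β χ e => by rw [S.forms.jacobiator_swap, e, neg_zero]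
  refine h.eq_zero_of_tensorial_jacobiator (fun φ => swap _ _ _ ?_) (fun φ => swap _ _ _ ?_) α
  · refine h.eq_zero_of_tensorial_jacobiator (fun ψ => ?_) (fun ψ => ?_) β
    all_goals rw [cyc, cyc]
    all_goals refine h.eq_zero_of_tensorial_jacobiator (fun σ => ?_) (fun σ => ?_) (differential χ)
    · exact h.jacobiator_lift h₁ _ _ _
    · exact h.jacobiator_lift_mixed' _ _ _
    · exact h.jacobiator_lift_mixed _ _ _
    · exact h.symm.jacobiator_lift_snd _ _ _
  · refine h.eq_zero_of_tensorial_jacobiator (fun ψ => ?_) (fun ψ => ?_) β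
    all_goals rw [cyc, cyc]
    all_goals refine h.eq_zero_of_tensorial_jacobiator (fun σ => ?_) (fun σ => ?_) (differential χ)
    · exact h.jacobiator_lift_snd _ _ _
    · exact h.symm.jacobiator_lift_mixed _ _ _
    · exact h.symm.jacobiator_lift_mixed' _ _ _
    · exact h.symm.jacobiator_lift h₂ _ _ _

theorem curv_eq_zero (α β γ : SmoothOneForms J N) : S.forms.curv α β γ = 0 := by
  have hJ := h.jacobiator_eq_zero h₁ h₂
  have d₁ := fun φ => (pullbackOne_differential h.smooth_fst φ).symm
  have d₂ := fun φ => (pullbackOne_differential h.smooth_snd φ).symm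
  have left : ∀ {β γ}, (∀ φ, S.forms.curv (differential (pullbackFun h.smooth_fst φ)) β γ = 0) →
      (∀ φ, S.forms.curv (differential (pullbackFun h.smooth_snd φ)) β γ = 0) →
      ∀ α, S.forms.curv α β γ = 0 := fun e₁ e₂ α => smoothOneForms_ext fun z =>
    h.eq_zero_of_tensorial z (L := fun α => (S.forms.curv α _ _).1 z)
      (fun α α' => by rw [S.forms.curv_add_left]; rfl)
      (fun φ α => by rw [S.forms.curv_smul_left]; rfl)
      (fun φ => congrFun (congrArg Subtype.val (e₁ φ)) z)
      (fun φ => congrFun (congrArg Subtype.val (e₂ φ)) z) α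
  have right : ∀ {α β}, (∀ φ, S.forms.curv α β (differential (pullbackFun h.smooth_fst φ)) = 0) →
      (∀ φ, S.forms.curv α β (differential (pullbackFun h.smooth_snd φ)) = 0) →
      ∀ γ, S.forms.curv α β γ = 0 := fun e₁ e₂ γ => smoothOneForms_ext fun z =>
    h.eq_zero_of_tensorial z (L := fun γ => (S.forms.curv _ _ γ).1 z)
      (fun α α' => by rw [S.forms.curv_add_right]; rfl)
      (fun φ α => by rw [S.forms.curv_smul_right, hJ, zero_smul, add_zero]; rfl)
      (fun φ => congrFun (congrArg Subtype.val (e₁ φ)) z)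
      (fun φ => congrFun (congrArg Subtype.val (e₂ φ)) z) γ
  have swap : ∀ α β γ, S.forms.curv β α γ = 0 → S.forms.curv α β γ = 0 :=
    fun α β γ e => by rw [S.forms.curv_swap, e, neg_zero]
  refine left (fun φ => swap _ _ _ (left (fun ψ => ?_) (fun ψ => ?_) β))
    (fun φ => swap _ _ _ (left (fun ψ => ?_) (fun ψ => ?_) β)) α
  all_goals refine right (fun χ => ?_) (fun χ => ?_) γ
  all_goals simp only [d₁, d₂]
  · refine (h.lift.curv_map _ _ _).trans ?_
    rw [h₁, h.lift.mapV_zero, smul_zero]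
  · exact h.isDisjoint_lift.curv_snd _ _ _
  · exact h.isDisjoint_lift.curv_mixed' _ _ _
  · exact h.symm.isDisjoint_lift.curv_mixed _ _ _
  · exact h.isDisjoint_lift.curv_mixed _ _ _
  · exact h.symm.isDisjoint_lift.curv_mixed' _ _ _
  · exact h.symm.isDisjoint_lift.curv_snd _ _ _
  · refine (h.symm.lift.curv_map _ _ _).trans ?_
    rw [h₂, h.symm.lift.mapV_zero, smul_zero]

theorem curvTwo_eq_zero (α β : SmoothOneForms J N) (η : SmoothTwoForms J N) :
    S.forms.curvTwo α β η = 0 := by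
  have hJ := h.jacobiator_eq_zero h₁ h₂
  have hR := h.curv_eq_zero h₁ h₂
  refine smoothTwoForms_ext fun z => ?_
  have hsmul : ∀ (φ : SmoothFunctions J N) η, (S.forms.curvTwo α β (φ • η)).1 z =
      φ.1 z • (S.forms.curvTwo α β η).1 z := fun φ η => by
    rw [S.forms.curvTwo_smul, hJ, zero_smul, add_zero]; rfl
  refine twoForm_induction z (p := fun η => (S.forms.curvTwo α β η).1 z = 0) ?_ ?_ ?_ ?_ η
  · intro φ ψ
    have e := S.forms.curvTwo_wedge α β (differential φ) (differential ψ)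
    rw [hR, hR, S.forms.wedge_zero_left, S.forms.wedge_zero_right, add_zero] at e
    exact congrFun (congrArg Subtype.val e) z
  · intro η θ hη hθ
    rw [S.forms.curvTwo_add, smoothTwoForms_add_apply, hη, hθ, add_zero]
  · intro φ η hη
    rw [hsmul, hη, smul_zero]
  · intro χ η hχ hη
    rwa [hsmul, hχ.self_of_nhds, one_smul] at hη

theorem metacurv_eq_zero {B : SmoothOneForms J N → SmoothOneForms J N → SmoothTwoForms J N}
    (hB : S.forms.IsBracket B)
    {B₁ : SmoothOneForms I₁ M₁ → SmoothOneForms I₁ M₁ → SmoothTwoForms I₁ M₁}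
    (hB₁ : S₁.forms.IsBracket B₁)
    {B₂ : SmoothOneForms I₂ M₂ → SmoothOneForms I₂ M₂ → SmoothTwoForms I₂ M₂}
    (hB₂ : S₂.forms.IsBracket B₂) (hM₁ : ∀ φ α β, S₁.forms.metacurv B₁ φ α β = 0)
    (hM₂ : ∀ φ α β, S₂.forms.metacurv B₂ φ α β = 0) (φ : SmoothFunctions J N)
    (α β : SmoothOneForms J N) : S.forms.metacurv B φ α β = 0 := by
  have hR := h.curv_eq_zero h₁ h₂
  have d₁ := fun φ => (pullbackOne_differential h.smooth_fst φ).symm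
  have d₂ := fun φ => (pullbackOne_differential h.smooth_snd φ).symm
  have right : ∀ {φ α},
      (∀ ψ, S.forms.metacurv B φ α (differential (pullbackFun h.smooth_fst ψ)) = 0) →
      (∀ ψ, S.forms.metacurv B φ α (differential (pullbackFun h.smooth_snd ψ)) = 0) →
      ∀ β, S.forms.metacurv B φ α β = 0 := fun e₁ e₂ β => smoothTwoForms_ext fun z =>
    h.eq_zero_of_tensorial z (L := fun β => (S.forms.metacurv B _ _ β).1 z)
      (fun β β' => by rw [hB.metacurv_add_right]; rfl)
      (fun χ β => by rw [hB.metacurv_smul_right _ _ _ _ (hR _ _ _)]; rfl)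
      (fun φ => congrFun (congrArg Subtype.val (e₁ φ)) z)
      (fun φ => congrFun (congrArg Subtype.val (e₂ φ)) z) β
  have swap : ∀ φ α β, S.forms.metacurv B φ β α = 0 → S.forms.metacurv B φ α β = 0 :=
    fun φ α β e => by rw [hB.metacurv_symm, e]
  have comm : ∀ φ ψ β, S.forms.metacurv B ψ β (differential φ) = 0 →
      S.forms.metacurv B φ (differential ψ) β = 0 := fun φ ψ β e =>
    (hB.metacurv_d_comm φ ψ β (hR _ _ _) (h.curvTwo_eq_zero h₁ h₂ _ _ _)).trans (swap _ _ _ e)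
  refine right (fun ψ => swap _ _ _ (right (fun χ => comm _ _ _ ?_) (fun χ => comm _ _ _ ?_) α))
    (fun ψ => swap _ _ _ (right (fun χ => comm _ _ _ ?_) (fun χ => comm _ _ _ ?_) α)) β
  all_goals refine right (fun σ => ?_) (fun σ => ?_) (differential φ)
  all_goals simp only [d₁, d₂]
  · refine (h.lift.metacurv_map hB hB₁ _ _ _).trans ?_
    rw [hM₁, h.lift.mapW_zero, smul_zero]
  · exact h.isDisjoint_lift.metacurv_snd hB _ _ _
  · exact h.isDisjoint_lift.metacurv_mixed hB _ _ _
  · exact h.isDisjoint_lift.metacurv_fst hB hB₂ _ _ _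
  · exact h.symm.isDisjoint_lift.metacurv_fst hB hB₁ _ _ _
  · exact h.symm.isDisjoint_lift.metacurv_mixed hB _ _ _
  · exact h.symm.isDisjoint_lift.metacurv_snd hB _ _ _
  · refine (h.symm.lift.metacurv_map hB hB₂ _ _ _).trans ?_
    rw [hM₂, h.symm.lift.mapW_zero, smul_zero]

end Ascent

end IsSplitting

end Splitting

section Splitting

variable {E₁ : Type*} [NormedAddCommGroup E₁] [NormedSpace ℝ E₁] [FiniteDimensional ℝ E₁]
  {H₁ : Type*} [TopologicalSpace H₁] {I₁ : ModelWithCorners ℝ E₁ H₁}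
  {M₁ : Type*} [TopologicalSpace M₁] [ChartedSpace H₁ M₁] [IsManifold I₁ ∞ M₁] [I₁.Boundaryless]
  [T2Space M₁]
  {E₂ : Type*} [NormedAddCommGroup E₂] [NormedSpace ℝ E₂] [FiniteDimensional ℝ E₂]
  {H₂ : Type*} [TopologicalSpace H₂] {I₂ : ModelWithCorners ℝ E₂ H₂}
  {M₂ : Type*} [TopologicalSpace M₂] [ChartedSpace H₂ M₂] [IsManifold I₂ ∞ M₂] [I₂.Boundaryless]
  [T2Space M₂]
  {F : Type*} [NormedAddCommGroup F] [NormedSpace ℝ F] [FiniteDimensional ℝ F]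
  {K : Type*} [TopologicalSpace K] {J : ModelWithCorners ℝ F K}
  {N : Type*} [TopologicalSpace N] [ChartedSpace K N] [IsManifold J ∞ N] [J.Boundaryless]
  [T2Space N]

/-- Metaflatness in terms of a given Levi-Civita connection. -/
def LeviCivitaData.HasMetaflatConnection (S : LeviCivitaData J N) : Prop :=
  IsFlat S.P S.D ∧ ∃ B : OneForm J N → OneForm J N → CovTwoTensor J N, IsOneFormBracket S.P S.D B ∧
    ∀ (φ : N → ℝ) (α β : OneForm J N), SmoothFun J φ → SmoothOneForm α → SmoothOneForm β →
      metacurvature S.P S.D B φ α β = 0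

theorem LeviCivitaData.exists_bracket (S : LeviCivitaData J N) :
    ∃ B : OneForm J N → OneForm J N → CovTwoTensor J N, IsOneFormBracket S.P S.D B :=
  exists_isOneFormBracket S.smooth S.alternating S.leviCivita.toIsContravariantConnection
    S.leviCivita.torsionFree

namespace IsSplitting

variable {S : LeviCivitaData J N} {S₁ : LeviCivitaData I₁ M₁} {S₂ : LeviCivitaData I₂ M₂}
  {p : N → M₁} {q : N → M₂} {m₁ w₁ m₂ w₂ : SmoothFunctions J N}
  (h : IsSplitting S S₁ S₂ p q m₁ w₁ m₂ w₂)
include h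

theorem hasMetaflatConnection_fst (hp : ∀ y, ∃ z, p z = y ∧ m₁.1 z ≠ 0)
    (hs : ∀ z, Function.Surjective (mfderiv J I₁ p z)) (hS : S.HasMetaflatConnection) :
    S₁.HasMetaflatConnection := by
  obtain ⟨hflat, B, hB, hM⟩ := hS
  obtain ⟨B₁, hB₁⟩ := S₁.exists_bracket
  rw [S.isFlat_iff] at hflat
  rw [LeviCivitaData.metacurvature_eq_zero_iff hB] at hM
  refine ⟨S₁.isFlat_iff.2 (h.curv_fst hp hs hflat), B₁, hB₁, ?_⟩
  rw [LeviCivitaData.metacurvature_eq_zero_iff hB₁]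
  exact h.metacurv_fst hp hs hflat (LeviCivitaData.isBracket_bracketForm hB) hM
    (LeviCivitaData.isBracket_bracketForm hB₁)

theorem hasMetaflatConnection_of_factors (hS₁ : S₁.HasMetaflatConnection)
    (hS₂ : S₂.HasMetaflatConnection) : S.HasMetaflatConnection := by
  obtain ⟨hflat₁, B₁, hB₁, hM₁⟩ := hS₁
  obtain ⟨hflat₂, B₂, hB₂, hM₂⟩ := hS₂
  obtain ⟨B, hB⟩ := S.exists_bracket
  rw [S₁.isFlat_iff] at hflat₁
  rw [S₂.isFlat_iff] at hflat₂
  rw [LeviCivitaData.metacurvature_eq_zero_iff hB₁] at hM₁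
  rw [LeviCivitaData.metacurvature_eq_zero_iff hB₂] at hM₂
  refine ⟨S.isFlat_iff.2 (h.curv_eq_zero hflat₁ hflat₂), B, hB, ?_⟩
  rw [LeviCivitaData.metacurvature_eq_zero_iff hB]
  exact h.metacurv_eq_zero hflat₁ hflat₂ (LeviCivitaData.isBracket_bracketForm hB)
    (LeviCivitaData.isBracket_bracketForm hB₁) (LeviCivitaData.isBracket_bracketForm hB₂) hM₁ hM₂

end IsSplitting

end Splitting

/-! ### Cometrics and bivector fields -/

section Tensor

theorem apply_inverse_of_nondegenerate {V : Type*} [NormedAddCommGroup V] [NormedSpace ℝ V]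
    [FiniteDimensional ℝ V] (B : V →L[ℝ] V →L[ℝ] ℝ) (hB : ∀ u, (∀ v, B u v = 0) → u = 0)
    (a : V →L[ℝ] ℝ) : B (B.inverse a) = a := by
  have hinj : Function.Injective (B : V →ₗ[ℝ] V →L[ℝ] ℝ) := (injective_iff_map_eq_zero _).2
    fun u hu => hB u fun v => congrArg (fun c : V →L[ℝ] ℝ => c v) hu
  have hdim : Module.finrank ℝ V = Module.finrank ℝ (V →L[ℝ] ℝ) :=
    (Subspace.dual_finrank_eq (K := ℝ) (V := V)).symm.trans
      (LinearMap.toContinuousLinearMap (𝕜 := ℝ) (E := V) (F' := ℝ)).finrank_eq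
  let e : V ≃L[ℝ] (V →L[ℝ] ℝ) :=
    (LinearEquiv.ofInjectiveOfFinrankEq (B : V →ₗ[ℝ] V →L[ℝ] ℝ) hinj hdim).toContinuousLinearEquiv
  have he : (e : V →L[ℝ] V →L[ℝ] ℝ) = B := by ext u v; rfl
  rw [← he, ContinuousLinearMap.inverse_equiv]
  exact e.apply_symm_apply a

variable {E : Type*} [NormedAddCommGroup E] [NormedSpace ℝ E] [FiniteDimensional ℝ E]
  {H : Type*} [TopologicalSpace H] {I : ModelWithCorners ℝ E H}
  {M : Type*} [TopologicalSpace M] [ChartedSpace H M] [IsManifold I ∞ M]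

theorem BivectorField.isSmoothPairing (P : BivectorField I M) : IsSmoothPairing P.form :=
  fun α β => SmoothContraTwoTensor.apply P.smooth α.2 β.2

namespace PseudoRiemannianMetric

variable (g : PseudoRiemannianMetric I M)

/-- The musical isomorphism from covectors to vectors. -/
def raise (x : M) : (TangentSpace I x →L[ℝ] ℝ) →L[ℝ] TangentSpace I x := (g.form x).inverse

theorem form_raise (x : M) (a : TangentSpace I x →L[ℝ] ℝ) : g.form x (g.raise x a) = a :=
  apply_inverse_of_nondegenerate (V := E) (g.form x) (g.nondegenerate x) a

theorem cometric_apply (x : M) (a b : TangentSpace I x →L[ℝ] ℝ) :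
    g.cometric x a b = a (g.raise x b) := by
  change g.form x (g.raise x a) (g.raise x b) = _
  rw [form_raise]

theorem cometric_symm (x : M) (a b : TangentSpace I x →L[ℝ] ℝ) :
    g.cometric x a b = g.cometric x b a :=
  g.symm x _ _

variable [I.Boundaryless] [T2Space M]

theorem isSmoothPairing_cometric : IsSmoothPairing g.cometric := by
  intro α β x₀
  obtain ⟨F⟩ := exists_coordinateFrame I x₀
  let s : Fin (Module.finrank ℝ E) → M → ℝ := fun b x =>
    dFun (F.coord b) x (g.raise x (β.1 x))
  let G : Matrix (Fin (Module.finrank ℝ E)) (Fin (Module.finrank ℝ E)) (SmoothFunctions I M) :=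
    fun a b => ⟨fun x => g.form x (F.field a x) (F.field b x),
      SmoothCovTwoTensor.apply g.smooth (F.smooth_field a) (F.smooth_field b)⟩
  have hs : ∀ b, ContMDiffAt I 𝓘(ℝ, ℝ) ∞ (s b) x₀ := by
    refine contMDiffAt_of_linear_system G (fun a => F.cutoffFun * F.coeff a β) s ?_ fun x a => ?_
    · intro h0
      obtain ⟨v, hv, hGv⟩ := Matrix.exists_mulVec_eq_zero_iff.2 h0
      apply hv
      have hw : ∑ b, v b • F.field b x₀ = 0 := by
        refine g.nondegenerate x₀ _ fun u => ?_
        have hu := F.decomp x₀ u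
        rw [F.cutoff_self, one_smul] at hu
        rw [hu, map_sum]
        refine Finset.sum_eq_zero fun a _ => ?_
        rw [map_smul, g.symm, map_sum]
        have h1 := congrFun hGv a
        have h2 : ∑ b, g.form x₀ (F.field a x₀) (v b • F.field b x₀) = 0 := by
          refine Eq.trans (Finset.sum_congr rfl fun b _ => ?_) h1
          rw [map_smul]
          exact mul_comm _ _
        rw [h2, smul_zero]
      funext b
      have h3 := congrArg (dFun (I := I) (F.coord b) x₀) hw
      simp only [map_sum, map_smul, F.dual, F.cutoff_self, smul_eq_mul, mul_ite, mul_one,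
        mul_zero, Finset.sum_ite_eq, Finset.mem_univ, if_true, map_zero] at h3
      exact h3
    · have h1 := congrArg (g.form x (F.field a x)) (F.decomp x (g.raise x (β.1 x)))
      rw [map_smul, map_sum, g.symm, form_raise] at h1
      change _ = F.cutoff x * β.1 x (F.field a x)
      refine Eq.trans (Finset.sum_congr rfl fun b _ => ?_) h1.symm
      rw [map_smul]
      exact mul_comm _ _
  have h5 : ContMDiffAt I 𝓘(ℝ, ℝ) ∞ (fun x => ∑ b, s b x * (F.coeff b α).1 x) x₀ :=
    ContMDiffAt.sum fun b _ => (hs b).mul ((F.coeff b α).2 x₀)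
  refine h5.congr_of_eventuallyEq ?_
  filter_upwards [F.cutoff_eventuallyEq] with x hx
  have h6 := F.decomp x (g.raise x (β.1 x))
  rw [hx, one_smul] at h6
  have h7 := congrArg (α.1 x) h6
  rw [map_sum] at h7
  refine (g.cometric_apply x _ _).trans (h7.trans (Finset.sum_congr rfl fun b _ => ?_))
  rw [map_smul]
  rfl

theorem isContravariantMetric_cometric : IsContravariantMetric g.cometric where
  smooth := g.isSmoothPairing_cometric
  symm := g.cometric_symm
  nondegenerate x a ha := by
    have h1 : g.raise x a = 0 := eq_of_covectors fun c => by
      rw [map_zero, ← cometric_apply, cometric_symm]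
      exact ha c
    rw [← g.form_raise x a, h1, map_zero]

end PseudoRiemannianMetric

end Tensor

/-! ### Warped products -/

section Restriction

variable {E : Type*} [NormedAddCommGroup E] [NormedSpace ℝ E] [FiniteDimensional ℝ E]
  {H : Type*} [TopologicalSpace H] {I : ModelWithCorners ℝ E H}
  {M : Type*} [TopologicalSpace M] [ChartedSpace H M] [IsManifold I ∞ M] [I.Boundaryless]
  [T2Space M]
  {F : Type*} [NormedAddCommGroup F] [NormedSpace ℝ F] [FiniteDimensional ℝ F]
  {K : Type*} [TopologicalSpace K] {J : ModelWithCorners ℝ F K}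
  {N : Type*} [TopologicalSpace N] [ChartedSpace K N] [IsManifold J ∞ N]

/-- Restricting smooth `1`-forms along a smooth family of linear maps and pairing them with a
smooth contravariant tensor gives a smooth function. -/
theorem smoothFun_pairing_comp {p : N → M} (hp : ContMDiff J I ∞ p)
    {T : Π z : N, TangentSpace I (p z) →L[ℝ] TangentSpace J z}
    (hT : ∀ X : VField I M, SmoothVField X → SmoothVField (fun z => T z (X (p z)) : VField J N))
    {Q : ContraTwoTensor I M} (hQ : IsSmoothPairing Q) {α β : OneForm J N} (hα : SmoothOneForm α)
    (hβ : SmoothOneForm β) :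
    SmoothFun J (fun z => Q (p z) ((α z).comp (T z)) ((β z).comp (T z))) := by
  intro z₀
  obtain ⟨F⟩ := exists_coordinateFrame I (p z₀)
  have h1 : ContMDiffAt J 𝓘(ℝ, ℝ) ∞ (fun z => ∑ a, ∑ b, α z (T z (F.field a (p z))) *
      (β z (T z (F.field b (p z))) *
        pairing Q (differential (F.coordFun a)).1 (differential (F.coordFun b)).1 (p z))) z₀ :=
    ContMDiffAt.sum fun a _ => ContMDiffAt.sum fun b _ =>
      (SmoothOneForm.apply hα (hT _ (F.smooth_field a)) z₀).mul
        ((SmoothOneForm.apply hβ (hT _ (F.smooth_field b)) z₀).mul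
          (ContMDiff.comp (hQ (differential (F.coordFun a)) (differential (F.coordFun b))) hp z₀))
  refine h1.congr_of_eventuallyEq ?_
  filter_upwards [hp.continuous.continuousAt.eventually F.cutoff_eventuallyEq] with z hz
  have ha := F.covector_decomp (p z) ((α z).comp (T z))
  have hb := F.covector_decomp (p z) ((β z).comp (T z))
  rw [hz, one_smul] at ha hb
  rw [ha, map_sum, sum_apply]
  refine Finset.sum_congr rfl fun a _ => ?_
  rw [map_smul, smul_apply, hb, map_sum, Finset.smul_sum]
  refine Finset.sum_congr rfl fun b _ => ?_
  rw [map_smul]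
  rfl

end Restriction

theorem dFun_eq_zero_of_isEssentiallyConstant {E : Type*} [NormedAddCommGroup E] [NormedSpace ℝ E]
    {H : Type*} [TopologicalSpace H] {I : ModelWithCorners ℝ E H} {M : Type*} [TopologicalSpace M]
    [ChartedSpace H M] [LocallyConnectedSpace H] {μ : M → ℝ} (hμ : IsEssentiallyConstant μ) :
    (dFun μ : OneForm I M) = 0 := by
  have : LocallyConnectedSpace M := ChartedSpace.locallyConnectedSpace H M
  funext x
  have h : μ =ᶠ[𝓝 x] fun _ => μ x := by
    filter_upwards [isOpen_connectedComponent.mem_nhds (mem_connectedComponent (x := x))] with y hy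
    exact hμ x y hy
  exact (dFun_congr h).trans (congrFun (dFun_const (μ x)) x)

section Product

variable {E₁ : Type*} [NormedAddCommGroup E₁] [NormedSpace ℝ E₁] [FiniteDimensional ℝ E₁]
  {H₁ : Type*} [TopologicalSpace H₁] {I₁ : ModelWithCorners ℝ E₁ H₁}
  {M₁ : Type*} [TopologicalSpace M₁] [ChartedSpace H₁ M₁] [IsManifold I₁ ∞ M₁] [I₁.Boundaryless]
  [T2Space M₁]
  {E₂ : Type*} [NormedAddCommGroup E₂] [NormedSpace ℝ E₂] [FiniteDimensional ℝ E₂]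
  {H₂ : Type*} [TopologicalSpace H₂] {I₂ : ModelWithCorners ℝ E₂ H₂}
  {M₂ : Type*} [TopologicalSpace M₂] [ChartedSpace H₂ M₂] [IsManifold I₂ ∞ M₂] [I₂.Boundaryless]
  [T2Space M₂]

theorem hLiftVec_apply (z : M₁ × M₂) (u : TangentSpace I₁ z.1) :
    (hLiftVec z u : TangentSpace (I₁.prod I₂) z) = ((u, 0) : E₁ × E₂) :=
  congrArg (fun T : E₁ →L[ℝ] E₁ × E₂ => T u)
    (mfderiv_prod_left (I := I₁) (I' := I₂) (x₀ := z.1) (y₀ := z.2))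

theorem vLiftVec_apply (z : M₁ × M₂) (u : TangentSpace I₂ z.2) :
    (vLiftVec z u : TangentSpace (I₁.prod I₂) z) = ((0, u) : E₁ × E₂) :=
  congrArg (fun T : E₂ →L[ℝ] E₁ × E₂ => T u)
    (mfderiv_prod_right (I := I₁) (I' := I₂) (x₀ := z.1) (y₀ := z.2))

theorem mfderiv_fst_apply (z : M₁ × M₂) (u : TangentSpace (I₁.prod I₂) z) :
    mfderiv (I₁.prod I₂) I₁ (Prod.fst : M₁ × M₂ → M₁) z u = (show E₁ × E₂ from u).1 :=
  congrArg (fun T : E₁ × E₂ →L[ℝ] E₁ => T u) (mfderiv_fst (I := I₁) (I' := I₂) (x := z))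

theorem mfderiv_snd_apply (z : M₁ × M₂) (u : TangentSpace (I₁.prod I₂) z) :
    mfderiv (I₁.prod I₂) I₂ (Prod.snd : M₁ × M₂ → M₂) z u = (show E₁ × E₂ from u).2 :=
  congrArg (fun T : E₁ × E₂ →L[ℝ] E₂ => T u) (mfderiv_snd (I := I₁) (I' := I₂) (x := z))

theorem smoothVField_hLiftVec {X : VField I₁ M₁} (hX : SmoothVField X) :
    SmoothVField (fun z : M₁ × M₂ => hLiftVec z (X z.1) : VField (I₁.prod I₂) (M₁ × M₂)) := by
  have : IsManifold I₁ 1 M₁ := IsManifold.of_le (n := ∞) (by simp)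
  have : IsManifold I₂ 1 M₂ := IsManifold.of_le (n := ∞) (by simp)
  have h1 : ContMDiff (I₁.prod I₂) (I₁.prod 𝓘(ℝ, E₁)) ∞ (fun z : M₁ × M₂ =>
      TotalSpace.mk' E₁ (E := TangentSpace I₁) z.1 (X z.1)) := hX.comp contMDiff_fst
  have h2 : ContMDiff (I₁.prod I₂) (I₂.prod 𝓘(ℝ, E₂)) ∞ (fun z : M₁ × M₂ =>
      TotalSpace.mk' E₂ (E := TangentSpace I₂) z.2 0) :=
    (contMDiff_zeroSection ℝ (fun x : M₂ => TangentSpace I₂ x)).comp contMDiff_snd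
  have h3 := (contMDiff_equivTangentBundleProd_symm (I := I₁) (I' := I₂) (M := M₁) (M' := M₂)
    (n := ∞)).comp (h1.prodMk h2)
  refine h3.congr fun z => ?_
  exact congrArg (fun w => (⟨z, w⟩ : TangentBundle (I₁.prod I₂) (M₁ × M₂))) (hLiftVec_apply z _)

theorem smoothVField_vLiftVec {X : VField I₂ M₂} (hX : SmoothVField X) :
    SmoothVField (fun z : M₁ × M₂ => vLiftVec z (X z.2) : VField (I₁.prod I₂) (M₁ × M₂)) := by
  have : IsManifold I₁ 1 M₁ := IsManifold.of_le (n := ∞) (by simp)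
  have : IsManifold I₂ 1 M₂ := IsManifold.of_le (n := ∞) (by simp)
  have h1 : ContMDiff (I₁.prod I₂) (I₂.prod 𝓘(ℝ, E₂)) ∞ (fun z : M₁ × M₂ =>
      TotalSpace.mk' E₂ (E := TangentSpace I₂) z.2 (X z.2)) := hX.comp contMDiff_snd
  have h2 : ContMDiff (I₁.prod I₂) (I₁.prod 𝓘(ℝ, E₁)) ∞ (fun z : M₁ × M₂ =>
      TotalSpace.mk' E₁ (E := TangentSpace I₁) z.1 0) :=
    (contMDiff_zeroSection ℝ (fun x : M₁ => TangentSpace I₁ x)).comp contMDiff_fst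
  have h3 := (contMDiff_equivTangentBundleProd_symm (I := I₁) (I' := I₂) (M := M₁) (M' := M₂)
    (n := ∞)).comp (h2.prodMk h1)
  refine h3.congr fun z => ?_
  exact congrArg (fun w => (⟨z, w⟩ : TangentBundle (I₁.prod I₂) (M₁ × M₂))) (vLiftVec_apply z _)

theorem warped_apply (φ : M₁ → ℝ) (Q₁ : ContraTwoTensor I₁ M₁) (Q₂ : ContraTwoTensor I₂ M₂)
    (z : M₁ × M₂) (a b : TangentSpace (I₁.prod I₂) z →L[ℝ] ℝ) :
    warped φ Q₁ Q₂ z a b = Q₁ z.1 (a.comp (hLiftVec z)) (b.comp (hLiftVec z)) +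
      φ z.1 * Q₂ z.2 (a.comp (vLiftVec z)) (b.comp (vLiftVec z)) := rfl

theorem comp_mfderiv_fst_comp_hLiftVec (z : M₁ × M₂) (a : TangentSpace I₁ z.1 →L[ℝ] ℝ) :
    (a.comp (mfderiv (I₁.prod I₂) I₁ (Prod.fst : M₁ × M₂ → M₁) z)).comp (hLiftVec z) = a := by
  ext u
  refine congrArg a ((mfderiv_fst_apply z _).trans ?_)
  exact congrArg (fun w : E₁ × E₂ => w.1) (hLiftVec_apply z u)

theorem comp_mfderiv_fst_comp_vLiftVec (z : M₁ × M₂) (a : TangentSpace I₁ z.1 →L[ℝ] ℝ) :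
    (a.comp (mfderiv (I₁.prod I₂) I₁ (Prod.fst : M₁ × M₂ → M₁) z)).comp (vLiftVec z) = 0 := by
  ext u
  refine (congrArg a ((mfderiv_fst_apply z _).trans ?_)).trans (map_zero a)
  exact congrArg (fun w : E₁ × E₂ => w.1) (vLiftVec_apply z u)

theorem comp_mfderiv_snd_comp_vLiftVec (z : M₁ × M₂) (a : TangentSpace I₂ z.2 →L[ℝ] ℝ) :
    (a.comp (mfderiv (I₁.prod I₂) I₂ (Prod.snd : M₁ × M₂ → M₂) z)).comp (vLiftVec z) = a := by
  ext u
  refine congrArg a ((mfderiv_snd_apply z _).trans ?_)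
  exact congrArg (fun w : E₁ × E₂ => w.2) (vLiftVec_apply z u)

theorem comp_mfderiv_snd_comp_hLiftVec (z : M₁ × M₂) (a : TangentSpace I₂ z.2 →L[ℝ] ℝ) :
    (a.comp (mfderiv (I₁.prod I₂) I₂ (Prod.snd : M₁ × M₂ → M₂) z)).comp (hLiftVec z) = 0 := by
  ext u
  refine (congrArg a ((mfderiv_snd_apply z _).trans ?_)).trans (map_zero a)
  exact congrArg (fun w : E₁ × E₂ => w.2) (hLiftVec_apply z u)

theorem covector_eq_add (z : M₁ × M₂) (c : TangentSpace (I₁.prod I₂) z →L[ℝ] ℝ) :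
    c = (c.comp (hLiftVec z)).comp (mfderiv (I₁.prod I₂) I₁ (Prod.fst : M₁ × M₂ → M₁) z) +
      (c.comp (vLiftVec z)).comp (mfderiv (I₁.prod I₂) I₂ (Prod.snd : M₁ × M₂ → M₂) z) := by
  ext u
  change c u = c (hLiftVec z _) + c (vLiftVec z _)
  rw [← map_add]
  refine congrArg c ?_
  rw [hLiftVec_apply, vLiftVec_apply]
  exact Prod.ext ((mfderiv_fst_apply z u).symm.trans (add_zero _).symm)
    ((mfderiv_snd_apply z u).symm.trans (zero_add _).symm)

variable {Q₁ : ContraTwoTensor I₁ M₁} {Q₂ : ContraTwoTensor I₂ M₂} {φ : M₁ → ℝ}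

theorem isSmoothPairing_warped (hφ : SmoothFun I₁ φ) (h₁ : IsSmoothPairing Q₁)
    (h₂ : IsSmoothPairing Q₂) : IsSmoothPairing (warped φ Q₁ Q₂) := fun α β =>
  ContMDiff.add
    (smoothFun_pairing_comp contMDiff_fst (fun _ => smoothVField_hLiftVec) h₁ α.2 β.2)
    (ContMDiff.mul (ContMDiff.comp hφ contMDiff_fst)
      (smoothFun_pairing_comp contMDiff_snd (fun _ => smoothVField_vLiftVec) h₂ α.2 β.2))

theorem isAlternatingField_warped (h₁ : IsAlternatingField Q₁) (h₂ : IsAlternatingField Q₂) :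
    IsAlternatingField (warped φ Q₁ Q₂) := fun z a => by
  rw [warped_apply, h₁, h₂, mul_zero, add_zero]

theorem isContravariantMetric_warped (hφ : SmoothFun I₁ φ) (hpos : ∀ x, φ x ≠ 0)
    (h₁ : IsContravariantMetric Q₁) (h₂ : IsContravariantMetric Q₂) :
    IsContravariantMetric (warped φ Q₁ Q₂) where
  smooth := isSmoothPairing_warped hφ h₁.smooth h₂.smooth
  symm z a b := by rw [warped_apply, warped_apply, h₁.symm, h₂.symm]
  nondegenerate z c hc := by
    have e₁ : c.comp (hLiftVec z) = 0 := h₁.nondegenerate z.1 _ fun a => by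
      have h := hc (a.comp (mfderiv (I₁.prod I₂) I₁ (Prod.fst : M₁ × M₂ → M₁) z))
      rwa [warped_apply, comp_mfderiv_fst_comp_hLiftVec, comp_mfderiv_fst_comp_vLiftVec, map_zero,
        mul_zero, add_zero] at h
    have e₂ : c.comp (vLiftVec z) = 0 := h₂.nondegenerate z.2 _ fun a => by
      have h := hc (a.comp (mfderiv (I₁.prod I₂) I₂ (Prod.snd : M₁ × M₂ → M₂) z))
      rw [warped_apply, comp_mfderiv_snd_comp_hLiftVec, comp_mfderiv_snd_comp_vLiftVec, map_zero,
        zero_add] at h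
      exact (mul_eq_zero.1 h).resolve_left (hpos _)
    rw [covector_eq_add z c, e₁, e₂, ContinuousLinearMap.zero_comp, ContinuousLinearMap.zero_comp,
      add_zero]

theorem isSplitting_warped {f μ : SmoothFunctions I₁ M₁} (S₁ : LeviCivitaData I₁ M₁) (S₂ : LeviCivitaData I₂ M₂)
    {S : LeviCivitaData (I₁.prod I₂) (M₁ × M₂)} (hg : S.g = warped f.1 S₁.g S₂.g)
    (hP : S.P = warped μ.1 S₁.P S₂.P) (hcas : IsCasimir S₁.P f.1)
    (hdμ : differential μ = 0) :
    IsSplitting S S₁ S₂ Prod.fst Prod.snd 1 1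
      (pullbackFun (J := I₁.prod I₂) (N := M₁ × M₂) contMDiff_fst μ)
      (pullbackFun (J := I₁.prod I₂) (N := M₁ × M₂) contMDiff_fst f) where
  smooth_fst := contMDiff_fst
  smooth_snd := contMDiff_snd
  span z c := ⟨_, _, covector_eq_add z c⟩
  biv_fst z a b := by
    rw [hP, warped_apply, comp_mfderiv_fst_comp_hLiftVec, comp_mfderiv_fst_comp_hLiftVec,
      comp_mfderiv_fst_comp_vLiftVec, map_zero, zero_apply, mul_zero, add_zero]
    exact (one_mul _).symm
  biv_snd z a b := by
    rw [hP, warped_apply, comp_mfderiv_snd_comp_vLiftVec, comp_mfderiv_snd_comp_vLiftVec,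
      comp_mfderiv_snd_comp_hLiftVec, map_zero, zero_apply, zero_add]
    rfl
  biv_mixed z a b := by
    rw [hP, warped_apply, comp_mfderiv_fst_comp_vLiftVec, comp_mfderiv_snd_comp_hLiftVec,
      map_zero, map_zero, zero_apply, mul_zero, add_zero]
  metric_fst z a b := by
    rw [hg, warped_apply, comp_mfderiv_fst_comp_hLiftVec, comp_mfderiv_fst_comp_hLiftVec,
      comp_mfderiv_fst_comp_vLiftVec, map_zero, zero_apply, mul_zero, add_zero]
    exact (one_mul _).symm
  metric_snd z a b := by
    rw [hg, warped_apply, comp_mfderiv_snd_comp_vLiftVec, comp_mfderiv_snd_comp_vLiftVec,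
      comp_mfderiv_snd_comp_hLiftVec, map_zero, zero_apply, zero_add]
    rfl
  metric_mixed z a b := by
    rw [hg, warped_apply, comp_mfderiv_fst_comp_vLiftVec, comp_mfderiv_snd_comp_hLiftVec,
      map_zero, map_zero, zero_apply, mul_zero, add_zero]
  constant_fst := Subtype.ext (dFun_const 1)
  constant_snd := by
    rw [← pullbackOne_differential, hdμ]
    exact smoothOneForms_ext fun z => ContinuousLinearMap.zero_comp _
  casimir_fst α := smoothFunctions_ext fun z => by
    have h : dFun (I := I₁.prod I₂) (fun _ : M₁ × M₂ => (1 : ℝ)) z = 0 :=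
      congrFun (dFun_const 1) z
    exact (congrArg (S.P z (α.1 z)) h).trans (map_zero _)
  casimir_snd α := smoothFunctions_ext fun z => by
    change S.P z (α.1 z) ((differential (pullbackFun contMDiff_fst f)).1 z) = 0
    have h : ∀ a, S₁.P z.1 a ((differential f).1 z.1) = 0 := fun a => by
      rw [pairing_swap_of_alternating S₁.alternating, ← apply_sharpAt]
      have e : sharpAt S₁.P z.1 ((differential f).1 z.1) = 0 := hcas z.1
      rw [e, map_zero, neg_zero]
    rw [differential_pullbackFun_apply, hP, warped_apply, comp_mfderiv_fst_comp_hLiftVec,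
      comp_mfderiv_fst_comp_vLiftVec, map_zero, mul_zero, add_zero]
    exact h _

theorem isMetaflat_warped_iff [Nonempty M₁] [Nonempty M₂] {g₁ P₁ : ContraTwoTensor I₁ M₁}
    {g₂ P₂ : ContraTwoTensor I₂ M₂} (hg₁ : IsContravariantMetric g₁)
    (hg₂ : IsContravariantMetric g₂) (hP₁ : IsSmoothPairing P₁) (hA₁ : IsAlternatingField P₁)
    (hP₂ : IsSmoothPairing P₂) (hA₂ : IsAlternatingField P₂) {f μ : M₁ → ℝ}
    (hf : SmoothFun I₁ f) (hpos : ∀ x, f x ≠ 0) (hcas : IsCasimir P₁ f) (hμ : SmoothFun I₁ μ)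
    (hμ0 : ∃ x, μ x ≠ 0) (hdμ : (dFun μ : OneForm I₁ M₁) = 0) :
    IsMetaflat (warped f g₁ g₂) (warped μ P₁ P₂) ↔ IsMetaflat g₁ P₁ ∧ IsMetaflat g₂ P₂ := by
  have hg := isContravariantMetric_warped hf hpos hg₁ hg₂
  have hP := isSmoothPairing_warped hμ hP₁ hP₂
  have hA := isAlternatingField_warped (φ := μ) hA₁ hA₂
  constructor
  · rintro ⟨D, hD, hflat⟩
    obtain ⟨D₁, hD₁⟩ := exists_isLeviCivita hP₁ hA₁ hg₁
    obtain ⟨D₂, hD₂⟩ := exists_isLeviCivita hP₂ hA₂ hg₂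
    have h := isSplitting_warped ⟨g₁, P₁, D₁, hg₁, hP₁, hA₁, hD₁⟩ ⟨g₂, P₂, D₂, hg₂, hP₂, hA₂, hD₂⟩
      (S := ⟨_, _, D, hg, hP, hA, hD⟩) (f := ⟨f, hf⟩) (μ := ⟨μ, hμ⟩) rfl rfl hcas (Subtype.ext hdμ)
    refine ⟨⟨D₁, hD₁, h.hasMetaflatConnection_fst (fun y => ?_) (fun z v => ?_) hflat⟩,
      ⟨D₂, hD₂, h.symm.hasMetaflatConnection_fst (fun y => ?_) (fun z v => ?_) hflat⟩⟩
    · exact ⟨(y, Classical.arbitrary M₂), rfl, one_ne_zero⟩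
    · exact ⟨((v, 0) : E₁ × E₂), mfderiv_fst_apply z _⟩
    · obtain ⟨x, hx⟩ := hμ0
      exact ⟨(x, y), rfl, hx⟩
    · exact ⟨((0, v) : E₁ × E₂), mfderiv_snd_apply z _⟩
  · rintro ⟨⟨D₁, hD₁, hflat₁⟩, ⟨D₂, hD₂, hflat₂⟩⟩
    obtain ⟨D, hD⟩ := exists_isLeviCivita hP hA hg
    have h := isSplitting_warped ⟨g₁, P₁, D₁, hg₁, hP₁, hA₁, hD₁⟩ ⟨g₂, P₂, D₂, hg₂, hP₂, hA₂, hD₂⟩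
      (S := ⟨_, _, D, hg, hP, hA, hD⟩) (f := ⟨f, hf⟩) (μ := ⟨μ, hμ⟩) rfl rfl hcas (Subtype.ext hdμ)
    exact ⟨D, hD, h.hasMetaflatConnection_of_factors hflat₁ hflat₂⟩

end Product

end PoissonGeometry

end

theorem theorem5p13
    {E₁ : Type*} [NormedAddCommGroup E₁] [NormedSpace ℝ E₁] [FiniteDimensional ℝ E₁]
    {M₁ : Type*} [TopologicalSpace M₁] [ChartedSpace E₁ M₁] [IsManifold 𝓘(ℝ, E₁) ∞ M₁]
    [T2Space M₁] [SecondCountableTopology M₁] [Nonempty M₁]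
    {E₂ : Type*} [NormedAddCommGroup E₂] [NormedSpace ℝ E₂] [FiniteDimensional ℝ E₂]
    {M₂ : Type*} [TopologicalSpace M₂] [ChartedSpace E₂ M₂] [IsManifold 𝓘(ℝ, E₂) ∞ M₂]
    [T2Space M₂] [SecondCountableTopology M₂] [Nonempty M₂]
    (g₁ : PseudoRiemannianMetric 𝓘(ℝ, E₁) M₁) (g₂ : PseudoRiemannianMetric 𝓘(ℝ, E₂) M₂)
    (P₁ : BivectorField 𝓘(ℝ, E₁) M₁) (P₂ : BivectorField 𝓘(ℝ, E₂) M₂)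
    (f μ : M₁ → ℝ)
    (hf : SmoothFun 𝓘(ℝ, E₁) f) (hf_pos : ∀ p, 0 < f p) (hf_casimir : IsCasimir P₁.form f)
    (hμ : SmoothFun 𝓘(ℝ, E₁) μ) (hμ_ne : μ ≠ 0) (hμ_const : IsEssentiallyConstant μ) :
    IsMetaflat (warped f g₁.cometric g₂.cometric) (warped μ P₁.form P₂.form) ↔
      IsMetaflat g₁.cometric P₁.form ∧ IsMetaflat g₂.cometric P₂.form := by
  refine isMetaflat_warped_iff g₁.isContravariantMetric_cometric g₂.isContravariantMetric_cometric
    P₁.isSmoothPairing P₁.alternating P₂.isSmoothPairing P₂.alternating hf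
    (fun p => (hf_pos p).ne') hf_casimir hμ ?_ (dFun_eq_zero_of_isEssentiallyConstant hμ_const)
  by_contra! h
  exact hμ_ne (funext h)
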